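/- **Conventions.** For a category $V$, $\mathcal{G}V$ is the category of graphs enriched in $V$: an object $X$ is a set $X_0$ of objects with an object $X(a,b)$ of $V$ for each $(a,b)\in X_0\times X_0$; a morphism $f:X\to Y$ is a function $f_0:X_0\to Y_0$ with morphisms $X(a,b)\to Y(f_0a,f_0b)$. The category of $n$-globular sets is $\mathcal{G}^n(\mathrm{Set})$. A *multitensor* $E$ on $V$ consists of functors $E_n:V^n\to V$ ($n\ge 0$), a unit $u_Z:Z\to E_1(Z)$ and substitutions $E_k(E_{n_1}(Z_{11},\dots,Z_{1n_1}),\dots,E_{n_k}(Z_{k1},\dots,Z_{kn_k}))\to E_{n_1+\dots+n_k}(Z_{11},\dots,Z_{kn_k})$, natural and satisfying the unit and associativity laws. It is *distributive* if each $E_n$ preserves coproducts in each variable. If $V$ has coproducts and $E$ is distributive, $\Gamma E$ is the monad on $\mathcal{G}V$ which is the identity on object sets, with $$(\Gamma E)(X)(a,b)=\coprod_{n\ge 0}\ \coprod_{a=x_0,x_1,\dots,x_n=b}E_n\big(X(x_0,x_1),\dots,X(x_{n-1},x_n)\big),$$ and with unit and multiplication induced by the unit and substitution of $E$ (and by concatenation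 of sequences). For a monad $T$ on a category with finite products, $T^\times$ is the multitensor $T^\times(Z_1,\dots,Z_n)=T(Z_1)\times\dots\times T(Z_n)$, with unit and substitution induced by the unit and multiplication of $T$. A strict $0$-category is a set; a strict $(n+1)$-category is a category enriched in the category of strict $n$-categories with respect to its cartesian product, and strict $(n+1)$-functors are the enriched functors. Forgetting identities and compositions at all levels gives a functor $U_n:n\text{-}\mathrm{Cat}\to\mathcal{G}^n(\mathrm{Set})$. **Theorem.** Let $\mathcal{T}_{\le 0}$ be the identity monad on $\mathrm{Set}=\mathcal{G}^0(\mathrm{Set})$ and, inductively, let $\mathcal{T}_{\le n+1}=\Gamma(\mathcal{T}_{\le n}^{\times})$, a monad on $\mathcal{G}^{n+1}(\mathrm{Set})$. (The categories $\mathcal{G}^n(\mathrm{Set})$ have coproducts and finite products, and the multitensors $\mathcal{T}_{\le n}^\times$ are distributive, so that this makes sense.) Then for every $n\ge 0$: 1. $\mathcal{T}_{\le n}$ is the strict $n$-category monad on $n$-globular sets: $U_n$ has a left adjoint, the monad induced by the adjunction is isomorphic, as a monad, to $\mathcal{T}_{\le n}$, and the comparison functor from strict $n$-categories to the algebras of the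 induced monad is an equivalence of categories; 2. $\mathcal{T}_{\le n}$ preserves all (small) coproducts; 3. $\mathcal{T}_{\le n}$ is finitary, that is, it preserves filtered colimits; 4. $\mathcal{T}_{\le n}$ is a local right adjoint monad: for every $n$-globular set $X$ the functor $\mathcal{G}^n(\mathrm{Set})/X\to\mathcal{G}^n(\mathrm{Set})/\mathcal{T}_{\le n}X$ induced by $\mathcal{T}_{\le n}$ has a left adjoint, and all naturality squares of the unit and of the multiplication of $\mathcal{T}_{\le n}$ are pullbacks. -/

import Mathlib

open CategoryTheory CategoryTheory.Limits

universe u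

set_option linter.unusedSectionVars false

noncomputable section

namespace GlobularMonads

/-! ### Enriched graphs -/

/-- A graph enriched in `V`: a set of objects and, for each ordered pair of objects, a hom in `V`. -/
structure EGraph (V : Type (u + 1)) : Type (u + 1) where
  Obj : Type u
  hom : Obj → Obj → V

namespace EGraph

/-- A morphism of enriched graphs: an object map together with hom maps. -/
structure Hom {V : Type (u + 1)} [LargeCategory.{u} V] (X Y : EGraph V) : Type u where
  obj : X.Obj → Y.Obj
  map : ∀ a b, X.hom a b ⟶ Y.hom (obj a) (obj b)

instance instCategory (V : Type (u + 1)) [LargeCategory.{u} V] : LargeCategory.{u} (EGraph V) where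
  Hom X Y := Hom X Y
  id X := { obj := fun a => a, map := fun _ _ => 𝟙 _ }
  comp f g := { obj := fun a => g.obj (f.obj a), map := fun a b => f.map a b ≫ g.map _ _ }
  id_comp f := by simp
  comp_id f := by simp
  assoc f g h := by simp

section
variable {V : Type (u + 1)} [LargeCategory.{u} V]

@[simp] theorem id_obj (X : EGraph V) (a : X.Obj) : Hom.obj (𝟙 X) a = a := rfl
@[simp] theorem id_map (X : EGraph V) (a b : X.Obj) : Hom.map (𝟙 X) a b = 𝟙 _ := rfl
@[simp] theorem comp_obj {X Y Z : EGraph V} (f : X ⟶ Y) (g : Y ⟶ Z) (a : X.Obj) :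
    Hom.obj (f ≫ g) a = g.obj (f.obj a) := rfl
@[simp] theorem comp_map {X Y Z : EGraph V} (f : X ⟶ Y) (g : Y ⟶ Z) (a b : X.Obj) :
    Hom.map (f ≫ g) a b = f.map a b ≫ g.map _ _ := rfl

/-- Transport of homs along equalities of objects. -/
def cast (X : EGraph V) {a a' b b' : X.Obj} (h : a = a') (k : b = b') : X.hom a b ⟶ X.hom a' b' :=
  eqToHom (by rw [h, k])

@[simp] theorem cast_rfl (X : EGraph V) {a b : X.Obj} (h : a = a) (k : b = b) :
    X.cast h k = 𝟙 _ := rfl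

@[simp]
theorem cast_trans (X : EGraph V) {a a' a'' b b' b'' : X.Obj} (h : a = a') (k : b = b')
    (h' : a' = a'') (k' : b' = b'') :
    X.cast h k ≫ X.cast h' k' = X.cast (h.trans h') (k.trans k') := by
  subst h k h' k'; simp

@[simp]
theorem cast_trans_assoc (X : EGraph V) {a a' a'' b b' b'' : X.Obj} (h : a = a') (k : b = b')
    (h' : a' = a'') (k' : b' = b'') {Z : V} (f : X.hom a'' b'' ⟶ Z) :
    X.cast h k ≫ X.cast h' k' ≫ f = X.cast (h.trans h') (k.trans k') ≫ f := by
  subst h k h' k'; simp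

instance (X : EGraph V) {a a' b b' : X.Obj} (h : a = a') (k : b = b') : IsIso (X.cast h k) := by
  unfold cast; infer_instance

theorem cast_map {X Y : EGraph V} (f : X ⟶ Y) {a a' b b' : X.Obj} (h : a = a') (k : b = b') :
    X.cast h k ≫ f.map a' b' = f.map a b ≫ Y.cast (congrArg f.obj h) (congrArg f.obj k) := by
  subst h k; simp

theorem hom_ext {X Y : EGraph V} {f g : X ⟶ Y} (h : ∀ a, f.obj a = g.obj a)
    (k : ∀ a b, f.map a b ≫ Y.cast (h a) (h b) = g.map a b) : f = g := by
  obtain ⟨f₀, f₁⟩ := f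
  obtain ⟨g₀, g₁⟩ := g
  obtain rfl : f₀ = g₀ := funext h
  congr 1
  funext a b
  simpa using k a b

end

theorem mk_ext {V : Type (u + 1)} [LargeCategory.{u} V] {X Y : EGraph V} {f₀ : X.Obj → Y.Obj}
    {f g : ∀ a b, X.hom a b ⟶ Y.hom (f₀ a) (f₀ b)} (h : ∀ a b, f a b = g a b) :
    (Hom.mk f₀ f : Hom X Y) = Hom.mk f₀ g := by
  rw [show f = g from funext fun a => funext fun b => h a b]

/-- The functor `𝒢F : 𝒢V ⥤ 𝒢W` induced by a functor `F : V ⥤ W`. -/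
@[simps]
def mapFunctor {V W : Type (u + 1)} [LargeCategory.{u} V] [LargeCategory.{u} W] (F : V ⥤ W) :
    EGraph V ⥤ EGraph W where
  obj X := { Obj := X.Obj, hom := fun a b => F.obj (X.hom a b) }
  map f := { obj := f.obj, map := fun a b => F.map (f.map a b) }
  map_id X := hom_ext (fun _ => rfl) (fun a b => by simp)
  map_comp f g := hom_ext (fun _ => rfl) (fun a b => by simp)

end EGraph

/-! ### Concatenation of finite sequences -/

/-- `Juxt n N` witnesses that `N` is the sum of the `n i`, through the bijection from pairs
`(i, j)`, `j < n i`, to `Fin N` which is increasing for the lexicographic order. It identifies the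
positions in a sequence of sequences with the positions in the concatenated sequence. -/
structure Juxt {k : ℕ} (n : Fin k → ℕ) (N : ℕ) where
  idx : ∀ i, Fin (n i) → Fin N
  lt_of_lt : ∀ {i i' : Fin k} (j : Fin (n i)) (j' : Fin (n i')), i < i' → idx i j < idx i' j'
  strictMono : ∀ i, StrictMono (idx i)
  surj : ∀ t, ∃ i j, idx i j = t

namespace Juxt

variable {k : ℕ} {n : Fin k → ℕ} {N : ℕ}

theorem lt_lex (e : Juxt n N) {a b : Σₗ i, Fin (n i)} (h : a < b) :
    e.idx (ofLex a).1 (ofLex a).2 < e.idx (ofLex b).1 (ofLex b).2 := by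
  cases h with
  | left _ _ h => exact e.lt_of_lt _ _ h
  | right _ _ h => exact e.strictMono _ h

/-- The associated order isomorphism. -/
def orderIso (e : Juxt n N) : (Σₗ i, Fin (n i)) ≃o Fin N :=
  StrictMono.orderIsoOfSurjective (fun a => e.idx (ofLex a).1 (ofLex a).2)
    (fun _ _ h => e.lt_lex h) (fun t => by
      obtain ⟨i, j, h⟩ := e.surj t
      exact ⟨toLex ⟨i, j⟩, h⟩)

theorem orderIso_apply (e : Juxt n N) (i : Fin k) (j : Fin (n i)) :
    e.orderIso (toLex ⟨i, j⟩) = e.idx i j := rfl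

theorem card_eq (e : Juxt n N) : N = ∑ i, n i := by
  have := Fintype.card_congr e.orderIso.toEquiv
  simpa using this.symm

theorem idx_eq (e e' : Juxt n N) (i : Fin k) (j : Fin (n i)) : e.idx i j = e'.idx i j := by
  rw [← orderIso_apply, ← orderIso_apply, Subsingleton.elim e.orderIso e'.orderIso]

theorem eq_of_juxt (e e' : Juxt n N) : e = e' := by
  have h : e.idx = e'.idx := funext fun i => funext fun j => idx_eq e e' i j
  obtain ⟨_, _, _, _⟩ := e
  obtain ⟨_, _, _, _⟩ := e'
  cases h
  rfl

/-- The block in which a position of the concatenated sequence lies. -/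
def fst (e : Juxt n N) (t : Fin N) : Fin k := (e.surj t).choose
/-- The position within its block of a position of the concatenated sequence. -/
def snd (e : Juxt n N) (t : Fin N) : Fin (n (e.fst t)) := (e.surj t).choose_spec.choose

@[simp] theorem idx_fst_snd (e : Juxt n N) (t : Fin N) : e.idx (e.fst t) (e.snd t) = t :=
  (e.surj t).choose_spec.choose_spec

theorem pair_inj (e : Juxt n N) {i i' : Fin k} {j : Fin (n i)} {j' : Fin (n i')}
    (h : e.idx i j = e.idx i' j') : (⟨i, j⟩ : Σ i, Fin (n i)) = ⟨i', j'⟩ := by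
  rw [← orderIso_apply, ← orderIso_apply] at h
  exact congrArg ofLex (e.orderIso.injective h)

/-- A sequence consisting of a single sequence. -/
@[reducible] def single (n : ℕ) : Juxt (fun _ : Fin 1 => n) n where
  idx _ j := j
  lt_of_lt {i i'} _ _ h := absurd h (by rw [Subsingleton.elim i i']; exact lt_irrefl _)
  strictMono _ _ _ h := h
  surj t := ⟨0, t, rfl⟩

/-- A sequence of sequences of length one. -/
@[reducible] def units (n : ℕ) : Juxt (fun _ : Fin n => 1) n where
  idx i _ := i
  lt_of_lt _ _ h := h
  strictMono _ j j' h := absurd h (by rw [Subsingleton.elim j j']; exact lt_irrefl _)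
  surj t := ⟨t, 0, rfl⟩

theorem exists_outer {k : ℕ} {n : Fin k → ℕ} {N₁ : ℕ} (e₁ : Juxt n N₁) {m : Fin N₁ → ℕ} {N : ℕ}
    (e₂ : Juxt m N) {M : Fin k → ℕ} (f : ∀ i, Juxt (fun j => m (e₁.idx i j)) (M i)) :
    ∃ g : Juxt M N, ∀ i j l, g.idx i ((f i).idx j l) = e₂.idx (e₁.idx i j) l := by
  let idx : ∀ i, Fin (M i) → Fin N := fun i u => e₂.idx (e₁.idx i ((f i).fst u)) ((f i).snd u)
  have h : ∀ i j l, idx i ((f i).idx j l) = e₂.idx (e₁.idx i j) l := by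
    intro i j l
    have key : ∀ (j' : Fin (n i)) (l' : Fin (m (e₁.idx i j'))), (f i).idx j' l' = (f i).idx j l →
        e₂.idx (e₁.idx i j') l' = e₂.idx (e₁.idx i j) l := by
      intro j' l' h
      have := (f i).pair_inj h
      cases this
      rfl
    exact key _ _ ((f i).idx_fst_snd _)
  refine ⟨⟨idx, ?_, ?_, ?_⟩, h⟩
  · intro i i' u u' hi
    exact e₂.lt_of_lt _ _ (e₁.lt_of_lt _ _ hi)
  · intro i u u' hu
    obtain ⟨j, l, rfl⟩ := (f i).surj u
    obtain ⟨j', l', rfl⟩ := (f i).surj u'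
    rw [h, h]
    rw [← orderIso_apply, ← orderIso_apply, OrderIso.lt_iff_lt] at hu
    cases hu with
    | left _ _ hj => exact e₂.lt_of_lt _ _ (e₁.strictMono i hj)
    | right _ _ hl => exact e₂.strictMono _ hl
  · intro t
    obtain ⟨s, l, rfl⟩ := e₂.surj t
    obtain ⟨i, j, rfl⟩ := e₁.surj s
    exact ⟨i, (f i).idx j l, h i j l⟩

theorem exists_append {O : Type u} : ∀ (k : ℕ) (n : Fin k → ℕ) (y : Fin (k + 1) → O)
    (x : ∀ i, Fin (n i + 1) → O) (_ : ∀ i, x i 0 = y i.castSucc)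
    (_ : ∀ i, x i (Fin.last _) = y i.succ), ∃ (N : ℕ) (e : Juxt n N) (v : Fin (N + 1) → O),
      v 0 = y 0 ∧ v (Fin.last _) = y (Fin.last _) ∧
      (∀ i j, v (e.idx i j).castSucc = x i j.castSucc) ∧
      (∀ i j, v (e.idx i j).succ = x i j.succ) := by
  intro k
  induction k with
  | zero =>
    intro n y x h0 h1
    exact ⟨0, ⟨fun i => i.elim0, fun {i} => i.elim0, fun i => i.elim0, fun t => t.elim0⟩,
      fun _ => y 0, rfl, rfl, fun i => i.elim0, fun i => i.elim0⟩
  | succ k ih =>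
    intro n y x h0 h1
    obtain ⟨N, e, v, v0, v1, hs, ht⟩ := ih (fun i => n i.castSucc) (fun i => y i.castSucc)
      (fun i => x i.castSucc) (fun i => h0 _) (fun i => h1 _)
    let m := n (Fin.last k)
    let idx : ∀ i, Fin (n i) → Fin (N + m) :=
      Fin.lastCases (motive := fun i => Fin (n i) → Fin (N + m)) (fun j => Fin.natAdd N j)
        (fun i j => Fin.castAdd m (e.idx i j))
    have idx_last : ∀ j, idx (Fin.last k) j = Fin.natAdd N j := fun j => by simp [idx]
    have idx_cast : ∀ i j, idx (Fin.castSucc i) j = Fin.castAdd m (e.idx i j) :=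
      fun i j => by simp [idx]
    let w : Fin (N + m + 1) → O := fun t =>
      if h : t.1 ≤ N then v ⟨t.1, by omega⟩ else x (Fin.last k) ⟨t.1 - N, by have := t.2; omega⟩
    have w_le : ∀ t (h : t.1 ≤ N), w t = v ⟨t.1, by omega⟩ := fun t h => by simp [w, h]
    have hv : v (Fin.last N) = x (Fin.last k) 0 := by rw [v1, h0]
    have w_ge : ∀ t (h : N ≤ t.1), w t = x (Fin.last k) ⟨t.1 - N, by have := t.2; omega⟩ := by
      intro t h
      by_cases h' : t.1 ≤ N
      · rw [w_le t h']
        have : t.1 = N := by omega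
        have h1 : (⟨t.1, by omega⟩ : Fin (N + 1)) = Fin.last N := Fin.ext this
        rw [h1, hv]
        congr 1
        exact Fin.ext (by simp [this])
      · simp [w, h']
    refine ⟨N + m, ⟨idx, ?_, ?_, ?_⟩, w, ?_, ?_, ?_, ?_⟩
    · intro i i'
      induction i using Fin.lastCases with
      | last => intro j j' h; exact absurd h (not_lt.mpr (Fin.le_last _))
      | cast i =>
        induction i' using Fin.lastCases with
        | last =>
          intro j j' _
          rw [idx_last, idx_cast]
          exact Fin.lt_def.mpr (by simp; omega)
        | cast i' =>
          intro j j' h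
          rw [idx_cast, idx_cast]
          exact e.lt_of_lt _ _ (by simpa using h)
    · intro i
      induction i using Fin.lastCases with
      | last => intro j j' h; rw [idx_last, idx_last]; simpa using h
      | cast i => intro j j' h; rw [idx_cast, idx_cast]; exact e.strictMono i h
    · intro t
      induction t using Fin.addCases with
      | left t =>
        obtain ⟨i, j, h⟩ := e.surj t
        exact ⟨i.castSucc, j, by rw [idx_cast, h]⟩
      | right t => exact ⟨Fin.last k, t, idx_last t⟩
    · rw [w_le _ (Nat.zero_le _)]; exact v0
    · rw [w_ge _ (by simp)]
      refine Eq.trans ?_ (h1 (Fin.last k))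
      congr 1
      exact Fin.ext (by simp [m])
    · intro i
      induction i using Fin.lastCases with
      | last =>
        intro j
        simp only [idx_last]
        rw [w_ge _ (by simp)]
        congr 1
        exact Fin.ext (by simp)
      | cast i =>
        intro j
        simp only [idx_cast]
        rw [w_le _ (by simp)]
        exact hs i j
    · intro i
      induction i using Fin.lastCases with
      | last =>
        intro j
        simp only [idx_last]
        rw [w_ge _ (by simp; omega)]
        congr 1
        exact Fin.ext (by simp; omega)
      | cast i =>
        intro j
        simp only [idx_cast]
        rw [w_le _ (by simp)]
        exact ht i j

end Juxt

/-! ### Multitensors -/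

/-- A multitensor (lax monoidal structure) on `V`: functors `Eₙ : Vⁿ ⥤ V`, a unit `Z ⟶ E₁(Z)` and
substitutions `Eᵢ Eⱼ Z_{ij} ⟶ E_{ij} Z_{ij}`, natural and satisfying the unit laws and
associativity. A sequence of sequences is presented by its concatenation `W` together with the
identification `e` of the positions; all the maps `eqToHom` below are identities between objects
in equal positions of the same sequence. -/
structure Multitensor (V : Type (u + 1)) [LargeCategory.{u} V] where
  tensor (n : ℕ) : (Fin n → V) ⥤ V
  unit (Z : V) : Z ⟶ (tensor 1).obj (fun _ => Z)
  unit_naturality {Z Z' : V} (f : Z ⟶ Z') :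
    unit Z ≫ (tensor 1).map (fun _ => f) = f ≫ unit Z'
  subst {k : ℕ} {n : Fin k → ℕ} {N : ℕ} (e : Juxt n N) (W : Fin N → V) :
    (tensor k).obj (fun i => (tensor (n i)).obj fun j => W (e.idx i j)) ⟶ (tensor N).obj W
  subst_naturality {k : ℕ} {n : Fin k → ℕ} {N : ℕ} (e : Juxt n N) {W W' : Fin N → V}
    (f : W ⟶ W') :
    subst e W ≫ (tensor N).map f =
      (tensor k).map (fun i => (tensor (n i)).map fun j => f (e.idx i j)) ≫ subst e W'
  unit_subst {n : ℕ} (e : Juxt (fun _ : Fin 1 => n) n) (h : ∀ i j, e.idx i j = j) (W : Fin n → V) :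
    unit ((tensor n).obj W) ≫
      (tensor 1).map (fun i => (tensor n).map fun j => eqToHom (congrArg W (h i j).symm)) ≫
        subst e W = 𝟙 _
  subst_unit {n : ℕ} (e : Juxt (fun _ : Fin n => 1) n) (h : ∀ i j, e.idx i j = i) (W : Fin n → V) :
    (tensor n).map (fun i => unit (W i) ≫
      (tensor 1).map fun j => eqToHom (congrArg W (h i j).symm)) ≫ subst e W = 𝟙 _
  assoc {k : ℕ} {n : Fin k → ℕ} {N₁ : ℕ} (e₁ : Juxt n N₁) {m : Fin N₁ → ℕ} {N : ℕ} (e₂ : Juxt m N)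
    {M : Fin k → ℕ} (f : ∀ i, Juxt (fun j => m (e₁.idx i j)) (M i)) (g : Juxt M N)
    (h : ∀ i j l, g.idx i ((f i).idx j l) = e₂.idx (e₁.idx i j) l) (W : Fin N → V) :
    (tensor k).map (fun i =>
        (tensor (n i)).map (fun j => (tensor (m (e₁.idx i j))).map fun l =>
          eqToHom (congrArg W (h i j l).symm)) ≫
        subst (f i) (fun s => W (g.idx i s))) ≫ subst g W =
      subst e₁ (fun t => (tensor (m t)).obj fun l => W (e₂.idx t l)) ≫ subst e₂ W

/-- `F : Vⁿ ⥤ V` preserves coproducts in each variable, in the joint form: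
given coproduct cocones `(Z i p ⟶ C i)` for `p : P i` and each `i`, the maps
`F (Z i (p i))ᵢ ⟶ F (C i)ᵢ` form a coproduct cocone indexed by all choice functions `p`. -/
def PreservesCoproductsInEachVariable {V : Type (u + 1)} [LargeCategory.{u} V] {n : ℕ}
    (F : (Fin n → V) ⥤ V) : Prop :=
  ∀ (P : Fin n → Type u) (Z : ∀ i, P i → V) (c : ∀ i, Cofan (Z i)),
    (∀ i, Nonempty (IsColimit (c i))) →
      Nonempty (IsColimit (Cofan.mk (f := fun p : ∀ i, P i => F.obj fun i => Z i (p i))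
        (F.obj fun i => (c i).pt) (fun p => F.map fun i => (c i).inj (p i))))

/-- A multitensor is distributive when it preserves coproducts in each variable. -/
def Multitensor.IsDistributive {V : Type (u + 1)} [LargeCategory.{u} V] (E : Multitensor V) :
    Prop :=
  ∀ n, PreservesCoproductsInEachVariable (E.tensor n)

/-- The `n`-fold product functor `Vⁿ ⥤ V`. -/
@[simps]
def prodFunctor (V : Type (u + 1)) [LargeCategory.{u} V] [HasFiniteProducts V] (n : ℕ) :
    (Fin n → V) ⥤ V where
  obj Z := ∏ᶜ Z
  map f := Limits.Pi.map f
  map_id Z := by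
    apply Limits.Pi.hom_ext
    intro i
    simp
  map_comp f g := by
    apply Limits.Pi.hom_ext
    intro i
    simp

section Times

variable {V : Type (u + 1)} [LargeCategory.{u} V] [HasFiniteProducts V] (T : Monad V)

/-- The functor `(Z₁, …, Zₙ) ↦ T Z₁ × ⋯ × T Zₙ`. -/
@[simps]
def timesTensor (n : ℕ) : (Fin n → V) ⥤ V where
  obj Z := ∏ᶜ fun i => T.obj (Z i)
  map f := Limits.Pi.map fun i => T.map (f i)
  map_id Z := by
    apply Limits.Pi.hom_ext
    intro i
    simp
  map_comp f g := by
    apply Limits.Pi.hom_ext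
    intro i
    simp

/-- The substitution of `T^×`: its component at the position `(i, j)` is the `i`-th projection, then
`T` of the `j`-th projection, then the multiplication of `T`. -/
def timesSubst {k : ℕ} {n : Fin k → ℕ} {N : ℕ} (e : Juxt n N) (W : Fin N → V) :
    (∏ᶜ fun i => T.obj (∏ᶜ fun j => T.obj (W (e.idx i j)))) ⟶ ∏ᶜ fun t => T.obj (W t) :=
  Pi.lift fun t => Pi.π _ (e.fst t) ≫ T.map (Pi.π _ (e.snd t)) ≫ T.μ.app _ ≫
    T.map (eqToHom (congrArg W (e.idx_fst_snd t)))

theorem times_aux {k : ℕ} {n : Fin k → ℕ} {N : ℕ} (e : Juxt n N) (W : Fin N → V)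
    (i i' : Fin k) (j : Fin (n i)) (j' : Fin (n i')) (t : Fin N) (h : e.idx i j = t)
    (h' : e.idx i' j' = t) :
    Pi.π (fun i => T.obj (∏ᶜ fun j => T.obj (W (e.idx i j)))) i ≫ T.map (Pi.π _ j) ≫ T.μ.app _ ≫
      T.map (eqToHom (congrArg W h)) =
    Pi.π (fun i => T.obj (∏ᶜ fun j => T.obj (W (e.idx i j)))) i' ≫ T.map (Pi.π _ j') ≫
      T.μ.app _ ≫ T.map (eqToHom (congrArg W h')) := by
  have := e.pair_inj (h.trans h'.symm)
  cases this
  rfl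

theorem timesSubst_π {k : ℕ} {n : Fin k → ℕ} {N : ℕ} (e : Juxt n N) (W : Fin N → V)
    (i : Fin k) (j : Fin (n i)) :
    timesSubst T e W ≫ Pi.π _ (e.idx i j) =
      Pi.π (fun i => T.obj (∏ᶜ fun j => T.obj (W (e.idx i j)))) i ≫ T.map (Pi.π _ j) ≫
        T.μ.app _ := by
  rw [timesSubst, Limits.Pi.lift_π, times_aux T e W _ i _ j _ (e.idx_fst_snd _) rfl]
  simp

theorem timesSubst_π_assoc {k : ℕ} {n : Fin k → ℕ} {N : ℕ} (e : Juxt n N) (W : Fin N → V)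
    (i : Fin k) (j : Fin (n i)) {Y : V} (g : T.obj (W (e.idx i j)) ⟶ Y) :
    timesSubst T e W ≫ Pi.π _ (e.idx i j) ≫ g =
      Pi.π (fun i => T.obj (∏ᶜ fun j => T.obj (W (e.idx i j)))) i ≫ T.map (Pi.π _ j) ≫
        T.μ.app _ ≫ g := by
  rw [← Category.assoc, timesSubst_π]; simp

theorem pi_π_eqToHom {n : ℕ} (W : Fin n → V) {i i' : Fin n} (h : i = i') :
    Pi.π (fun t => T.obj (W t)) i ≫ T.map (eqToHom (congrArg W h)) = Pi.π _ i' := by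
  subst h; simp

theorem times_unit_naturality {Z Z' : V} (f : Z ⟶ Z') :
    (Pi.lift fun _ : Fin 1 => T.η.app Z) ≫ (Limits.Pi.map fun _ : Fin 1 => T.map f) =
      f ≫ Pi.lift fun _ : Fin 1 => T.η.app Z' := by
  apply Limits.Pi.hom_ext
  intro i
  simpa using (T.η.naturality f).symm

theorem timesSubst_naturality {k : ℕ} {n : Fin k → ℕ} {N : ℕ} (e : Juxt n N) {W W' : Fin N → V}
    (f : ∀ t, W t ⟶ W' t) :
    timesSubst T e W ≫ (Limits.Pi.map fun t => T.map (f t)) =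
      (Limits.Pi.map fun i => T.map (Limits.Pi.map fun j => T.map (f (e.idx i j)))) ≫
        timesSubst T e W' := by
  apply Limits.Pi.hom_ext
  intro t
  obtain ⟨i, j, rfl⟩ := e.surj t
  have := T.μ.naturality (f (e.idx i j))
  simp only [Category.assoc, Limits.Pi.map_π, timesSubst_π_assoc, timesSubst_π,
    Limits.Pi.map_π_assoc]
  rw [← this]
  simp only [← T.map_comp_assoc, Limits.Pi.map_π, Functor.comp_map]

theorem times_unit_subst {n : ℕ} (e : Juxt (fun _ : Fin 1 => n) n) (h : ∀ i j, e.idx i j = j)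
    (W : Fin n → V) :
    (Pi.lift fun _ : Fin 1 => T.η.app (∏ᶜ fun j => T.obj (W j))) ≫
      (Limits.Pi.map fun i => T.map (Limits.Pi.map fun j =>
        T.map (eqToHom (congrArg W (h i j).symm)))) ≫ timesSubst T e W = 𝟙 _ := by
  apply Limits.Pi.hom_ext
  intro t
  obtain ⟨i, j, rfl⟩ := e.surj t
  simp only [Category.assoc, timesSubst_π, Limits.Pi.map_π_assoc, Limits.Pi.lift_π_assoc]
  simp only [← T.map_comp_assoc, Limits.Pi.map_π]
  have := T.η.naturality
    (Pi.π (fun t => T.obj (W t)) j ≫ T.map (eqToHom (congrArg W (h i j).symm)))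
  simp only [Functor.id_map] at this
  rw [← Category.assoc, ← this]
  simpa using pi_π_eqToHom T W (h i j).symm

theorem times_subst_unit {n : ℕ} (e : Juxt (fun _ : Fin n => 1) n) (h : ∀ i j, e.idx i j = i)
    (W : Fin n → V) :
    (Limits.Pi.map fun i => T.map ((Pi.lift fun _ : Fin 1 => T.η.app (W i)) ≫
      Limits.Pi.map fun j => T.map (eqToHom (congrArg W (h i j).symm)))) ≫
        timesSubst T e W = 𝟙 _ := by
  apply Limits.Pi.hom_ext
  intro t
  obtain ⟨i, j, rfl⟩ := e.surj t
  simp only [Category.assoc, timesSubst_π, Limits.Pi.map_π_assoc, ← T.map_comp_assoc]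
  simp only [Limits.Pi.map_π, Limits.Pi.lift_π_assoc]
  have := T.η.naturality (eqToHom (congrArg W (h i j).symm))
  simp only [Functor.id_map] at this
  rw [← this]
  simpa using pi_π_eqToHom T W (h i j).symm

theorem times_assoc {k : ℕ} {n : Fin k → ℕ} {N₁ : ℕ} (e₁ : Juxt n N₁) {m : Fin N₁ → ℕ} {N : ℕ}
    (e₂ : Juxt m N) {M : Fin k → ℕ} (f : ∀ i, Juxt (fun j => m (e₁.idx i j)) (M i)) (g : Juxt M N)
    (h : ∀ i j l, g.idx i ((f i).idx j l) = e₂.idx (e₁.idx i j) l) (W : Fin N → V) :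
    (Limits.Pi.map fun i =>
      T.map ((Limits.Pi.map fun j => T.map (Limits.Pi.map fun l => T.map
          (eqToHom (congrArg W (h i j l).symm)))) ≫
        timesSubst T (f i) (fun s => W (g.idx i s)))) ≫ timesSubst T g W =
      timesSubst T e₁ (fun t => ∏ᶜ fun l => T.obj (W (e₂.idx t l))) ≫ timesSubst T e₂ W := by
  apply Limits.Pi.hom_ext
  intro t
  obtain ⟨s, l, rfl⟩ := e₂.surj t
  obtain ⟨i, j, rfl⟩ := e₁.surj s
  rw [← pi_π_eqToHom T W (h i j l)]
  have h₁ := T.μ.naturality (eqToHom (congrArg W (h i j l)))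
  have h₂ := T.μ.naturality (Pi.π (fun l => T.obj (W (e₂.idx (e₁.idx i j) l))) l)
  simp only [Functor.comp_map] at h₁ h₂
  simp only [Category.assoc, timesSubst_π_assoc, Limits.Pi.map_π_assoc, ← h₁]
  rw [pi_π_eqToHom T W (h i j l), timesSubst_π, timesSubst_π_assoc, ← Category.assoc (T.μ.app _),
    ← h₂]
  simp only [← T.map_comp_assoc, Category.assoc]
  simp only [timesSubst_π_assoc, Limits.Pi.map_π_assoc, Limits.Pi.map_π,
    ← T.map_comp_assoc]
  simp only [Category.assoc, T.map_comp, T.assoc, ← h₁]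
  congr 3
  have h₃ := T.map_comp (T.map (T.map (eqToHom (congrArg W (h i j l).symm))))
    (T.map (T.map (eqToHom (congrArg W (h i j l)))))
  rw [← T.map_comp, ← T.map_comp, eqToHom_trans, eqToHom_refl, T.map_id, T.map_id, T.map_id] at h₃
  rw [← Category.assoc, ← h₃, Category.id_comp]

/-- The multitensor `T^×` associated with a monad `T`:
`T^×(Z₁, …, Zₙ) = T Z₁ × ⋯ × T Zₙ`, with unit and substitution induced by those of `T`. -/
def timesMultitensor : Multitensor V where
  tensor n := timesTensor T n
  unit Z := Pi.lift fun _ => T.η.app Z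
  unit_naturality f := times_unit_naturality T f
  subst e W := timesSubst T e W
  subst_naturality e _ _ f := timesSubst_naturality T e f
  unit_subst e h W := times_unit_subst T e h W
  subst_unit e h W := times_subst_unit T e h W
  assoc e₁ _ _ e₂ _ f g h W := times_assoc T e₁ e₂ f g h W

end Times

/-! ### Sequences of objects from `a` to `b` -/

/-- A finite sequence `(x₀, …, xₙ)` with `x₀ = a` and `xₙ = b`. -/
structure EPath {O : Type u} (a b : O) : Type u where
  len : ℕ
  vert : Fin (len + 1) → O
  vert_zero : vert 0 = a
  vert_last : vert (Fin.last len) = b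

namespace EPath

section
variable {O : Type u}

/-- The sequence `(a, b)`. -/
@[reducible] def edge (a b : O) : EPath a b where
  len := 1
  vert i := if i = 0 then a else b
  vert_zero := rfl
  vert_last := rfl

theorem edge_src (a b : O) (i : Fin 1) : a = (edge a b).vert (Fin.castSucc i) := by
  obtain rfl : i = 0 := Subsingleton.elim _ _
  rfl

theorem edge_tgt (a b : O) (i : Fin 1) : b = (edge a b).vert (Fin.succ i) := by
  obtain rfl : i = 0 := Subsingleton.elim _ _
  rfl

/-- The image of a sequence under a function. -/
@[reducible] def map {O' : Type u} (f : O → O') {a b : O} (p : EPath a b) : EPath (f a) (f b) where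
  len := p.len
  vert i := f (p.vert i)
  vert_zero := congrArg f p.vert_zero
  vert_last := congrArg f p.vert_last

/-- Replacing the end points of a sequence by equal ones. -/
@[reducible] def cast {a a' b b' : O} (p : EPath a b) (h : a = a') (k : b = b') : EPath a' b' where
  len := p.len
  vert := p.vert
  vert_zero := p.vert_zero.trans h
  vert_last := p.vert_last.trans k

theorem map_edge_vert {O' : Type u} (f : O → O') (a b : O) (i : Fin 2) :
    f ((edge a b).vert i) = (edge (f a) (f b)).vert i := by
  dsimp only [edge]
  split <;> rfl

end

/-- The sequence `(X(x₀, x₁), …, X(xₙ₋₁, xₙ))` of homs of `X` along a sequence `(x₀, …, xₙ)`. -/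
@[reducible] def homs {V : Type (u + 1)} (X : EGraph V) {a b : X.Obj} (p : EPath a b) :
    Fin p.len → V :=
  fun i => X.hom (p.vert i.castSucc) (p.vert i.succ)

end EPath

/-- A concatenation of the sequences `p i`, whose end points are the successive members of `q`. -/
structure Concat {O : Type u} {a b : O} (q : EPath a b)
    (p : ∀ i : Fin q.len, EPath (q.vert i.castSucc) (q.vert i.succ)) where
  path : EPath a b
  e : Juxt (fun i => (p i).len) path.len
  src : ∀ i j, (p i).vert j.castSucc = path.vert (e.idx i j).castSucc
  tgt : ∀ i j, (p i).vert j.succ = path.vert (e.idx i j).succ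

namespace Concat

variable {O : Type u} {a b : O} {q : EPath a b}
  {p : ∀ i : Fin q.len, EPath (q.vert i.castSucc) (q.vert i.succ)}

instance : Nonempty (Concat q p) := by
  obtain ⟨N, e, v, h0, h1, hs, ht⟩ := Juxt.exists_append q.len (fun i => (p i).len) q.vert
    (fun i => (p i).vert) (fun i => (p i).vert_zero) (fun i => (p i).vert_last)
  exact ⟨⟨⟨N, v, h0.trans q.vert_zero, h1.trans q.vert_last⟩, e, fun i j => (hs i j).symm,
    fun i j => (ht i j).symm⟩⟩

instance : Subsingleton (Concat q p) := by
  constructor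
  rintro ⟨⟨N, x, x0, x1⟩, e, src, tgt⟩ ⟨⟨N', x', x0', x1'⟩, e', src', tgt'⟩
  obtain rfl : N = N' := e.card_eq.trans e'.card_eq.symm
  obtain rfl : e = e' := Juxt.eq_of_juxt e e'
  obtain rfl : x = x' := by
    funext t
    induction t using Fin.lastCases with
    | last => exact x1.trans x1'.symm
    | cast t =>
      obtain ⟨i, j, rfl⟩ := e.surj t
      exact (src i j).symm.trans (src' i j)
  rfl

/-- The image of a concatenation under a function. -/
@[reducible] def map {O' : Type u} (f : O → O') (c : Concat q p) :
    Concat (q.map f) (fun i => (p i).map f) where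
  path := c.path.map f
  e := c.e
  src i j := congrArg f (c.src i j)
  tgt i j := congrArg f (c.tgt i j)

end Concat

namespace Multitensor

variable {V : Type (u + 1)} [LargeCategory.{u} V] (E : Multitensor V)

theorem IsDistributive.hom_ext {E : Multitensor V} (hE : E.IsDistributive) {n : ℕ}
    {P : Fin n → Type u} {Z : ∀ i, P i → V} (c : ∀ i, Cofan (Z i))
    (hc : ∀ i, Nonempty (IsColimit (c i))) {A : V}
    {f g : (E.tensor n).obj (fun i => (c i).pt) ⟶ A}
    (h : ∀ p : ∀ i, P i, (E.tensor n).map (fun i => (c i).inj (p i)) ≫ f =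
      (E.tensor n).map (fun i => (c i).inj (p i)) ≫ g) : f = g :=
  Cofan.IsColimit.hom_ext (hE n P Z c hc).some f g h

variable [HasCoproducts.{u} V]

/-- The homs of `Γ E X`: the coproduct, over all sequences `(x₀, …, xₙ)` from `a` to `b`, of
`Eᵢ X(xᵢ₋₁, xᵢ)`. -/
def gammaHom (X : EGraph V) (a b : X.Obj) : V :=
  ∐ fun p : EPath a b => (E.tensor p.len).obj (p.homs X)

/-- The enriched graph `Γ E X`, with the same objects as `X`. -/
@[reducible] def gammaObj (X : EGraph V) : EGraph V where
  Obj := X.Obj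
  hom := E.gammaHom X

variable {E}

/-- The coproduct inclusions. -/
def inc (X : EGraph V) {a b : X.Obj} (p : EPath a b) :
    (E.tensor p.len).obj (p.homs X) ⟶ E.gammaHom X a b :=
  Sigma.ι (fun p : EPath a b => (E.tensor p.len).obj (p.homs X)) p

/-- The inclusions form a coproduct cocone. -/
@[reducible] def gammaCofan (X : EGraph V) (a b : X.Obj) :
    Cofan (fun p : EPath a b => (E.tensor p.len).obj (p.homs X)) :=
  Cofan.mk (E.gammaHom X a b) (fun p => inc X p)

def gammaIsColimit (X : EGraph V) (a b : X.Obj) : IsColimit (gammaCofan (E := E) X a b) :=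
  coproductIsCoproduct _

theorem gammaHom_ext {X : EGraph V} {a b : X.Obj} {A : V} {f g : E.gammaHom X a b ⟶ A}
    (h : ∀ p, inc X p ≫ f = inc X p ≫ g) : f = g :=
  Cofan.IsColimit.hom_ext (gammaIsColimit X a b) f g h

def gammaDesc {X : EGraph V} {a b : X.Obj} {A : V}
    (f : ∀ p : EPath a b, (E.tensor p.len).obj (p.homs X) ⟶ A) : E.gammaHom X a b ⟶ A :=
  Sigma.desc f

theorem inc_desc {X : EGraph V} {a b : X.Obj} {A : V}
    (f : ∀ p : EPath a b, (E.tensor p.len).obj (p.homs X) ⟶ A) (p : EPath a b) :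
    inc X p ≫ gammaDesc f = f p :=
  Sigma.ι_desc _ _

theorem inc_desc_assoc {X : EGraph V} {a b : X.Obj} {A : V}
    (f : ∀ p : EPath a b, (E.tensor p.len).obj (p.homs X) ⟶ A) (p : EPath a b) {B : V}
    (g : A ⟶ B) : inc X p ≫ gammaDesc f ≫ g = f p ≫ g := by
  rw [← Category.assoc, inc_desc]

theorem inc_congr (X : EGraph V) {a b : X.Obj} {n : ℕ} {x y : Fin (n + 1) → X.Obj}
    (hx₀ : x 0 = a) (hx₁ : x (Fin.last n) = b) (hy₀ : y 0 = a) (hy₁ : y (Fin.last n) = b)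
    (h : ∀ i, x i = y i) :
    (E.tensor n).map (fun i : Fin n => X.cast (h i.castSucc) (h i.succ)) ≫
      inc (E := E) X ⟨n, y, hy₀, hy₁⟩ = inc X ⟨n, x, hx₀, hx₁⟩ := by
  obtain rfl : x = y := funext h
  exact (congrArg (· ≫ _) ((E.tensor n).map_id _)).trans (Category.id_comp _)

theorem inc_cast (X : EGraph V) {a a' b b' : X.Obj} (h : a = a') (k : b = b') (p : EPath a b) :
    inc (E := E) X p ≫ (E.gammaObj X).cast h k = inc X (p.cast h k) := by
  subst h k
  exact Category.comp_id _

theorem map_map {n : ℕ} {Z Z' Z'' : Fin n → V} (f : ∀ i, Z i ⟶ Z' i) (g : ∀ i, Z' i ⟶ Z'' i) :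
    (E.tensor n).map f ≫ (E.tensor n).map g = (E.tensor n).map fun i => f i ≫ g i :=
  ((E.tensor n).map_comp f g).symm

theorem map_map_assoc {n : ℕ} {Z Z' Z'' : Fin n → V} (f : ∀ i, Z i ⟶ Z' i)
    (g : ∀ i, Z' i ⟶ Z'' i) {A : V} (h : (E.tensor n).obj Z'' ⟶ A) :
    (E.tensor n).map f ≫ (E.tensor n).map g ≫ h = ((E.tensor n).map fun i => f i ≫ g i) ≫ h := by
  rw [← Category.assoc, map_map]

theorem map_one {n : ℕ} (Z : Fin n → V) {f : ∀ i, Z i ⟶ Z i} (h : ∀ i, f i = 𝟙 _) :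
    (E.tensor n).map f = 𝟙 ((E.tensor n).obj Z) := by
  obtain rfl : f = fun i => 𝟙 (Z i) := funext h
  exact (E.tensor n).map_id Z

theorem map_one_comp {n : ℕ} (Z : Fin n → V) {f : ∀ i, Z i ⟶ Z i} (h : ∀ i, f i = 𝟙 _) {A : V}
    (g : (E.tensor n).obj Z ⟶ A) : (E.tensor n).map f ≫ g = g := by
  rw [map_one Z h, Category.id_comp]

theorem map_eq {n : ℕ} {Z Z' : Fin n → V} {f g : ∀ i, Z i ⟶ Z' i} (h : ∀ i, f i = g i) :
    (E.tensor n).map f = (E.tensor n).map g := by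
  rw [show f = g from funext h]

theorem map_eq_comp {n : ℕ} {Z Z' : Fin n → V} {f g : ∀ i, Z i ⟶ Z' i} (h : ∀ i, f i = g i) {A : V}
    (k : (E.tensor n).obj Z' ⟶ A) : (E.tensor n).map f ≫ k = (E.tensor n).map g ≫ k := by
  rw [show f = g from funext h]

/-- The hom maps of `Γ E f`. -/
def gammaMapHom {X Y : EGraph V} (f : X ⟶ Y) (a b : X.Obj) :
    E.gammaHom X a b ⟶ E.gammaHom Y (f.obj a) (f.obj b) :=
  gammaDesc fun p =>
    (E.tensor p.len).map (fun i => f.map (p.vert i.castSucc) (p.vert i.succ)) ≫ inc Y (p.map f.obj)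

theorem inc_mapHom {X Y : EGraph V} (f : X ⟶ Y) {a b : X.Obj} (p : EPath a b) :
    inc X p ≫ gammaMapHom (E := E) f a b =
      (E.tensor p.len).map (fun i => f.map (p.vert i.castSucc) (p.vert i.succ)) ≫
        inc Y (p.map f.obj) :=
  inc_desc _ _

theorem inc_mapHom_assoc {X Y : EGraph V} (f : X ⟶ Y) {a b : X.Obj} (p : EPath a b) {A : V}
    (g : E.gammaHom Y (f.obj a) (f.obj b) ⟶ A) :
    inc X p ≫ gammaMapHom (E := E) f a b ≫ g =
      (E.tensor p.len).map (fun i => f.map (p.vert i.castSucc) (p.vert i.succ)) ≫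
        inc Y (p.map f.obj) ≫ g := by
  rw [← Category.assoc, inc_mapHom, Category.assoc]

theorem gammaMapHom_id (X : EGraph V) (a b : X.Obj) :
    gammaMapHom (E := E) (𝟙 X) a b = 𝟙 (E.gammaHom X a b) := by
  refine gammaHom_ext fun p => ?_
  rw [inc_mapHom]
  exact (map_one_comp _ (fun _ => rfl) _).trans (Category.comp_id _).symm

theorem gammaMapHom_comp {X Y Z : EGraph V} (f : X ⟶ Y) (g : Y ⟶ Z) (a b : X.Obj) :
    gammaMapHom (E := E) (f ≫ g) a b = gammaMapHom f a b ≫ gammaMapHom g (f.obj a) (f.obj b) := by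
  refine gammaHom_ext fun p => ?_
  rw [inc_mapHom, inc_mapHom_assoc, inc_mapHom]
  exact (map_map_assoc _ _ _).symm

/-- The action of `Γ E` on morphisms. -/
@[reducible] def gammaMap {X Y : EGraph V} (f : X ⟶ Y) : E.gammaObj X ⟶ E.gammaObj Y :=
  EGraph.Hom.mk f.obj (gammaMapHom f)

variable (E)

/-- The functor `Γ E : 𝒢V ⥤ 𝒢V`. -/
def gammaFunctor : EGraph V ⥤ EGraph V where
  obj X := E.gammaObj X
  map f := gammaMap f
  map_id X := EGraph.mk_ext (gammaMapHom_id X)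
  map_comp f g := EGraph.mk_ext (gammaMapHom_comp f g)

/-- The hom maps of the unit of `Γ E`, given by the unit of `E` and the sequences `(a, b)`. -/
def gammaUnitHom (X : EGraph V) (a b : X.Obj) : X.hom a b ⟶ E.gammaHom X a b :=
  E.unit (X.hom a b) ≫
    (E.tensor 1).map (fun i => X.cast (EPath.edge_src a b i) (EPath.edge_tgt a b i)) ≫
      inc X (EPath.edge a b)

variable {E}

theorem inc_map_edge {X Y : EGraph V} (f : X ⟶ Y) (a b : X.Obj) :
    (E.tensor 1).map (fun i => Y.cast (congrArg f.obj (EPath.edge_src a b i))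
        (congrArg f.obj (EPath.edge_tgt a b i))) ≫ inc (E := E) Y ((EPath.edge a b).map f.obj) =
      (E.tensor 1).map (fun i => Y.cast (EPath.edge_src (f.obj a) (f.obj b) i)
        (EPath.edge_tgt (f.obj a) (f.obj b) i)) ≫ inc Y (EPath.edge (f.obj a) (f.obj b)) := by
  have h : ∀ i, ((EPath.edge a b).map f.obj).vert i = (EPath.edge (f.obj a) (f.obj b)).vert i :=
    EPath.map_edge_vert f.obj a b
  have h' : inc (E := E) Y ((EPath.edge a b).map f.obj) = _ :=
    (inc_congr (E := E) Y ((EPath.edge a b).map f.obj).vert_zero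
      ((EPath.edge a b).map f.obj).vert_last (EPath.edge (f.obj a) (f.obj b)).vert_zero
      (EPath.edge (f.obj a) (f.obj b)).vert_last h).symm
  rw [h']
  refine (map_map_assoc _ _ _).trans ?_
  exact map_eq_comp (fun i => EGraph.cast_trans _ _ _ _ _) _

theorem gammaUnitHom_naturality {X Y : EGraph V} (f : X ⟶ Y) (a b : X.Obj) :
    f.map a b ≫ E.gammaUnitHom Y (f.obj a) (f.obj b) =
      E.gammaUnitHom X a b ≫ gammaMapHom f a b := by
  rw [gammaUnitHom, gammaUnitHom, ← Category.assoc, ← E.unit_naturality]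
  simp only [Category.assoc]
  rw [inc_mapHom]
  congr 1
  rw [← inc_map_edge]
  refine (map_map_assoc _ _ _).trans (Eq.trans ?_ (map_map_assoc _ _ _).symm)
  exact map_eq_comp (fun i => (EGraph.cast_map f _ _).symm) _

/-! ### The multiplication -/

/-- The component of the multiplication at sequences `p i` with concatenation `c`. -/
def mulOf (X : EGraph V) {a b : X.Obj} {q : EPath a b}
    {p : ∀ i : Fin q.len, EPath (q.vert i.castSucc) (q.vert i.succ)} (c : Concat q p) :
    (E.tensor q.len).obj (fun i => (E.tensor (p i).len).obj ((p i).homs X)) ⟶ E.gammaHom X a b :=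
  (E.tensor q.len).map (fun i => (E.tensor (p i).len).map fun j => X.cast (c.src i j) (c.tgt i j)) ≫
    E.subst c.e (c.path.homs X) ≫ inc X c.path

/-- The inclusion of the summand of `Γ E (Γ E X)` at a sequence of sequences. -/
def inc₂ (X : EGraph V) {a b : X.Obj} (q : EPath a b)
    (p : ∀ i : Fin q.len, EPath (q.vert i.castSucc) (q.vert i.succ)) :
    (E.tensor q.len).obj (fun i => (E.tensor (p i).len).obj ((p i).homs X)) ⟶
      E.gammaHom (E.gammaObj X) a b :=
  (E.tensor q.len).map (fun i => inc X (p i)) ≫ inc (E.gammaObj X) q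

/-- The inclusions of `inc₂` for fixed `q` before applying `inc`, as a coproduct cocone. -/
def innerIsColimit (hE : E.IsDistributive) (X : EGraph V) {a b : X.Obj} (q : EPath a b) :
    IsColimit (Cofan.mk (f := fun p : ∀ i : Fin q.len, EPath (q.vert i.castSucc) (q.vert i.succ) =>
        (E.tensor q.len).obj (fun i => (E.tensor (p i).len).obj ((p i).homs X)))
      ((E.tensor q.len).obj (q.homs (E.gammaObj X)))
      (fun p => (E.tensor q.len).map (fun i => inc X (p i)))) :=
  (hE q.len _ _ (fun i => gammaCofan X (q.vert i.castSucc) (q.vert i.succ))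
    (fun _ => ⟨gammaIsColimit X _ _⟩)).some

theorem gamma₂_ext (hE : E.IsDistributive) {X : EGraph V} {a b : X.Obj} {A : V}
    {f g : E.gammaHom (E.gammaObj X) a b ⟶ A}
    (h : ∀ q p, inc₂ X q p ≫ f = inc₂ X q p ≫ g) : f = g := by
  refine gammaHom_ext fun q => ?_
  refine Cofan.IsColimit.hom_ext (innerIsColimit hE X q) _ _ fun p => ?_
  have := h q p
  simp only [inc₂, Category.assoc] at this
  exact this

variable (hE : E.IsDistributive)

/-- The hom maps of the multiplication of `Γ E`. On the summand of a sequence `q` of objects and of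
sequences `p i` between its successive members it is the substitution of `E` followed by the
inclusion of the summand of the concatenation, which exists and is unique. -/
def gammaMulHom (X : EGraph V) (a b : X.Obj) :
    E.gammaHom (E.gammaObj X) a b ⟶ E.gammaHom X a b :=
  gammaDesc fun q => Cofan.IsColimit.desc (innerIsColimit hE X q) fun p =>
    mulOf X (Classical.arbitrary (Concat q p))

theorem inc₂_mul (X : EGraph V) {a b : X.Obj} {q : EPath a b}
    {p : ∀ i : Fin q.len, EPath (q.vert i.castSucc) (q.vert i.succ)} (c : Concat q p) :
    inc₂ X q p ≫ gammaMulHom hE X a b = mulOf X c := by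
  rw [inc₂, gammaMulHom, Category.assoc, inc_desc, Subsingleton.elim c (Classical.arbitrary _)]
  exact Cofan.IsColimit.fac (innerIsColimit hE X q) _ p

theorem inc₂_mul_assoc (X : EGraph V) {a b : X.Obj} {q : EPath a b}
    {p : ∀ i : Fin q.len, EPath (q.vert i.castSucc) (q.vert i.succ)} (c : Concat q p) {A : V}
    (f : E.gammaHom X a b ⟶ A) : inc₂ X q p ≫ gammaMulHom hE X a b ≫ f = mulOf X c ≫ f := by
  rw [← Category.assoc, inc₂_mul hE X c]

theorem inc₂_map {X Y : EGraph V} (f : X ⟶ Y) {a b : X.Obj} (q : EPath a b)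
    (p : ∀ i : Fin q.len, EPath (q.vert i.castSucc) (q.vert i.succ)) :
    inc₂ (E := E) X q p ≫ gammaMapHom (gammaMap f) a b =
      (E.tensor q.len).map (fun i => (E.tensor (p i).len).map fun _ => f.map _ _) ≫
        inc₂ Y (q.map f.obj) (fun i => (p i).map f.obj) := by
  rw [inc₂, inc₂, Category.assoc, inc_mapHom]
  refine (map_map_assoc _ _ _).trans (Eq.trans ?_ (map_map_assoc _ _ _).symm)
  exact map_eq_comp (fun i => inc_mapHom _ _) _

theorem gammaMulHom_naturality {X Y : EGraph V} (f : X ⟶ Y) (a b : X.Obj) :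
    gammaMapHom (gammaMap f) a b ≫ gammaMulHom hE Y (f.obj a) (f.obj b) =
      gammaMulHom hE X a b ≫ gammaMapHom f a b := by
  refine gamma₂_ext hE fun q p => ?_
  let c : Concat q p := Classical.arbitrary _
  rw [inc₂_mul_assoc hE X c, ← Category.assoc, inc₂_map, Category.assoc]
  refine (congrArg (_ ≫ ·) (inc₂_mul hE Y (c.map f.obj))).trans ?_
  rw [mulOf, mulOf, Category.assoc, Category.assoc, inc_mapHom]
  have h := E.subst_naturality c.e (W := c.path.homs X) (W' := (c.path.map f.obj).homs Y)
    (fun i => f.map _ _)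
  refine Eq.trans ?_ (congrArg (_ ≫ ·) ((Category.assoc _ _ _).symm.trans
    (congrArg (· ≫ inc Y (c.path.map f.obj)) h)).symm)
  rw [Category.assoc]
  refine (map_map_assoc _ _ _).trans (Eq.trans ?_ (map_map_assoc _ _ _).symm)
  refine map_eq_comp (fun i => ?_) _
  refine (map_map _ _).trans (Eq.trans ?_ (map_map _ _).symm)
  exact map_eq (fun j => (EGraph.cast_map f _ _).symm)

/-! ### The monad laws -/

theorem gamma_left_unit (X : EGraph V) (a b : X.Obj) :
    E.gammaUnitHom (E.gammaObj X) a b ≫ gammaMulHom hE X a b = 𝟙 _ := by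
  refine gammaHom_ext fun p => ?_
  let p' : ∀ i : Fin (EPath.edge a b).len,
      EPath ((EPath.edge a b).vert i.castSucc) ((EPath.edge a b).vert i.succ) :=
    fun i => p.cast (EPath.edge_src a b i) (EPath.edge_tgt a b i)
  let c : Concat (EPath.edge a b) p' :=
    { path := p
      e := Juxt.single p.len
      src := fun _ _ => rfl
      tgt := fun _ _ => rfl }
  have h₁ : inc X p ≫ E.gammaUnitHom (E.gammaObj X) a b = E.unit _ ≫ inc₂ X (EPath.edge a b) p' := by
    rw [gammaUnitHom, ← Category.assoc, ← E.unit_naturality, Category.assoc]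
    congr 1
    unfold inc₂
    refine (map_map_assoc _ _ _).trans ?_
    exact map_eq_comp (fun i => inc_cast (E := E) X (EPath.edge_src a b i) (EPath.edge_tgt a b i) p) _
  rw [← Category.assoc, h₁, Category.assoc, inc₂_mul hE X c, mulOf]
  have h₂ := E.unit_subst (Juxt.single p.len) (fun _ _ => rfl) (p.homs X)
  refine Eq.trans ?_ ((congrArg (· ≫ inc X p) h₂).trans
    ((Category.id_comp _).trans (Category.comp_id _).symm))
  simp only [Category.assoc]
  rfl

theorem gamma_right_unit (X : EGraph V) (a b : X.Obj) :
    gammaMapHom (X := X) (Y := E.gammaObj X) (EGraph.Hom.mk (fun a => a) (E.gammaUnitHom X)) a b ≫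
      gammaMulHom hE X a b = 𝟙 _ := by
  refine gammaHom_ext fun p => ?_
  rw [inc_mapHom_assoc]
  let p' : ∀ i : Fin p.len, EPath (p.vert i.castSucc) (p.vert i.succ) := fun i => EPath.edge _ _
  let c : Concat p p' :=
    { path := p
      e := Juxt.units p.len
      src := fun i j => (EPath.edge_src _ _ j).symm
      tgt := fun i j => (EPath.edge_tgt _ _ j).symm }
  have h₁ : (E.tensor p.len).map (fun i => E.gammaUnitHom X (p.vert i.castSucc) (p.vert i.succ)) ≫
      inc (E.gammaObj X) p = (E.tensor p.len).map (fun i => E.unit (p.homs X i) ≫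
        (E.tensor 1).map (fun j => X.cast (EPath.edge_src _ _ j) (EPath.edge_tgt _ _ j))) ≫
        inc₂ X p p' := by
    refine Eq.trans ?_ (map_map_assoc _ _ _).symm
    exact map_eq_comp (fun i => (Category.assoc _ _ _).symm) _
  refine (Category.assoc _ _ _).symm.trans ((congrArg (· ≫ gammaMulHom hE X a b) h₁).trans ?_)
  rw [Category.assoc, inc₂_mul hE X c, mulOf]
  have h₂ := E.subst_unit (Juxt.units p.len) (fun _ _ => rfl) (p.homs X)
  refine Eq.trans ?_ ((congrArg (· ≫ inc X p) h₂).trans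
    ((Category.id_comp _).trans (Category.comp_id _).symm))
  rw [Category.assoc]
  refine (map_map_assoc _ _ _).trans (map_eq_comp (fun i => ?_) _)
  rw [Category.assoc]
  congr 1
  refine (map_map _ _).trans (map_eq fun j => ?_)
  exact (EGraph.cast_trans _ _ _ _ _)

/-- The inclusion of a summand of `Γ E (Γ E (Γ E X))`. -/
def inc₃ (X : EGraph V) {a b : X.Obj} (q : EPath a b)
    (p : ∀ i : Fin q.len, EPath (q.vert i.castSucc) (q.vert i.succ))
    (s : ∀ i (j : Fin (p i).len), EPath ((p i).vert j.castSucc) ((p i).vert j.succ)) :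
    (E.tensor q.len).obj (fun i => (E.tensor (p i).len).obj fun j =>
        (E.tensor (s i j).len).obj ((s i j).homs X)) ⟶
      E.gammaHom (E.gammaObj (E.gammaObj X)) a b :=
  (E.tensor q.len).map (fun i => (E.tensor (p i).len).map fun j => inc X (s i j)) ≫
    inc₂ (E.gammaObj X) q p

theorem gamma₃_ext (hE : E.IsDistributive) {X : EGraph V} {a b : X.Obj} {A : V}
    {f g : E.gammaHom (E.gammaObj (E.gammaObj X)) a b ⟶ A}
    (h : ∀ q p s, inc₃ X q p s ≫ f = inc₃ X q p s ≫ g) : f = g := by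
  refine gamma₂_ext hE fun q p => ?_
  refine hE.hom_ext (fun i => Cofan.mk _ fun s : ∀ j : Fin (p i).len,
    EPath ((p i).vert j.castSucc) ((p i).vert j.succ) =>
      (E.tensor (p i).len).map fun j => inc X (s j))
    (fun i => ⟨innerIsColimit hE X (p i)⟩) fun s => ?_
  have := h q p s
  simp only [inc₃, Category.assoc] at this
  exact this

theorem inc₃_mul (X : EGraph V) {a b : X.Obj} (q : EPath a b)
    (p : ∀ i : Fin q.len, EPath (q.vert i.castSucc) (q.vert i.succ))
    (s : ∀ i (j : Fin (p i).len), EPath ((p i).vert j.castSucc) ((p i).vert j.succ))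
    (c : ∀ i, Concat (p i) (s i)) (d : Concat q (fun i => (c i).path)) :
    inc₃ X q p s ≫ gammaMapHom (X := E.gammaObj (E.gammaObj X)) (Y := E.gammaObj X)
        (EGraph.Hom.mk (fun a => a) (gammaMulHom hE X)) a b ≫ gammaMulHom hE X a b =
      (E.tensor q.len).map (fun i =>
        (E.tensor (p i).len).map (fun j => (E.tensor (s i j).len).map fun l =>
          X.cast ((c i).src j l) ((c i).tgt j l)) ≫ E.subst (c i).e ((c i).path.homs X)) ≫
        mulOf X d := by
  rw [inc₃, inc₂, Category.assoc, Category.assoc, inc_mapHom_assoc]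
  refine (congrArg (_ ≫ ·) (map_map_assoc _ _ _)).trans ((map_map_assoc _ _ _).trans ?_)
  rw [← inc₂_mul hE X d, inc₂, Category.assoc]
  refine Eq.trans ?_ (map_map_assoc _ _ _).symm
  refine map_eq_comp (fun i => ?_) _
  have := inc₂_mul hE X (c i)
  rw [inc₂, Category.assoc] at this
  refine this.trans ?_
  rw [mulOf, Category.assoc]

theorem exists_reindex {X : EGraph V} {a b : X.Obj} {q : EPath a b}
    {p : ∀ i : Fin q.len, EPath (q.vert i.castSucc) (q.vert i.succ)} (c : Concat q p)
    (s : ∀ i (j : Fin (p i).len), EPath ((p i).vert j.castSucc) ((p i).vert j.succ)) :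
    ∃ s' : ∀ t : Fin c.path.len, EPath (c.path.vert t.castSucc) (c.path.vert t.succ),
      s = fun i j => (s' (c.e.idx i j)).cast (c.src i j).symm (c.tgt i j).symm := by
  have key : ∀ (t : Fin c.path.len) (i i' : Fin q.len) (j : Fin (p i).len) (j' : Fin (p i').len)
      (h : c.e.idx i j = t) (h' : c.e.idx i' j' = t),
      (s i j).cast ((c.src i j).trans (congrArg (fun t => c.path.vert (Fin.castSucc t)) h))
        ((c.tgt i j).trans (congrArg (fun t => c.path.vert (Fin.succ t)) h)) =
      (s i' j').cast ((c.src i' j').trans (congrArg (fun t => c.path.vert (Fin.castSucc t)) h'))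
        ((c.tgt i' j').trans (congrArg (fun t => c.path.vert (Fin.succ t)) h')) := by
    intro t i i' j j' h h'
    have := c.e.pair_inj (h.trans h'.symm)
    cases this
    rfl
  refine ⟨fun t => (s (c.e.fst t) (c.e.snd t)).cast
    ((c.src _ _).trans (congrArg (fun t => c.path.vert (Fin.castSucc t)) (c.e.idx_fst_snd t)))
    ((c.tgt _ _).trans (congrArg (fun t => c.path.vert (Fin.succ t)) (c.e.idx_fst_snd t))), ?_⟩
  funext i j
  have := congrArg (fun r => EPath.cast r (c.src i j).symm (c.tgt i j).symm)
    (key (c.e.idx i j) _ i _ j (c.e.idx_fst_snd _) rfl)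
  exact this.symm

theorem gamma_assoc_aux (X : EGraph V) {a b : X.Obj} (q : EPath a b)
    (p : ∀ i : Fin q.len, EPath (q.vert i.castSucc) (q.vert i.succ)) (c' : Concat q p)
    (s : ∀ t : Fin c'.path.len, EPath (c'.path.vert t.castSucc) (c'.path.vert t.succ))
    (f : Concat c'.path s) :
    inc₃ X q p (fun i j => (s (c'.e.idx i j)).cast (c'.src i j).symm (c'.tgt i j).symm) ≫
        gammaMulHom hE (E.gammaObj X) a b ≫ gammaMulHom hE X a b =
      (E.tensor q.len).map (fun i => (E.tensor (p i).len).map fun j =>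
        (E.tensor (s (c'.e.idx i j)).len).map fun l =>
          X.cast (f.src (c'.e.idx i j) l) (f.tgt (c'.e.idx i j) l)) ≫
        E.subst c'.e (fun t => (E.tensor (s t).len).obj fun l => f.path.homs X (f.e.idx t l)) ≫
          E.subst f.e (f.path.homs X) ≫ inc X f.path := by
  have h₁ := E.subst_naturality c'.e
    (W := fun t => (E.tensor (s t).len).obj ((s t).homs X))
    (W' := fun t => (E.tensor (s t).len).obj fun l => f.path.homs X (f.e.idx t l))
    (fun t => (E.tensor (s t).len).map fun l => X.cast (f.src t l) (f.tgt t l))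
  have h₂ := E.subst_naturality c'.e
    (W := fun t => (E.tensor (s t).len).obj ((s t).homs X))
    (W' := c'.path.homs (E.gammaObj X))
    (fun t => inc X (s t))
  have h₃ : inc₃ X q p (fun i j => (s (c'.e.idx i j)).cast (c'.src i j).symm (c'.tgt i j).symm) ≫
      gammaMulHom hE (E.gammaObj X) a b =
      E.subst c'.e (fun t => (E.tensor (s t).len).obj ((s t).homs X)) ≫ inc₂ X c'.path s := by
    unfold inc₃
    rw [Category.assoc]
    refine (congrArg (_ ≫ ·) (inc₂_mul hE (E.gammaObj X) c')).trans ?_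
    rw [mulOf]
    refine (map_map_assoc _ _ _).trans ?_
    unfold inc₂
    refine Eq.trans ?_ ((congrArg (· ≫ inc (E.gammaObj X) c'.path) h₂).symm.trans
      (Category.assoc _ _ _))
    rw [Category.assoc]
    refine map_eq_comp (fun i => ?_) _
    refine (map_map _ _).trans (map_eq fun j => ?_)
    exact inc_cast X _ _ _
  rw [← Category.assoc, h₃, Category.assoc, inc₂_mul hE X f, mulOf]
  refine (Category.assoc _ _ _).symm.trans
    ((congrArg (· ≫ E.subst f.e (f.path.homs X) ≫ inc X f.path) h₁).trans (Category.assoc _ _ _))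

theorem gamma_assoc (X : EGraph V) (a b : X.Obj) :
    gammaMapHom (X := E.gammaObj (E.gammaObj X)) (Y := E.gammaObj X)
        (EGraph.Hom.mk (fun a => a) (gammaMulHom hE X)) a b ≫ gammaMulHom hE X a b =
      gammaMulHom hE (E.gammaObj X) a b ≫ gammaMulHom hE X a b := by
  refine gamma₃_ext hE fun q p s => ?_
  let c' : Concat q p := Classical.arbitrary _
  obtain ⟨s, rfl⟩ := exists_reindex c' s
  let f : Concat c'.path s := Classical.arbitrary _
  rw [gamma_assoc_aux hE X q p c' s f]
  let c : ∀ i, Concat (p i) (fun j => (s (c'.e.idx i j)).cast (c'.src i j).symm (c'.tgt i j).symm) :=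
    fun i => Classical.arbitrary _
  obtain ⟨g, hg⟩ := Juxt.exists_outer c'.e f.e (fun i => (c i).e)
  have hs : ∀ i u, (c i).path.vert u.castSucc = f.path.vert (g.idx i u).castSucc := by
    intro i u
    obtain ⟨j, l, rfl⟩ := (c i).e.surj u
    rw [hg, ← (c i).src j l]
    exact f.src _ l
  have ht : ∀ i u, (c i).path.vert u.succ = f.path.vert (g.idx i u).succ := by
    intro i u
    obtain ⟨j, l, rfl⟩ := (c i).e.surj u
    rw [hg, ← (c i).tgt j l]
    exact f.tgt _ l
  let d : Concat q (fun i => (c i).path) := ⟨f.path, g, hs, ht⟩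
  refine (inc₃_mul hE X q p _ c d).trans ?_
  rw [mulOf]
  have hass := E.assoc c'.e f.e (fun i => (c i).e) g hg (f.path.homs X)
  refine Eq.trans ?_ (congrArg (fun z => (E.tensor q.len).map (fun i => (E.tensor (p i).len).map
    fun j => (E.tensor (s (c'.e.idx i j)).len).map fun l =>
          X.cast (f.src (c'.e.idx i j) l) (f.tgt (c'.e.idx i j) l)) ≫ z ≫ inc X f.path) hass |>.trans ?_)
  · rw [Category.assoc]
    refine (map_map_assoc _ _ _).trans (Eq.trans ?_ (map_map_assoc _ _ _).symm)
    refine map_eq_comp (fun i => ?_) _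
    have hn := E.subst_naturality (c i).e (W := (c i).path.homs X)
      (W' := fun u => f.path.homs X (g.idx i u)) (fun u => X.cast (hs i u) (ht i u))
    rw [Category.assoc]
    refine (congrArg (_ ≫ ·) hn).trans ?_
    refine (map_map_assoc _ _ _).trans (Eq.trans ?_ (map_map_assoc _ _ _).symm)
    refine map_eq_comp (fun j => ?_) _
    refine (map_map _ _).trans (Eq.trans ?_ (map_map _ _).symm)
    refine map_eq fun l => ?_
    refine (EGraph.cast_trans _ _ _ _ _).trans ?_
    exact (eqToHom_trans _ _).symm
  · exact congrArg (_ ≫ ·) (Category.assoc _ _ _)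

/-- The monad `Γ E` on `𝒢V` associated with a distributive multitensor `E`. -/
def gamma : Monad (EGraph V) where
  toFunctor := E.gammaFunctor
  η :=
    { app := fun X => EGraph.Hom.mk (fun a => a) (E.gammaUnitHom X)
      naturality := fun _ _ f => EGraph.mk_ext (gammaUnitHom_naturality f) }
  μ :=
    { app := fun X => EGraph.Hom.mk (fun a => a) (gammaMulHom hE X)
      naturality := fun _ _ f => EGraph.mk_ext (gammaMulHom_naturality hE f) }
  assoc X := EGraph.mk_ext (gamma_assoc hE X)
  left_unit X := EGraph.mk_ext (gamma_left_unit hE X)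
  right_unit X := EGraph.mk_ext (gamma_right_unit hE X)

end Multitensor

/-! ### Coproducts and products of enriched graphs -/

/-- A functor preserves coproducts: it sends coproduct cocones to coproduct cocones. -/
def PreservesCoproducts {V W : Type (u + 1)} [LargeCategory.{u} V] [LargeCategory.{u} W]
    (F : V ⥤ W) : Prop :=
  ∀ (J : Type u) (Z : J → V) (c : Cofan Z), Nonempty (IsColimit c) →
    Nonempty (IsColimit (Cofan.mk (f := fun j => F.obj (Z j)) (F.obj c.pt)
      (fun j => F.map (c.inj j))))

/-- Finite products distribute over coproducts in `V`: the `n`-fold products preserve coproducts in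
each variable. -/
def ProductsDistribute (V : Type (u + 1)) [LargeCategory.{u} V] [HasFiniteProducts V] : Prop :=
  ∀ n, PreservesCoproductsInEachVariable (prodFunctor V n)

section
variable {V : Type (u + 1)} [LargeCategory.{u} V]

theorem preservesCoproducts_id : PreservesCoproducts (𝟭 V) :=
  fun _ _ _ ⟨hc⟩ => ⟨hc.ofIsoColimit (Cofan.ext (Iso.refl _))⟩

theorem timesMultitensor_isDistributive [HasFiniteProducts V] (hV : ProductsDistribute V)
    (T : Monad V) (hT : PreservesCoproducts T.toFunctor) :
    (timesMultitensor T).IsDistributive :=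
  fun n P Z c hc => hV n P (fun i p => T.obj (Z i p)) (fun i => Cofan.mk (T.obj (c i).pt)
    fun p => T.map ((c i).inj p)) (fun i => hT _ _ _ (hc i))

theorem isInitial_of_empty {L : Type u} [IsEmpty L] {W : L → V} {A : V} (i : ∀ l, W l ⟶ A)
    (h : IsColimit (Cofan.mk A i)) : Nonempty (IsInitial A) :=
  ⟨IsInitial.ofUniqueHom (fun _ => Cofan.IsColimit.desc h (fun l => isEmptyElim l))
    (fun _ _ => Cofan.IsColimit.hom_ext h _ _ (fun l => isEmptyElim l))⟩

/-- A coproduct of initial objects is initial. -/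
theorem isInitial_of_coprod {L : Type u} {W : L → V} {A : V} (i : ∀ l, W l ⟶ A)
    (h : IsColimit (Cofan.mk A i)) (hW : ∀ l, Nonempty (IsInitial (W l))) :
    Nonempty (IsInitial A) :=
  ⟨IsInitial.ofUniqueHom (fun B => Cofan.IsColimit.desc h (fun l => (hW l).some.to B))
    (fun _ _ => Cofan.IsColimit.hom_ext h _ _ (fun l => (hW l).some.hom_ext _ _))⟩

/-- Initial summands can be omitted from a coproduct. -/
theorem isColimit_of_reindex {K L : Type u} {Z : K → V} {W : L → V} {A : V} (i : ∀ l, W l ⟶ A)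
    (h : IsColimit (Cofan.mk A i)) (φ : K → L) (hφ : Function.Injective φ)
    (g : ∀ k, Z k ⟶ W (φ k)) (hg : ∀ k, IsIso (g k))
    (hW : ∀ l, (∀ k, φ k ≠ l) → Nonempty (IsInitial (W l))) :
    Nonempty (IsColimit (Cofan.mk A (fun k => g k ≫ i (φ k)))) := by
  classical
  have hd : ∀ (B : V) (f : ∀ k, Z k ⟶ B), ∃ m : ∀ l, W l ⟶ B, ∀ k, m (φ k) = inv (g k) ≫ f k := by
    intro B f
    have : ∀ l, ∃ m : W l ⟶ B, ∀ k (e : φ k = l), eqToHom (congrArg W e) ≫ m = inv (g k) ≫ f k := by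
      intro l
      by_cases hl : ∃ k, φ k = l
      · obtain ⟨k, rfl⟩ := hl
        refine ⟨inv (g k) ≫ f k, fun k' e => ?_⟩
        obtain rfl := hφ e
        simp
      · push Not at hl
        exact ⟨(hW l hl).some.to B, fun k e => absurd e (hl k)⟩
    choose m hm using this
    exact ⟨m, fun k => by simpa using hm _ k rfl⟩
  choose m hm using hd
  refine ⟨Cofan.IsColimit.mk _ (fun s => Cofan.IsColimit.desc h (m s.pt s.inj)) ?_ ?_⟩
  · intro s k
    have := Cofan.IsColimit.fac h (m s.pt s.inj) (φ k)
    have h' : i (φ k) ≫ Cofan.IsColimit.desc h (m s.pt s.inj) = m s.pt s.inj (φ k) := this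
    simp [h', hm]
  · intro s q hq
    refine Cofan.IsColimit.hom_ext h _ _ fun l => ?_
    rw [Cofan.IsColimit.fac]
    by_cases hl : ∃ k, φ k = l
    · obtain ⟨k, rfl⟩ := hl
      have h₁ : (g k ≫ i (φ k)) ≫ q = s.inj k := hq k
      change i (φ k) ≫ q = _
      rw [hm, ← h₁]
      simp
    · push Not at hl
      exact (hW l hl).some.hom_ext _ _

/-- A morphism which carries a coproduct cocone to a coproduct cocone is invertible. -/
theorem isIso_of_isColimit {K : Type u} {Z : K → V} {A B : V} {i : ∀ k, Z k ⟶ A} {j : ∀ k, Z k ⟶ B}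
    (hi : IsColimit (Cofan.mk A i)) (hj : IsColimit (Cofan.mk B j)) (m : A ⟶ B)
    (hm : ∀ k, i k ≫ m = j k) : IsIso m := by
  have fi : ∀ {C} (f : ∀ k, Z k ⟶ C) k, i k ≫ Cofan.IsColimit.desc hi f = f k :=
    fun f k => Cofan.IsColimit.fac hi f k
  have fj : ∀ {C} (f : ∀ k, Z k ⟶ C) k, j k ≫ Cofan.IsColimit.desc hj f = f k :=
    fun f k => Cofan.IsColimit.fac hj f k
  refine ⟨⟨Cofan.IsColimit.desc hj i, ?_, ?_⟩⟩
  · refine Cofan.IsColimit.hom_ext hi _ _ fun k => ?_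
    change i k ≫ m ≫ _ = i k ≫ 𝟙 _
    rw [← Category.assoc, hm, fj, Category.comp_id]
  · refine Cofan.IsColimit.hom_ext hj _ _ fun k => ?_
    change j k ≫ _ ≫ m = j k ≫ 𝟙 _
    rw [← Category.assoc, fj, hm, Category.comp_id]

theorem PreservesCoproductsInEachVariable.isInitial {n : ℕ} {F : (Fin n → V) ⥤ V}
    (hF : PreservesCoproductsInEachVariable F) (Z : Fin n → V) (i : Fin n)
    (hi : Nonempty (IsInitial (Z i))) : Nonempty (IsInitial (F.obj Z)) := by
  have := hF (fun k => {_x : PUnit.{u + 1} // k ≠ i}) (fun k _ => Z k)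
    (fun k => Cofan.mk (Z k) fun _ => 𝟙 _) (fun k => by
      by_cases hk : k = i
      · subst hk
        exact ⟨Cofan.IsColimit.mk _ (fun s => hi.some.to _) (fun s p => absurd rfl p.2)
          (fun s m _ => hi.some.hom_ext _ _)⟩
      · exact ⟨Cofan.IsColimit.mk _ (fun s => s.inj ⟨PUnit.unit, hk⟩) (fun s p => by simp)
          (fun s m hm => by simpa using hm ⟨PUnit.unit, hk⟩)⟩)
  obtain ⟨h⟩ := this
  have : IsEmpty (∀ k : Fin n, {_x : PUnit.{u + 1} // k ≠ i}) := ⟨fun p => (p i).2 rfl⟩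
  exact isInitial_of_empty _ h

theorem PreservesCoproductsInEachVariable.of_iso {n : ℕ} {F G : (Fin n → V) ⥤ V}
    (hF : PreservesCoproductsInEachVariable F) (α : F ≅ G) :
    PreservesCoproductsInEachVariable G := by
  intro P Z c hc
  obtain ⟨h⟩ := hF P Z c hc
  have fac : ∀ {A : V} (f : ∀ p : (∀ i, P i), F.obj (fun i => Z i (p i)) ⟶ A) p,
      (F.map fun i => (c i).inj (p i)) ≫ Cofan.IsColimit.desc h f = f p :=
    fun f p => Cofan.IsColimit.fac h f p
  refine ⟨Cofan.IsColimit.mk _ (fun s => α.inv.app _ ≫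
    Cofan.IsColimit.desc h fun p => α.hom.app _ ≫ s.inj p) ?_ ?_⟩
  · intro s p
    change G.map _ ≫ α.inv.app _ ≫ _ = _
    rw [← Category.assoc, α.inv.naturality, Category.assoc, fac]
    simp
  · intro s m hm
    have h₁ : ∀ p, (G.map fun i => (c i).inj (p i)) ≫ m = s.inj p := hm
    have h₂ : Cofan.IsColimit.desc h (fun p => α.hom.app _ ≫ s.inj p) = α.hom.app _ ≫ m := by
      refine Cofan.IsColimit.hom_ext h _ _ fun p => ?_
      rw [Cofan.IsColimit.fac, ← h₁ p, ← Category.assoc, ← α.hom.naturality, Category.assoc]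
      rfl
    change m = α.inv.app _ ≫ _
    rw [h₂, ← Category.assoc, Iso.inv_hom_id_app, Category.id_comp]

end

theorem pi_sigma_bijective {n : ℕ} {P : Fin n → Type u} {Z : ∀ i, P i → Type u} {C : Fin n → Type u}
    (f : ∀ i p, Z i p → C i)
    (h : ∀ i, Function.Bijective (fun x : Σ p, Z i p => f i x.1 x.2)) :
    Function.Bijective
      (fun x : Σ p : (∀ i, P i), ∀ i, Z i (p i) => fun i => f i (x.1 i) (x.2 i)) := by
  constructor
  · rintro ⟨p, x⟩ ⟨p', x'⟩ e
    have : (fun i => (⟨p i, x i⟩ : Σ p, Z i p)) = fun i => ⟨p' i, x' i⟩ :=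
      funext fun i => (h i).1 (congrFun e i)
    exact congrArg (fun w : ∀ i, Σ p, Z i p =>
      (⟨fun i => (w i).1, fun i => (w i).2⟩ : Σ p : (∀ i, P i), ∀ i, Z i (p i))) this
  · intro y
    choose w hw using fun i => (h i).2 (y i)
    exact ⟨⟨fun i => (w i).1, fun i => (w i).2⟩, funext hw⟩

theorem nonempty_isColimit_type_iff {K : Type u} {Z : K → Type u} (c : Cofan Z) :
    Nonempty (IsColimit c) ↔ Function.Bijective (fun x : Σ k, Z k => c.inj x.1 x.2) :=
  Cofan.nonempty_isColimit_iff_bijective_fromSigma c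

theorem productsDistribute_type : ProductsDistribute (Type u) := by
  intro n P Z c hc
  rw [nonempty_isColimit_type_iff]
  have h := pi_sigma_bijective (fun i p => (c i).inj p)
    (fun i => (nonempty_isColimit_type_iff _).1 (hc i))
  let e : ∀ W : Fin n → Type u, (∏ᶜ W : Type u) ≃ ∀ i, W i := fun W => (Types.productIso W).toEquiv
  have he : ∀ W x i, e W x i = Pi.π W i x := fun W x i =>
    ConcreteCategory.congr_hom (Types.productIso_hom_comp_eval W i) x
  have h₂ : ⇑(e fun i => (c i).pt) ∘ (fun x : Σ p : (∀ i, P i), (∏ᶜ fun i => Z i (p i) : Type u) =>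
      (Limits.Pi.map fun i => (c i).inj (x.1 i)) x.2) =
      (fun x : Σ p : (∀ i, P i), ∀ i, Z i (p i) => fun i => (c i).inj (x.1 i) (x.2 i)) ∘
        ⇑(Equiv.sigmaCongrRight fun p : (∀ i, P i) => e fun i => Z i (p i)) := by
    funext ⟨p, x⟩ i
    refine (he _ _ i).trans ?_
    refine (ConcreteCategory.congr_hom (Limits.Pi.map_π (fun i => (c i).inj (p i)) i) x).trans ?_
    exact congrArg ((c i).inj (p i)) (he (fun i => Z i (p i)) x i).symm
  have h₃ := h.comp (Equiv.sigmaCongrRight fun p : (∀ i, P i) => e fun i => Z i (p i)).bijective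
  rw [← h₂] at h₃
  exact (Function.Bijective.of_comp_iff' (e fun i => (c i).pt).bijective _).1 h₃

namespace EGraph

section
variable {V : Type (u + 1)} [LargeCategory.{u} V]

/-- An isomorphism of enriched graphs is a bijection on objects with invertible hom maps. -/
theorem isIso_of_bijective {X Y : EGraph V} (f : X ⟶ Y) (h : Function.Bijective f.obj)
    (h' : ∀ a b, IsIso (f.map a b)) : IsIso f := by
  let e := Equiv.ofBijective _ h
  have he : ∀ y, f.obj (e.symm y) = y := fun y => e.apply_symm_apply y
  have he' : ∀ x, e.symm (f.obj x) = x := fun x => e.symm_apply_apply x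
  let g : Y ⟶ X := Hom.mk (fun y => e.symm y) (fun y z =>
    Y.cast (he y).symm (he z).symm ≫ inv (f.map (e.symm y) (e.symm z)))
  refine ⟨⟨g, hom_ext he' fun a b => ?_, hom_ext he fun a b => ?_⟩⟩
  · change (f.map a b ≫ Y.cast _ _ ≫ inv _) ≫ X.cast _ _ = 𝟙 _
    have h₁ := cast_map f (he' a).symm (he' b).symm
    rw [← Category.assoc (f.map a b), ← h₁]
    simp
  · change ((Y.cast _ _ ≫ inv (f.map _ _)) ≫ f.map _ _) ≫ Y.cast _ _ = 𝟙 _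
    simp

theorem bijective_of_isIso {X Y : EGraph V} (f : X ⟶ Y) [IsIso f] : Function.Bijective f.obj :=
  Function.bijective_iff_has_inverse.2 ⟨(inv f).obj,
    fun x => congrArg (fun g : X ⟶ X => g.obj x) (IsIso.hom_inv_id f),
    fun y => congrArg (fun g : Y ⟶ Y => g.obj y) (IsIso.inv_hom_id f)⟩

theorem map_eq_of_eq {X Y : EGraph V} {f g : X ⟶ Y} (h : f = g) (a b : X.Obj) :
    f.map a b = g.map a b ≫ Y.cast (by rw [h]) (by rw [h]) := by
  subst h
  simp

theorem isIso_map_of_isIso {X Y : EGraph V} (f : X ⟶ Y) [IsIso f] (a b : X.Obj) :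
    IsIso (f.map a b) := by
  have h₁ := map_eq_of_eq (IsIso.hom_inv_id f) a b
  have h₂ : ∀ x y, (inv f).map x y ≫ f.map _ _ = _ := map_eq_of_eq (IsIso.inv_hom_id f)
  simp only [id_map, Category.id_comp, comp_map] at h₁
  have m : Mono (f.map a b) := by
    have : IsIso (f.map a b ≫ (inv f).map _ _) := by rw [h₁]; infer_instance
    exact mono_of_mono _ ((inv f).map _ _)
  have s : IsSplitEpi (f.map a b) := by
    have e : ∀ a, (inv f).obj (f.obj a) = a :=
      fun x => congrArg (fun g : X ⟶ X => g.obj x) (IsIso.hom_inv_id f)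
    refine IsSplitEpi.mk' ⟨(inv f).map _ _ ≫ X.cast (e a) (e b), ?_⟩
    rw [Category.assoc, cast_map, ← Category.assoc, h₂]
    simp
  exact isIso_of_mono_of_isSplitEpi _

end

section Coproducts

variable {V : Type (u + 1)} [LargeCategory.{u} V]

/-- The coproduct cocones of enriched graphs: the objects are the disjoint union, the homs within a
summand are those of that summand and the homs between different summands are initial. -/
structure IsCoproduct {J : Type u} {X : J → EGraph V} (c : Cofan X) : Prop where
  bijective : Function.Bijective (fun x : Σ j, (X j).Obj => (c.inj x.1).obj x.2)
  isIso_map : ∀ j a b, IsIso ((c.inj j).map a b)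
  isInitial : ∀ j j' a b, j ≠ j' →
    Nonempty (IsInitial (c.pt.hom ((c.inj j).obj a) ((c.inj j').obj b)))

variable [HasInitial V] {J : Type u} (X : J → EGraph V)

open Classical in
/-- The homs of a coproduct of enriched graphs. -/
def coprodHom (x y : Σ j, (X j).Obj) : V :=
  if h : x.1 = y.1 then (X y.1).hom (h ▸ x.2) y.2 else ⊥_ V

/-- The coproduct of enriched graphs. -/
@[reducible] def coprodObj : EGraph V where
  Obj := Σ j, (X j).Obj
  hom := coprodHom X

theorem coprodHom_self (j : J) (a b : (X j).Obj) :
    (X j).hom a b = coprodHom X ⟨j, a⟩ ⟨j, b⟩ := by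
  simp [coprodHom]

theorem coprodHom_initial (x y : Σ j, (X j).Obj) (h : x.1 ≠ y.1) :
    Nonempty (IsInitial (coprodHom X x y)) := by
  rw [coprodHom, dif_neg h]
  exact ⟨initialIsInitial⟩

/-- The inclusion of a summand. -/
@[reducible] def coprodInj (j : J) : X j ⟶ coprodObj X :=
  Hom.mk (fun a => ⟨j, a⟩) (fun a b => eqToHom (coprodHom_self X j a b))

theorem exists_desc {A : (Σ j, (X j).Obj) → (Σ j, (X j).Obj) → V}
    (f : ∀ j a b, (X j).hom a b ⟶ A ⟨j, a⟩ ⟨j, b⟩) :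
    ∃ m : ∀ x y, coprodHom X x y ⟶ A x y,
      ∀ j a b, eqToHom (coprodHom_self X j a b) ≫ m ⟨j, a⟩ ⟨j, b⟩ = f j a b := by
  have : ∀ x y, ∃ m : coprodHom X x y ⟶ A x y, ∀ j a b (h : ⟨j, a⟩ = x) (h' : ⟨j, b⟩ = y),
      eqToHom ((coprodHom_self X j a b).trans (by rw [h, h'])) ≫ m =
        f j a b ≫ eqToHom (by rw [h, h']) := by
    rintro ⟨j, a⟩ ⟨j', b⟩
    by_cases h : j = j'
    · subst h
      refine ⟨eqToHom (coprodHom_self X j a b).symm ≫ f j a b, fun j' a' b' e e' => ?_⟩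
      cases e
      cases e'
      simp
    · refine ⟨(coprodHom_initial X ⟨j, a⟩ ⟨j', b⟩ h).some.to _, fun j' a' b' e e' => ?_⟩
      cases e
      cases e'
      exact absurd rfl h
  choose m hm using this
  exact ⟨m, fun j a b => by simpa using hm _ _ j a b rfl rfl⟩

theorem coprodHom_ext {x y : Σ j, (X j).Obj} {A : V} {f g : coprodHom X x y ⟶ A}
    (h : ∀ j a b (e : ⟨j, a⟩ = x) (e' : ⟨j, b⟩ = y),
      eqToHom ((coprodHom_self X j a b).trans (by rw [e, e'])) ≫ f =
        eqToHom ((coprodHom_self X j a b).trans (by rw [e, e'])) ≫ g) : f = g := by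
  obtain ⟨j, a⟩ := x
  obtain ⟨j', b⟩ := y
  by_cases e : j = j'
  · subst e
    exact (cancel_epi _).1 (h j a b rfl rfl)
  · exact (coprodHom_initial X ⟨j, a⟩ ⟨j', b⟩ e).some.hom_ext _ _

/-- The universal property of the coproduct. -/
def coprodIsColimit : IsColimit (Cofan.mk (coprodObj X) (coprodInj X)) :=
  Cofan.IsColimit.mk _
    (fun s => Hom.mk (fun x => (s.inj x.1).obj x.2)
      (exists_desc X (A := fun x y => s.pt.hom ((s.inj x.1).obj x.2) ((s.inj y.1).obj y.2))
        (fun j a b => (s.inj j).map a b)).choose)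
    (fun s j => mk_ext fun a b => (exists_desc X
      (A := fun x y => s.pt.hom ((s.inj x.1).obj x.2) ((s.inj y.1).obj y.2))
        (fun j a b => (s.inj j).map a b)).choose_spec j a b)
    (fun s m hm => by
      have h : ∀ j, coprodInj X j ≫ m = s.inj j := hm
      have hx : ∀ x : Σ j, (X j).Obj, m.obj x = (s.inj x.1).obj x.2 :=
        fun x => congrArg (fun g : X x.1 ⟶ s.pt => g.obj x.2) (h x.1)
      refine hom_ext hx fun x y => coprodHom_ext X fun j a b e e' => ?_
      subst e
      subst e'
      have h₁ := map_eq_of_eq (h j).symm a b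
      refine Eq.trans ?_ ((exists_desc X
        (A := fun x y => s.pt.hom ((s.inj x.1).obj x.2) ((s.inj y.1).obj y.2))
        (fun j a b => (s.inj j).map a b)).choose_spec j a b).symm
      refine Eq.trans ?_ h₁.symm
      exact (Category.assoc _ _ _).symm)

instance : HasCoproducts.{u} (EGraph V) :=
  hasCoproducts_of_colimit_cofans (fun X => Cofan.mk (coprodObj X) (coprodInj X))
    (fun X => coprodIsColimit X)

variable {X}

theorem isCoproduct_coprod : IsCoproduct (Cofan.mk (coprodObj X) (coprodInj X)) where
  bijective := Function.bijective_id
  isIso_map j a b := by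
    change IsIso (eqToHom (coprodHom_self X j a b))
    infer_instance
  isInitial j j' a b h := coprodHom_initial X ⟨j, a⟩ ⟨j', b⟩ h

theorem isCoproduct_of_iso {c c' : Cofan X} (h : IsCoproduct c) (f : c.pt ⟶ c'.pt) [IsIso f]
    (hf : ∀ j, c.inj j ≫ f = c'.inj j) : IsCoproduct c' := by
  have h₀ : ∀ j a, (c'.inj j).obj a = f.obj ((c.inj j).obj a) := fun j a => by
    rw [← hf]; rfl
  have h₁ : ∀ x y, IsIso (f.map x y) := isIso_map_of_isIso f
  refine ⟨?_, fun j a b => ?_, fun j j' a b hj => ?_⟩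
  · have := (bijective_of_isIso f).comp h.bijective
    convert this using 1
    funext x
    exact h₀ _ _
  · rw [map_eq_of_eq (hf j).symm a b, comp_map]
    have := h.isIso_map j a b
    infer_instance
  · rw [h₀, h₀]
    exact ⟨(h.isInitial j j' a b hj).some.ofIso (asIso (f.map _ _))⟩

theorem isCoproduct_of_isColimit {c : Cofan X} (h : Nonempty (IsColimit c)) : IsCoproduct c := by
  obtain ⟨h⟩ := h
  let e := IsColimit.coconePointUniqueUpToIso (coprodIsColimit X) h
  refine isCoproduct_of_iso isCoproduct_coprod e.hom fun j => ?_
  exact IsColimit.comp_coconePointUniqueUpToIso_hom (coprodIsColimit X) h ⟨j⟩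

theorem isColimit_of_isCoproduct {c : Cofan X} (h : IsCoproduct c) : Nonempty (IsColimit c) := by
  let d : coprodObj X ⟶ c.pt := Cofan.IsColimit.desc (coprodIsColimit X) c.inj
  have hd : ∀ j, coprodInj X j ≫ d = c.inj j := fun j =>
    Cofan.IsColimit.fac (coprodIsColimit X) c.inj j
  have hobj : ∀ x : Σ j, (X j).Obj, d.obj x = (c.inj x.1).obj x.2 :=
    fun x => by rw [← hd]; rfl
  have : IsIso d := by
    refine isIso_of_bijective d ?_ ?_
    · convert h.bijective using 1
      funext x
      exact hobj x
    · rintro ⟨j, a⟩ ⟨j', b⟩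
      by_cases hj : j = j'
      · subst hj
        have h₁ := map_eq_of_eq (hd j) a b
        have h₂ := h.isIso_map j a b
        have h₃ : IsIso (eqToHom (coprodHom_self X j a b) ≫ d.map ⟨j, a⟩ ⟨j, b⟩) := by
          have h₄ : eqToHom (coprodHom_self X j a b) ≫ d.map ⟨j, a⟩ ⟨j, b⟩ = _ := h₁
          rw [h₄]
          infer_instance
        exact IsIso.of_isIso_comp_left (eqToHom (coprodHom_self X j a b)) _
      · have i₁ := (coprodHom_initial X ⟨j, a⟩ ⟨j', b⟩ hj).some
        have i₂ := (h.isInitial j j' a b hj).some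
        rw [← hobj ⟨j, a⟩, ← hobj ⟨j', b⟩] at i₂
        exact ⟨⟨i₂.to _, i₁.hom_ext _ _, i₂.hom_ext _ _⟩⟩
  exact ⟨(coprodIsColimit X).ofIsoColimit (Cofan.ext (asIso d) hd)⟩

end Coproducts

end EGraph

namespace EGraph

section Products

variable {V : Type (u + 1)} [LargeCategory.{u} V] [HasFiniteProducts V] {n : ℕ}

/-- The product of enriched graphs. -/
@[reducible] def piObj (X : Fin n → EGraph V) : EGraph V where
  Obj := ∀ i, (X i).Obj
  hom a b := ∏ᶜ fun i => (X i).hom (a i) (b i)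

/-- The projections of a product of enriched graphs. -/
@[reducible] def piProj (X : Fin n → EGraph V) (i : Fin n) : piObj X ⟶ X i :=
  Hom.mk (fun a => a i) (fun _ _ => Pi.π _ i)

theorem cast_pi (X : Fin n → EGraph V) {a a' b b' : ∀ i, (X i).Obj} (h : a = a') (k : b = b')
    (i : Fin n) : (piObj X).cast h k ≫ Pi.π _ i =
      Pi.π _ i ≫ (X i).cast (congrFun h i) (congrFun k i) := by
  subst h k
  simp

/-- The universal property of the product. -/
def piIsLimit (X : Fin n → EGraph V) : IsLimit (Fan.mk (piObj X) (piProj X)) :=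
  Fan.IsLimit.mk _
    (fun s => Hom.mk (fun x i => (s.proj i).obj x) (fun x y => Pi.lift fun i => (s.proj i).map x y))
    (fun s i => mk_ext fun x y => Limits.Pi.lift_π _ i)
    (fun s m hm => by
      have h : ∀ i, m ≫ piProj X i = s.proj i := hm
      have hx : ∀ x, m.obj x = fun i => (s.proj i).obj x :=
        fun x => funext fun i => by rw [← h]; rfl
      refine hom_ext hx fun x y => Limits.Pi.hom_ext _ _ fun i => ?_
      have h₁ := map_eq_of_eq (h i).symm x y
      refine Eq.trans ?_ (Limits.Pi.lift_π (fun i => (s.proj i).map x y) i).symm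
      refine Eq.trans ?_ h₁.symm
      refine (Category.assoc _ _ _).trans ((congrArg (m.map x y ≫ ·) (cast_pi X _ _ i)).trans ?_)
      exact (Category.assoc _ _ _).symm)

instance : HasFiniteProducts (EGraph V) where
  out _ :=
    { has_limit := fun F =>
        haveI : HasLimit (Discrete.functor (F.obj ∘ Discrete.mk)) := ⟨⟨⟨_, piIsLimit _⟩⟩⟩
        hasLimit_of_iso (Discrete.natIsoFunctor (F := F)).symm }

variable (V n)

/-- The `n`-fold product functor on enriched graphs. -/
def piFunctor : (Fin n → EGraph V) ⥤ EGraph V where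
  obj X := piObj X
  map f := Hom.mk (fun a i => (f i).obj (a i)) (fun a b => Limits.Pi.map fun i => (f i).map _ _)
  map_id X := mk_ext fun a b => Limits.Pi.hom_ext _ _ fun i => by simp
  map_comp f g := mk_ext fun a b => Limits.Pi.hom_ext _ _ fun i => by simp

/-- The product functor is given by the explicit products. -/
def piFunctorIso : piFunctor V n ≅ prodFunctor (EGraph V) n :=
  NatIso.ofComponents
    (fun X => IsLimit.conePointUniqueUpToIso (piIsLimit X) (productIsProduct X))
    (fun {X Y} f => Limits.Pi.hom_ext _ _ fun i => by
      have h : ∀ X : Fin n → EGraph V,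
          (IsLimit.conePointUniqueUpToIso (piIsLimit X) (productIsProduct X)).hom ≫ Pi.π X i =
            piProj X i :=
        fun X => IsLimit.conePointUniqueUpToIso_hom_comp (piIsLimit X) (productIsProduct X) ⟨i⟩
      refine (Category.assoc _ _ _).trans ((congrArg (_ ≫ ·) (h Y)).trans ?_)
      refine Eq.trans ?_ (Category.assoc _ _ _).symm
      refine Eq.trans ?_ (congrArg (_ ≫ ·) (Limits.Pi.map_π f i)).symm
      refine Eq.trans ?_ (Category.assoc _ _ _)
      refine Eq.trans ?_ (congrArg (· ≫ f i) (h X)).symm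
      exact mk_ext fun a b => Limits.Pi.map_π (fun i => (f i).map (a i) (b i)) i)

variable {V}

theorem productsDistribute [HasInitial V] (hV : ProductsDistribute V) :
    ProductsDistribute (EGraph V) := by
  intro n
  refine PreservesCoproductsInEachVariable.of_iso ?_ (piFunctorIso V n)
  intro P Z c hc
  have h := fun i => isCoproduct_of_isColimit (hc i)
  refine isColimit_of_isCoproduct ⟨?_, ?_, ?_⟩
  · exact pi_sigma_bijective (fun i p => ((c i).inj p).obj) (fun i => (h i).bijective)
  · intro p a b
    have h' := fun i => (h i).isIso_map (p i) (a i) (b i)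
    change IsIso (Limits.Pi.map fun i => ((c i).inj (p i)).map (a i) (b i))
    infer_instance
  · intro p p' a b hp
    obtain ⟨i, hi⟩ := Function.ne_iff.1 hp
    exact (hV n).isInitial
      (fun i => (c i).pt.hom (((c i).inj (p i)).obj (a i)) (((c i).inj (p' i)).obj (b i))) i
      ((h i).isInitial (p i) (p' i) (a i) (b i) hi)

end Products

end EGraph

namespace Multitensor

variable {V : Type (u + 1)} [LargeCategory.{u} V] [HasCoproducts.{u} V] {E : Multitensor V}

theorem hasInitial_of_hasCoproducts (V : Type (u + 1)) [LargeCategory.{u} V] [HasCoproducts.{u} V] :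
    HasInitial V :=
  have : HasFiniteCoproducts V := hasFiniteCoproducts_of_hasCoproducts V
  inferInstance

theorem EPath.map_injective {O O' : Type u} {f : O → O'} (hf : Function.Injective f) {a b : O} :
    Function.Injective (fun p : EPath a b => p.map f) := by
  rintro ⟨n, x, h, h'⟩ ⟨m, y, k, k'⟩ e
  obtain rfl : n = m := congrArg EPath.len e
  have e' : (fun i => f (x i)) = fun i => f (y i) := by
    have := (EPath.mk.injEq _ _ _ _ _ _ _ _).mp e
    exact eq_of_heq this.2
  obtain rfl : x = y := funext fun i => hf (congrFun e' i)
  rfl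

theorem EPath.mk_vert {O : Type u} {a b : O} (p : EPath a b) (x : Fin (p.len + 1) → O)
    (hx : ∀ i, x i = p.vert i) (h₀ : x 0 = a) (h₁ : x (Fin.last _) = b) :
    EPath.mk p.len x h₀ h₁ = p := by
  obtain rfl : x = p.vert := funext hx
  rfl

theorem exists_crossing {O : Type u} {J : Type u} (g : O → J) {a b : O} (p : EPath a b)
    (h : ∃ i, g (p.vert i) ≠ g a) :
    ∃ i : Fin p.len, g (p.vert i.castSucc) ≠ g (p.vert i.succ) := by
  by_contra! hc
  obtain ⟨i, hi⟩ := h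
  refine hi ?_
  induction i using Fin.induction with
  | zero => rw [p.vert_zero]
  | succ i ih =>
    rw [← hc i]
    by_contra h
    exact h (by_contra fun h' => h' (ih h))

theorem gamma_preservesCoproducts (hE : E.IsDistributive) :
    PreservesCoproducts (gamma hE).toFunctor := by
  intro J X c hc
  have := hasInitial_of_hasCoproducts V
  have h := EGraph.isCoproduct_of_isColimit hc
  -- the component of an object, and the object of the component
  let e := Equiv.ofBijective _ h.bijective
  let g : c.pt.Obj → J := fun x => (e.symm x).1
  have hg : ∀ j a, g ((c.inj j).obj a) = j := fun j a =>
    congrArg Sigma.fst (e.symm_apply_apply ⟨j, a⟩)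
  have hinj : ∀ j, Function.Injective (c.inj j).obj := fun j a b hab => by
    have := h.bijective.1 (a₁ := ⟨j, a⟩) (a₂ := ⟨j, b⟩) hab
    simpa using this
  have hsurj : ∀ j x, g x = j → ∃ a, (c.inj j).obj a = x := by
    rintro j x rfl
    exact ⟨(e.symm x).2, e.apply_symm_apply x⟩
  have hinit : ∀ x y, g x ≠ g y → Nonempty (IsInitial (c.pt.hom x y)) := by
    intro x y hxy
    obtain ⟨a, ha⟩ := hsurj _ x rfl
    obtain ⟨b, hb⟩ := hsurj _ y rfl
    have := h.isInitial _ _ a b hxy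
    rwa [ha, hb] at this
  have hpath : ∀ {x y} (p : EPath x y), (∃ i, g (p.vert i) ≠ g x) →
      Nonempty (IsInitial ((E.tensor p.len).obj (p.homs c.pt))) := by
    intro x y p hp
    obtain ⟨i, hi⟩ := exists_crossing g p hp
    exact (hE p.len).isInitial _ i (hinit _ _ hi)
  refine EGraph.isColimit_of_isCoproduct ⟨h.bijective, fun j a b => ?_, fun j j' a b hj => ?_⟩
  · have hiso := h.isIso_map j
    obtain ⟨hcol⟩ := isColimit_of_reindex (Z := fun p : EPath a b => (E.tensor p.len).obj (p.homs (X j)))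
      _ (gammaIsColimit (E := E) c.pt ((c.inj j).obj a) ((c.inj j).obj b))
      (fun p => p.map (c.inj j).obj) (EPath.map_injective (hinj j))
      (fun p => (E.tensor p.len).map (fun i => (c.inj j).map (p.vert i.castSucc) (p.vert i.succ)))
      (fun p => by
        have hi : ∀ i : Fin p.len, IsIso ((c.inj j).map (p.vert i.castSucc) (p.vert i.succ)) :=
          fun i => hiso _ _
        exact ⟨(E.tensor p.len).map fun i => inv ((c.inj j).map (p.vert i.castSucc) (p.vert i.succ)),
          (map_map _ _).trans (map_one _ fun i => IsIso.hom_inv_id _),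
          (map_map _ _).trans (map_one _ fun i => IsIso.inv_hom_id _)⟩)
      (fun p hp => by
        refine hpath p ?_
        by_contra! hall
        choose v hv using fun i => hsurj j (p.vert i) ((hall i).trans (hg j a))
        refine hp ⟨p.len, v, hinj j ((hv _).trans p.vert_zero), hinj j ((hv _).trans p.vert_last)⟩ ?_
        exact EPath.mk_vert p _ hv _ _)
    exact isIso_of_isColimit (gammaIsColimit (X j) a b) hcol (gammaMapHom (c.inj j) a b)
      (fun p => inc_mapHom _ _)
  · refine isInitial_of_coprod _ (gammaIsColimit (E := E) c.pt ((c.inj j).obj a) ((c.inj j').obj b))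
      fun p => hpath p ⟨Fin.last _, ?_⟩
    intro hh
    rw [p.vert_last] at hh
    exact hj ((hg j a).symm.trans (hh.symm.trans (hg j' b)))

end Multitensor

/-! ### Enriched categories -/

section
open MonoidalCategory CartesianMonoidalCategory

/-- A category enriched in `V` with a set of objects. -/
structure VCat (V : Type (u + 1)) [LargeCategory.{u} V] [MonoidalCategory V] : Type (u + 1) where
  carrier : Type u
  [str : EnrichedCategory.{u, u + 1, u} V carrier]

attribute [instance] VCat.str

namespace VCat

/-- The category of `V`-categories and `V`-functors. -/
instance instCategory (V : Type (u + 1)) [LargeCategory.{u} V] [MonoidalCategory V] :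
    LargeCategory.{u} (VCat V) where
  Hom A B := EnrichedFunctor V A.carrier B.carrier
  id A := EnrichedFunctor.id V A.carrier
  comp F G := EnrichedFunctor.comp V F G
  id_comp _ := EnrichedFunctor.ext V (fun _ => rfl)
    (fun _ _ => (Category.comp_id _).trans (Category.id_comp _))
  comp_id _ := EnrichedFunctor.ext V (fun _ => rfl)
    (fun _ _ => (Category.comp_id _).trans (Category.comp_id _))
  assoc _ _ _ := EnrichedFunctor.ext V (fun _ => rfl)
    (fun _ _ => (Category.comp_id _).trans (Category.assoc _ _ _))

/-- The underlying enriched graph of an enriched category. -/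
@[simps]
def forget (V : Type (u + 1)) [LargeCategory.{u} V] [MonoidalCategory V] : VCat V ⥤ EGraph V where
  obj A := { Obj := A.carrier, hom := fun a b => EnrichedCategory.Hom a b }
  map F := EGraph.Hom.mk (EnrichedFunctor.obj F) (EnrichedFunctor.map F)
  map_id _ := rfl
  map_comp _ _ := rfl

section
variable {V : Type (u + 1)} [LargeCategory.{u} V] [CartesianMonoidalCategory V]

/-- The terminal `V`-category. -/
def unit (V : Type (u + 1)) [LargeCategory.{u} V] [CartesianMonoidalCategory V] :
    VCat V where
  carrier := PUnit
  str :=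
    { Hom := fun _ _ => 𝟙_ V
      id := fun _ => 𝟙 _
      comp := fun _ _ _ => toUnit _
      id_comp := fun _ _ => toUnit_unique _ _
      comp_id := fun _ _ => toUnit_unique _ _
      assoc := fun _ _ _ _ => toUnit_unique _ _ }

/-- The terminal `V`-category is terminal. -/
def unitLimitCone : LimitCone (Functor.empty.{0} (VCat V)) where
  cone := asEmptyCone (unit V)
  isLimit := IsTerminal.ofUniqueHom
    (fun _ =>
      { obj := fun _ => PUnit.unit
        map := fun _ _ => toUnit _
        map_id := fun _ => toUnit_unique _ _
        map_comp := fun _ _ _ => toUnit_unique _ _ })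
    (fun _ _ => EnrichedFunctor.ext V (fun _ => rfl) (fun _ _ => toUnit_unique _ _))

theorem prod_id_comp {A A' B B' : V} (i : 𝟙_ V ⟶ A') (i' : 𝟙_ V ⟶ B') (m : A' ⊗ A ⟶ A)
    (m' : B' ⊗ B ⟶ B) (h : (λ_ A).inv ≫ i ▷ A ≫ m = 𝟙 A) (h' : (λ_ B).inv ≫ i' ▷ B ≫ m' = 𝟙 B) :
    (λ_ (A ⊗ B)).inv ≫ lift i i' ▷ (A ⊗ B) ≫
      lift ((fst _ _ ⊗ₘ fst _ _) ≫ m) ((snd _ _ ⊗ₘ snd _ _) ≫ m') = 𝟙 _ := by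
  have e : (λ_ (A ⊗ B)).inv ≫ lift i i' ▷ (A ⊗ B) ≫ (fst A' B' ⊗ₘ fst A B) =
      fst A B ≫ (λ_ A).inv ≫ i ▷ A := by ext <;> simp
  have e' : (λ_ (A ⊗ B)).inv ≫ lift i i' ▷ (A ⊗ B) ≫ (snd A' B' ⊗ₘ snd A B) =
      snd A B ≫ (λ_ B).inv ≫ i' ▷ B := by ext <;> simp
  refine CartesianMonoidalCategory.hom_ext _ _ ?_ ?_
  · have := congrArg (· ≫ m) e
    simp only [Category.assoc, h] at this
    simpa only [Category.assoc, lift_fst, Category.id_comp, Category.comp_id] using this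
  · have := congrArg (· ≫ m') e'
    simp only [Category.assoc, h'] at this
    simpa only [Category.assoc, lift_snd, Category.id_comp, Category.comp_id] using this

theorem prod_comp_id {A A' B B' : V} (i : 𝟙_ V ⟶ A') (i' : 𝟙_ V ⟶ B') (m : A ⊗ A' ⟶ A)
    (m' : B ⊗ B' ⟶ B) (h : (ρ_ A).inv ≫ A ◁ i ≫ m = 𝟙 A) (h' : (ρ_ B).inv ≫ B ◁ i' ≫ m' = 𝟙 B) :
    (ρ_ (A ⊗ B)).inv ≫ (A ⊗ B) ◁ lift i i' ≫
      lift ((fst _ _ ⊗ₘ fst _ _) ≫ m) ((snd _ _ ⊗ₘ snd _ _) ≫ m') = 𝟙 _ := by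
  have e : (ρ_ (A ⊗ B)).inv ≫ (A ⊗ B) ◁ lift i i' ≫ (fst A B ⊗ₘ fst A' B') =
      fst A B ≫ (ρ_ A).inv ≫ A ◁ i := by ext <;> simp
  have e' : (ρ_ (A ⊗ B)).inv ≫ (A ⊗ B) ◁ lift i i' ≫ (snd A B ⊗ₘ snd A' B') =
      snd A B ≫ (ρ_ B).inv ≫ B ◁ i' := by ext <;> simp
  refine CartesianMonoidalCategory.hom_ext _ _ ?_ ?_
  · have := congrArg (· ≫ m) e
    simp only [Category.assoc, h] at this
    simpa only [Category.assoc, lift_fst, Category.id_comp, Category.comp_id] using this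
  · have := congrArg (· ≫ m') e'
    simp only [Category.assoc, h'] at this
    simpa only [Category.assoc, lift_snd, Category.id_comp, Category.comp_id] using this

theorem prod_assoc {A₁ A₂ A₃ A₁₂ A₂₃ A B₁ B₂ B₃ B₁₂ B₂₃ B : V} (m₁ : A₁ ⊗ A₂ ⟶ A₁₂)
    (m₂ : A₁₂ ⊗ A₃ ⟶ A) (m₃ : A₂ ⊗ A₃ ⟶ A₂₃) (m₄ : A₁ ⊗ A₂₃ ⟶ A) (k₁ : B₁ ⊗ B₂ ⟶ B₁₂)
    (k₂ : B₁₂ ⊗ B₃ ⟶ B) (k₃ : B₂ ⊗ B₃ ⟶ B₂₃) (k₄ : B₁ ⊗ B₂₃ ⟶ B)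
    (h : (α_ _ _ _).inv ≫ m₁ ▷ _ ≫ m₂ = _ ◁ m₃ ≫ m₄)
    (h' : (α_ _ _ _).inv ≫ k₁ ▷ _ ≫ k₂ = _ ◁ k₃ ≫ k₄) :
    (α_ (A₁ ⊗ B₁) (A₂ ⊗ B₂) (A₃ ⊗ B₃)).inv ≫
      lift ((fst _ _ ⊗ₘ fst _ _) ≫ m₁) ((snd _ _ ⊗ₘ snd _ _) ≫ k₁) ▷ _ ≫
        lift ((fst _ _ ⊗ₘ fst _ _) ≫ m₂) ((snd _ _ ⊗ₘ snd _ _) ≫ k₂) =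
      (A₁ ⊗ B₁) ◁ lift ((fst _ _ ⊗ₘ fst _ _) ≫ m₃) ((snd _ _ ⊗ₘ snd _ _) ≫ k₃) ≫
        lift ((fst _ _ ⊗ₘ fst _ _) ≫ m₄) ((snd _ _ ⊗ₘ snd _ _) ≫ k₄) := by
  refine CartesianMonoidalCategory.hom_ext _ _ ?_ ?_
  · have e₁ : (α_ (A₁ ⊗ B₁) (A₂ ⊗ B₂) (A₃ ⊗ B₃)).inv ≫
        lift ((fst _ _ ⊗ₘ fst _ _) ≫ m₁) ((snd _ _ ⊗ₘ snd _ _) ≫ k₁) ▷ _ ≫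
          (fst _ _ ⊗ₘ fst _ _) =
        (fst A₁ B₁ ⊗ₘ (fst A₂ B₂ ⊗ₘ fst A₃ B₃)) ≫ (α_ _ _ _).inv ≫ m₁ ▷ _ := by
      refine CartesianMonoidalCategory.hom_ext _ _ ?_ (by simp)
      simp only [Category.assoc, tensorHom_fst, whiskerRight_fst, whiskerRight_fst_assoc, lift_fst]
      simp only [← Category.assoc]
      congr 1
      ext <;> simp
    have e₂ : (A₁ ⊗ B₁) ◁ lift ((fst _ _ ⊗ₘ fst _ _) ≫ m₃) ((snd _ _ ⊗ₘ snd _ _) ≫ k₃) ≫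
        (fst _ _ ⊗ₘ fst _ _) =
        (fst A₁ B₁ ⊗ₘ (fst A₂ B₂ ⊗ₘ fst A₃ B₃)) ≫ _ ◁ m₃ := by
      ext <;> simp
    have e₃ := congrArg (· ≫ m₂) e₁
    have e₄ := congrArg (· ≫ m₄) e₂
    simp only [Category.assoc, h] at e₃ e₄
    simp only [Category.assoc, lift_fst]
    exact e₃.trans e₄.symm
  · have e₁ : (α_ (A₁ ⊗ B₁) (A₂ ⊗ B₂) (A₃ ⊗ B₃)).inv ≫
        lift ((fst _ _ ⊗ₘ fst _ _) ≫ m₁) ((snd _ _ ⊗ₘ snd _ _) ≫ k₁) ▷ _ ≫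
          (snd _ _ ⊗ₘ snd _ _) =
        (snd A₁ B₁ ⊗ₘ (snd A₂ B₂ ⊗ₘ snd A₃ B₃)) ≫ (α_ _ _ _).inv ≫ k₁ ▷ _ := by
      refine CartesianMonoidalCategory.hom_ext _ _ ?_ (by simp)
      simp only [Category.assoc, tensorHom_fst, whiskerRight_fst, whiskerRight_fst_assoc, lift_snd]
      simp only [← Category.assoc]
      congr 1
      ext <;> simp
    have e₂ : (A₁ ⊗ B₁) ◁ lift ((fst _ _ ⊗ₘ fst _ _) ≫ m₃) ((snd _ _ ⊗ₘ snd _ _) ≫ k₃) ≫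
        (snd _ _ ⊗ₘ snd _ _) =
        (snd A₁ B₁ ⊗ₘ (snd A₂ B₂ ⊗ₘ snd A₃ B₃)) ≫ _ ◁ k₃ := by
      ext <;> simp
    have e₃ := congrArg (· ≫ k₂) e₁
    have e₄ := congrArg (· ≫ k₄) e₂
    simp only [Category.assoc, h'] at e₃ e₄
    simp only [Category.assoc, lift_snd]
    exact e₃.trans e₄.symm

theorem prod_map_comp {A₁ A₂ A B₁ B₂ B C₁ C₂ : V} (f₁ : C₁ ⟶ A₁) (f₂ : C₂ ⟶ A₂) (g₁ : C₁ ⟶ B₁)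
    (g₂ : C₂ ⟶ B₂) (m : A₁ ⊗ A₂ ⟶ A) (k : B₁ ⊗ B₂ ⟶ B) :
    lift ((f₁ ⊗ₘ f₂) ≫ m) ((g₁ ⊗ₘ g₂) ≫ k) =
      (lift f₁ g₁ ⊗ₘ lift f₂ g₂) ≫
        lift ((fst _ _ ⊗ₘ fst _ _) ≫ m) ((snd _ _ ⊗ₘ snd _ _) ≫ k) := by
  rw [comp_lift, ← Category.assoc, ← Category.assoc, tensorHom_comp_tensorHom,
    tensorHom_comp_tensorHom, lift_fst, lift_fst, lift_snd, lift_snd]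

/-- The product of two `V`-categories. -/
def prod (A B : VCat V) : VCat V where
  carrier := A.carrier × B.carrier
  str :=
    { Hom := fun x y => EnrichedCategory.Hom (V := V) x.1 y.1 ⊗ EnrichedCategory.Hom (V := V) x.2 y.2
      id := fun x => lift (eId V x.1) (eId V x.2)
      comp := fun x y z => lift ((fst _ _ ⊗ₘ fst _ _) ≫ eComp V x.1 y.1 z.1)
        ((snd _ _ ⊗ₘ snd _ _) ≫ eComp V x.2 y.2 z.2)
      id_comp := fun x y => prod_id_comp _ _ _ _ (e_id_comp V x.1 y.1) (e_id_comp V x.2 y.2)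
      comp_id := fun x y => prod_comp_id _ _ _ _ (e_comp_id V x.1 y.1) (e_comp_id V x.2 y.2)
      assoc := fun w x y z => prod_assoc _ _ _ _ _ _ _ _ (e_assoc V w.1 x.1 y.1 z.1)
        (e_assoc V w.2 x.2 y.2 z.2) }

/-- The product of two `V`-categories is a product. -/
def prodLimitCone (A B : VCat V) : LimitCone (pair A B) where
  cone := BinaryFan.mk (P := prod A B)
    { obj := fun x => x.1
      map := fun _ _ => fst _ _
      map_id := fun _ => lift_fst _ _
      map_comp := fun _ _ _ => lift_fst _ _ }
    { obj := fun x => x.2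
      map := fun _ _ => snd _ _
      map_id := fun _ => lift_snd _ _
      map_comp := fun _ _ _ => lift_snd _ _ }
  isLimit := BinaryFan.IsLimit.mk _
    (fun {C} F G =>
      { obj := fun x => (EnrichedFunctor.obj F x, EnrichedFunctor.obj G x)
        map := fun x y => lift (EnrichedFunctor.map F x y) (EnrichedFunctor.map G x y)
        map_id := fun x => by
          refine (comp_lift _ _ _).trans ?_
          rw [EnrichedFunctor.map_id, EnrichedFunctor.map_id]
          rfl
        map_comp := fun x y z => by
          refine (comp_lift _ _ _).trans ?_
          rw [EnrichedFunctor.map_comp, EnrichedFunctor.map_comp]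
          exact prod_map_comp _ _ _ _ _ _ })
    (fun _ _ => EnrichedFunctor.ext V (fun _ => rfl)
      (fun _ _ => (Category.comp_id _).trans (lift_fst _ _)))
    (fun _ _ => EnrichedFunctor.ext V (fun _ => rfl)
      (fun _ _ => (Category.comp_id _).trans (lift_snd _ _)))
    (fun F G M h₁ h₂ => by
      subst h₁ h₂
      exact EnrichedFunctor.ext V (fun _ => rfl)
        (fun _ _ => (Category.comp_id _).trans (lift_comp_fst_snd _).symm))

/-- The category of `V`-categories has finite products. -/
instance : CartesianMonoidalCategory (VCat V) :=
  CartesianMonoidalCategory.ofChosenFiniteProducts unitLimitCone prodLimitCone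

end

end VCat

end

/-! ### Globular sets and the monads -/

/-- The category `𝒢ⁿ(Set)` of `n`-globular sets: sets for `n = 0`, and graphs enriched in
`n`-globular sets for `n + 1`. -/
def GlobSet : ℕ → Cat.{u, u + 1}
  | 0 => Cat.of (Type u)
  | n + 1 => Cat.of (EGraph (GlobSet n))

theorem globSet_hasCoproducts : ∀ n, HasCoproducts.{u} (GlobSet.{u} n)
  | 0 => inferInstanceAs (HasCoproducts.{u} (Type u))
  | n + 1 =>
    have := globSet_hasCoproducts n
    have := Multitensor.hasInitial_of_hasCoproducts (GlobSet.{u} n)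
    inferInstanceAs (HasCoproducts.{u} (EGraph (GlobSet n)))

instance (n : ℕ) : HasCoproducts.{u} (GlobSet.{u} n) := globSet_hasCoproducts n

theorem globSet_hasFiniteProducts : ∀ n, HasFiniteProducts (GlobSet.{u} n)
  | 0 => inferInstanceAs (HasFiniteProducts (Type u))
  | n + 1 =>
    have := globSet_hasFiniteProducts n
    inferInstanceAs (HasFiniteProducts (EGraph (GlobSet n)))

instance (n : ℕ) : HasFiniteProducts (GlobSet.{u} n) := globSet_hasFiniteProducts n

theorem globSet_productsDistribute : ∀ n, ProductsDistribute (GlobSet.{u} n)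
  | 0 => productsDistribute_type
  | n + 1 =>
    have := Multitensor.hasInitial_of_hasCoproducts (GlobSet.{u} n)
    EGraph.productsDistribute (globSet_productsDistribute n)

/-- The monads `𝒯_{≤ n}` on `n`-globular sets, together with the fact that they preserve
coproducts, which makes the multitensors `𝒯_{≤ n}^×` distributive. -/
def globMonadAux : ∀ n, { T : Monad (GlobSet.{u} n) // PreservesCoproducts T.toFunctor }
  | 0 => ⟨Monad.id (Type u), preservesCoproducts_id⟩
  | n + 1 =>
    ⟨Multitensor.gamma (timesMultitensor_isDistributive (globSet_productsDistribute n)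
      (globMonadAux n).1 (globMonadAux n).2), Multitensor.gamma_preservesCoproducts _⟩

/-- The monad `𝒯_{≤ n}`: `𝒯_{≤ 0}` is the identity and `𝒯_{≤ n + 1} = Γ (𝒯_{≤ n}^×)`. -/
def globMonad (n : ℕ) : Monad (GlobSet.{u} n) := (globMonadAux n).1

theorem globMonad_zero : globMonad.{u} 0 = Monad.id (Type u) := rfl

theorem globMonad_succ (n : ℕ) (h : (timesMultitensor (globMonad.{u} n)).IsDistributive) :
    globMonad.{u} (n + 1) = Multitensor.gamma h := rfl

/-! ### Strict `n`-categories -/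

/-- A bundled category with finite products. -/
structure CartCat where
  carrier : Type (u + 1)
  [cat : LargeCategory.{u} carrier]
  [cart : CartesianMonoidalCategory carrier]

attribute [instance] CartCat.cat CartCat.cart

/-- The category of strict `n`-categories and strict `n`-functors: sets for `n = 0`, and categories
enriched in strict `n`-categories, with respect to the cartesian product, for `n + 1`. -/
def StrictCat : ℕ → CartCat.{u}
  | 0 => CartCat.mk (Type u)
  | n + 1 => CartCat.mk (VCat (StrictCat n).carrier)

/-- The underlying `n`-globular set of a strict `n`-category. -/
def forgetStrict : ∀ n, (StrictCat.{u} n).carrier ⥤ GlobSet.{u} n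
  | 0 => 𝟭 (Type u)
  | n + 1 => VCat.forget (StrictCat.{u} n).carrier ⋙ EGraph.mapFunctor (forgetStrict n)

end GlobularMonads

end

open GlobularMonads

noncomputable section

namespace GlobularMonads

/-! ### Finite composable sequences -/

/-! The proof is an induction on n, and the step passes from a monad T on V to `Γ (T^×)` on graphs
enriched in V. The formula for `Γ (T^×)` is hard to handle directly, because it mixes coproducts,
products and concatenations. It is therefore replaced by a calculus of generalized elements. A chain
from a to b, with members Z ⟶ T X(x, y) for successive objects x and y, gives an element Z ⟶
Γ(T^×)X(a, b) (`el`). In these terms the unit is a one-member chain, and the multiplication applies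
the multiplication of T inside each member and then concatenates (`comp_unitHom`, `el_mulHom`).
These elements suffice to test equality of morphisms out of `Γ (T^×) X`.

Monadicity. An algebra of `Γ (T^×)` is the same as a family of T-algebras X(a, b) with an
associative and unital composition of generalized elements that is natural and compatible with T
(`HomOps`; `HomOps.exists_algebra_eq`, `HomOps.exists_isHom`). One-member chains give the T-actions,
and chains of units of T give the compositions. Let D be equivalent to the T-algebras. The forgetful
functor preserves finite products, so by the Yoneda argument such compositions are exactly
enrichments in D for the cartesian product (`vcatToAlgebra_isEquivalence`). By induction, strict
n-categories are the algebras of `globMonad n`, compatibly with the forgetful functors. The left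
adjoint, the monad isomorphism and the comparison are then transported from the Eilenberg-Moore
adjunction (`freeAdj`, `freeAdjMonadIso`, `comparison_freeAdj_isEquivalence`).

Exactness. Globular sets are presheaves on the finite category of globes (`CellFamily`,
`EGraph.cellFamily_cells`). A map from a globe into a coproduct lies in exactly one summand, so a
cell of `Γ (T^×) X` is a unique chain of cells (`el_bijective`). The property carried through the
induction is that each cell of T X factors through a generic morphism into T B, where B has finitely
many cells (`HasGenericFactorizations`). Finiteness of B makes T finitary, and universality of
generic morphisms gives the left adjoints on slices. For `Γ (T^×)` the generic object of a chain is
the wedge obtained by laying the generic objects of its members end to end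
(`gamma_hasGenericFactorizations`). Cartesianness of the unit and multiplication is a unique lifting
property of cells. For the multiplication it also rests on generic factorizations
(`existsUnique_tensor`) and on lifting decompositions of chains (`Chain.existsUnique_join`).
Preservation of coproducts is already part of the construction of the monads. -/

/-- Finite composable sequences of elements of a family `H` indexed by pairs of objects. -/
inductive Chain {O : Type u} (H : O → O → Type u) (a : O) : O → Type u
  | nil : Chain H a a
  | cons {b c : O} (P : Chain H a b) (e : H b c) : Chain H a c

namespace Chain

variable {O O' O'' : Type u} {H K L : O → O → Type u} {H' : O' → O' → Type u}
  {H'' : O'' → O'' → Type u}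

/-- The image of a chain under a map of families over a function on objects. -/
def map (f : O → O') (φ : ∀ a b, H a b → H' (f a) (f b)) {a : O} :
    ∀ {b : O}, Chain H a b → Chain H' (f a) (f b)
  | _, nil => nil
  | _, cons P e => cons (map f φ P) (φ _ _ e)

/-- The image of a chain under a map of families over the same objects. -/
def hmap (φ : ∀ {a b}, H a b → K a b) {a : O} : ∀ {b : O}, Chain H a b → Chain K a b
  | _, nil => nil
  | _, cons P e => cons (hmap φ P) (φ e)

/-- Concatenation of two chains. -/
def comp {a b : O} (P : Chain H a b) : ∀ {c : O}, Chain H b c → Chain H a c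
  | _, nil => P
  | _, cons Q e => cons (comp P Q) e

/-- The chain with a single member. -/
abbrev single {a b : O} (e : H a b) : Chain H a b := cons nil e

/-- Concatenation of a chain of chains. -/
def join {a : O} : ∀ {b : O}, Chain (Chain H) a b → Chain H a b
  | _, nil => nil
  | _, cons P Q => comp (join P) Q

/-- The number of members of a chain. -/
def length {a : O} : ∀ {b : O}, Chain H a b → ℕ
  | _, nil => 0
  | _, cons P _ => length P + 1

/-- The list of members of a chain, with their end points. -/
def toList {a : O} : ∀ {b : O}, Chain H a b → List (Σ a b, H a b)
  | _, nil => []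
  | _, cons P e => toList P ++ [⟨_, _, e⟩]

/-- Transport of chains along equalities of their end points. -/
def cast {a a' b b' : O} (h : a = a') (k : b = b') (P : Chain H a b) : Chain H a' b' :=
  h ▸ k ▸ P

@[simp] theorem cast_rfl {a b : O} (P : Chain H a b) : P.cast rfl rfl = P := rfl

@[simp] theorem toList_cast {a a' b b' : O} (h : a = a') (k : b = b') (P : Chain H a b) :
    (P.cast h k).toList = P.toList := by
  subst h k; rfl

/-- The list records both end points of every member, so it determines the chain, while its type no
longer mentions the end points. Identities between chains whose end points agree only
propositionally can thus be checked on lists, without casts. -/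
theorem toList_injective {a b : O} {P Q : Chain H a b} (h : P.toList = Q.toList) : P = Q := by
  induction P with
  | nil =>
    cases Q with
    | nil => rfl
    | cons Q e => simp [toList] at h
  | cons P e ih =>
    cases Q with
    | nil => simp [toList] at h
    | cons Q e' =>
      obtain ⟨h₁, h₂⟩ := List.append_inj' h rfl
      cases h₂
      rw [ih h₁]

theorem toList_map (f : O → O') (φ : ∀ a b, H a b → H' (f a) (f b)) {a b : O} (P : Chain H a b) :
    (P.map f φ).toList = P.toList.map fun e => ⟨f e.1, f e.2.1, φ _ _ e.2.2⟩ := by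
  induction P with
  | nil => rfl
  | cons P e ih => simp [map, toList, ih]

theorem toList_hmap (φ : ∀ {a b}, H a b → K a b) {a b : O} (P : Chain H a b) :
    (P.hmap φ).toList = P.toList.map fun e => ⟨e.1, e.2.1, φ e.2.2⟩ := by
  induction P with
  | nil => rfl
  | cons P e ih => simp [hmap, toList, ih]

theorem toList_comp {a b c : O} (P : Chain H a b) (Q : Chain H b c) :
    (P.comp Q).toList = P.toList ++ Q.toList := by
  induction Q with
  | nil => simp [comp, toList]
  | cons Q e ih => simp [comp, toList, ih]

theorem toList_join {a b : O} (P : Chain (Chain H) a b) :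
    P.join.toList = (P.toList.map fun e => e.2.2.toList).flatten := by
  induction P with
  | nil => rfl
  | cons P e ih => simp [join, toList, toList_comp, ih]

theorem hmap_hmap (φ : ∀ {a b}, H a b → K a b) (ψ : ∀ {a b}, K a b → L a b) {a b : O}
    (P : Chain H a b) : (P.hmap φ).hmap ψ = P.hmap fun e => ψ (φ e) := by
  induction P with
  | nil => rfl
  | cons P e ih => simp [hmap, ih]

theorem hmap_congr {φ ψ : ∀ {a b}, H a b → K a b} (h : ∀ a b (e : H a b), φ e = ψ e) {a b : O}
    (P : Chain H a b) : P.hmap φ = P.hmap ψ := by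
  induction P with
  | nil => rfl
  | cons P e ih => simp [hmap, ih, h]

theorem hmap_id {φ : ∀ {a b}, H a b → H a b} (h : ∀ a b (e : H a b), φ e = e) {a b : O}
    (P : Chain H a b) : P.hmap φ = P := by
  induction P with
  | nil => rfl
  | cons P e ih => simp [hmap, ih, h]

theorem hmap_comp (φ : ∀ {a b}, H a b → K a b) {a b c : O} (P : Chain H a b) (Q : Chain H b c) :
    (P.comp Q).hmap φ = (P.hmap φ).comp (Q.hmap φ) := by
  induction Q with
  | nil => rfl
  | cons Q e ih => simp [hmap, comp, ih]

theorem hmap_join (φ : ∀ {a b}, H a b → K a b) {a b : O} (P : Chain (Chain H) a b) :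
    P.join.hmap φ = (P.hmap fun Q => Q.hmap φ).join := by
  induction P with
  | nil => rfl
  | cons P e ih => simp [hmap, join, hmap_comp, ih]

theorem map_hmap (f : O → O') (φ : ∀ {a b}, H a b → K a b) (ψ : ∀ a b, K a b → H' (f a) (f b))
    {a b : O} (P : Chain H a b) :
    (P.hmap φ).map f ψ = P.map f fun _ _ e => ψ _ _ (φ e) := by
  induction P with
  | nil => rfl
  | cons P e ih => simp [hmap, map, ih]

theorem hmap_map {K' : O' → O' → Type u} (f : O → O') (φ : ∀ a b, H a b → H' (f a) (f b))
    (ψ : ∀ {a b}, H' a b → K' a b) {a b : O} (P : Chain H a b) :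
    (P.map f φ).hmap ψ = P.map f fun _ _ e => ψ (φ _ _ e) := by
  induction P with
  | nil => rfl
  | cons P e ih => simp [hmap, map, ih]

theorem map_congr (f : O → O') {φ ψ : ∀ a b, H a b → H' (f a) (f b)}
    (h : ∀ a b (e : H a b), φ _ _ e = ψ _ _ e) {a b : O} (P : Chain H a b) :
    P.map f φ = P.map f ψ := by
  induction P with
  | nil => rfl
  | cons P e ih => simp [map, ih, h]

theorem length_map (f : O → O') (φ : ∀ a b, H a b → H' (f a) (f b)) {a b : O} (P : Chain H a b) :
    (P.map f φ).length = P.length := by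
  induction P with
  | nil => rfl
  | cons P e ih => simp [length, map, ih]

@[simp] theorem nil_comp {a b : O} (P : Chain H a b) : (nil : Chain H a a).comp P = P := by
  induction P with
  | nil => rfl
  | cons P e ih => simp [comp, ih]

/-! #### Comparison with sequences of objects -/

/-- The chain of a finite sequence. -/
def ofSeq : ∀ (n : ℕ) (x : Fin (n + 1) → O) (_ : ∀ i : Fin n, H (x i.castSucc) (x i.succ)),
    Chain H (x 0) (x (Fin.last n))
  | 0, _, _ => nil
  | n + 1, x, t => cons (ofSeq n (fun i => x i.castSucc) fun i => t i.castSucc) (t (Fin.last n))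

theorem toList_ofSeq (n : ℕ) (x : Fin (n + 1) → O) (t : ∀ i : Fin n, H (x i.castSucc) (x i.succ)) :
    (ofSeq n x t).toList = List.ofFn fun i => ⟨_, _, t i⟩ := by
  induction n with
  | zero => rfl
  | succ n ih =>
    rw [List.ofFn_succ', List.concat_eq_append]
    exact congrArg (· ++ _) (ih _ _)

/-- The chain of a sequence of elements of `H` along a sequence of objects. -/
def ofPath {a b : O} (p : EPath a b) (t : ∀ i : Fin p.len, H (p.vert i.castSucc) (p.vert i.succ)) :
    Chain H a b :=
  (ofSeq p.len p.vert t).cast p.vert_zero p.vert_last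

theorem toList_ofPath {a b : O} (p : EPath a b)
    (t : ∀ i : Fin p.len, H (p.vert i.castSucc) (p.vert i.succ)) :
    (ofPath p t).toList = List.ofFn fun i => ⟨_, _, t i⟩ := by
  rw [ofPath, toList_cast, toList_ofSeq]

variable (H) in
/-- A sequence of elements of `H` along a sequence of objects. -/
abbrev Along (a b : O) : Type u :=
  Σ p : EPath a b, ∀ i : Fin p.len, H (p.vert i.castSucc) (p.vert i.succ)

/-- The list of members gives back the length, the members and the target of every member; together
with the fixed initial vertex, the targets determine all vertices. -/
theorem ofPath_injective {a b : O} :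
    Function.Injective (fun s : Along H a b => ofPath s.1 s.2) := by
  rintro ⟨⟨n, x, x₀, x₁⟩, t⟩ ⟨⟨n', x', x₀', x₁'⟩, t'⟩ h
  have h' := congrArg toList h
  simp only [toList_ofPath] at h'
  obtain ⟨rfl, h₁⟩ := Sigma.mk.inj_iff.1 (List.ofFn_inj'.1 h')
  have h₂ := fun i => congrFun (eq_of_heq h₁) i
  obtain rfl : x = x' := by
    funext i
    induction i using Fin.cases with
    | zero => exact x₀.trans x₀'.symm
    | succ i => exact congrArg (fun s : Σ a b, H a b => s.2.1) (h₂ i)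
  obtain rfl : t = t' := by
    funext i
    simpa using h₂ i
  rfl

theorem exists_ofSeq {a b : O} (P : Chain H a b) : ∃ (n : ℕ) (x : Fin (n + 1) → O)
    (t : ∀ i : Fin n, H (x i.castSucc) (x i.succ)) (h₀ : x 0 = a) (h₁ : x (Fin.last n) = b),
    P = (ofSeq n x t).cast h₀ h₁ := by
  induction P with
  | nil => exact ⟨0, fun _ => a, fun i => i.elim0, rfl, rfl, rfl⟩
  | @cons b c P e ih =>
    obtain ⟨n, x, t, rfl, rfl, rfl⟩ := ih
    -- The old vertices and the new target are put into one sequence `y`, so that after substitution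
    -- the old vertices are `y ∘ castSucc` and nothing has to be transported.
    obtain ⟨y, rfl, rfl⟩ : ∃ y : Fin (n + 2) → O, x = (fun i => y i.castSucc) ∧
        y (Fin.last (n + 1)) = c :=
      ⟨Fin.lastCases c x, funext fun i => by simp, by simp⟩
    refine ⟨n + 1, y, Fin.lastCases e t, rfl, rfl, ?_⟩
    let s : ∀ i : Fin (n + 1), H (y i.castSucc) (y i.succ) := Fin.lastCases e t
    have h₁ : t = fun i : Fin n => s i.castSucc :=
      funext fun i => (Fin.lastCases_castSucc (motive := fun i => H (y i.castSucc) (y i.succ)) ..).symm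
    have h₂ : e = s (Fin.last n) :=
      (Fin.lastCases_last (motive := fun i => H (y i.castSucc) (y i.succ)) ..).symm
    exact congrArg₂ (fun t e => cons (ofSeq n (fun i => y i.castSucc) t) e) h₁ h₂

theorem ofPath_surjective {a b : O} :
    Function.Surjective (fun s : Along H a b => ofPath s.1 s.2) := by
  intro P
  obtain ⟨n, x, t, h₀, h₁, h⟩ := exists_ofSeq P
  exact ⟨⟨⟨n, x, h₀, h₁⟩, t⟩, h.symm⟩

/-- Chains are sequences of elements along sequences of objects. -/
def alongEquiv (a b : O) : Along H a b ≃ Chain H a b :=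
  Equiv.ofBijective _ ⟨ofPath_injective, ofPath_surjective⟩

theorem alongEquiv_symm_ofPath {a b : O} (p : EPath a b)
    (t : ∀ i : Fin p.len, H (p.vert i.castSucc) (p.vert i.succ)) :
    (alongEquiv a b).symm (ofPath p t) = ⟨p, t⟩ :=
  (alongEquiv a b).symm_apply_apply ⟨p, t⟩

theorem map_ofPath (f : O → O') (φ : ∀ a b, H a b → H' (f a) (f b)) {a b : O} (p : EPath a b)
    (t : ∀ i : Fin p.len, H (p.vert i.castSucc) (p.vert i.succ)) :
    (ofPath p t).map f φ = ofPath (p.map f) fun i => φ _ _ (t i) := by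
  apply toList_injective
  rw [toList_map, toList_ofPath, toList_ofPath, List.map_ofFn]
  rfl

theorem hmap_ofPath (φ : ∀ {a b}, H a b → K a b) {a b : O} (p : EPath a b)
    (t : ∀ i : Fin p.len, H (p.vert i.castSucc) (p.vert i.succ)) :
    (ofPath p t).hmap φ = ofPath p fun i => φ (t i) := by
  apply toList_injective
  rw [toList_hmap, toList_ofPath, toList_ofPath, List.map_ofFn]
  rfl

end Chain

/-- The positions in order and the positions read block by block are two strictly increasing lists
with the same members, hence equal. -/
theorem Juxt.ofFn_eq_flatten {k : ℕ} {n : Fin k → ℕ} {N : ℕ} (e : Juxt n N) {α : Type*}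
    (w : Fin N → α) :
    List.ofFn w = (List.ofFn fun i => List.ofFn fun j => w (e.idx i j)).flatten := by
  have h : List.finRange N =
      (List.finRange k).flatMap fun i => (List.finRange (n i)).map (e.idx i) := by
    have hp : ((List.finRange k).flatMap fun i => (List.finRange (n i)).map (e.idx i)).Pairwise
        (· < ·) := by
      rw [List.pairwise_flatMap]
      refine ⟨fun i _ => ?_, ?_⟩
      · rw [List.pairwise_map]
        exact (List.pairwise_lt_finRange _).imp fun h => e.strictMono i h
      · refine (List.pairwise_lt_finRange _).imp fun {i i'} h x hx y hy => ?_
        obtain ⟨j, _, rfl⟩ := List.mem_map.1 hx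
        obtain ⟨j', _, rfl⟩ := List.mem_map.1 hy
        exact e.lt_of_lt _ _ h
    refine List.Perm.eq_of_pairwise' (r := (· < ·)) (List.pairwise_lt_finRange _) hp
      ((List.perm_ext_iff_of_nodup (List.nodup_finRange _) (hp.imp fun h => ne_of_lt h)).2
        fun t => ?_)
    obtain ⟨i, j, rfl⟩ := e.surj t
    simp only [List.mem_finRange, List.mem_flatMap, List.mem_map, true_and, true_iff]
    exact ⟨i, j, rfl⟩
  rw [List.ofFn_eq_map, h, List.map_flatMap, List.flatMap_def, List.ofFn_eq_map]
  congr 2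
  funext i
  rw [List.ofFn_eq_map, List.map_map]
  rfl

namespace Chain

variable {O : Type u} {H : O → O → Type u}

/-- This connects the concatenations used to define the multiplication of `Γ E` with the recursive
`Chain.join`: both have the same list of members. The hypothesis compares members together with
their end points because the vertices agree only propositionally. -/
theorem ofPath_concat {a b : O} {q : EPath a b}
    {p : ∀ i : Fin q.len, EPath (q.vert i.castSucc) (q.vert i.succ)} (c : Concat q p)
    (u : ∀ l : Fin c.path.len, H (c.path.vert l.castSucc) (c.path.vert l.succ))
    (v : ∀ i (j : Fin (p i).len), H ((p i).vert j.castSucc) ((p i).vert j.succ))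
    (h : ∀ i j, (⟨_, _, v i j⟩ : Σ a b, H a b) = ⟨_, _, u (c.e.idx i j)⟩) :
    ofPath c.path u = (ofPath q fun i => ofPath (p i) (v i)).join := by
  apply toList_injective
  rw [toList_ofPath, toList_join, toList_ofPath, c.e.ofFn_eq_flatten, List.map_ofFn]
  congr 2
  funext i
  simp only [Function.comp, toList_ofPath, h]

end Chain

/-! ### Generalized elements of `Γ (T^×) X` -/

section Elements

variable {V : Type (u + 1)} [LargeCategory.{u} V] [HasFiniteProducts V] {T : Monad V}

/-- The tuple of a family of generalized elements. -/
def tensorLift {n : ℕ} {W : Fin n → V} {Z : V} (t : ∀ i, Z ⟶ T.obj (W i)) :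
    Z ⟶ ((timesMultitensor T).tensor n).obj W :=
  Pi.lift t

variable (T) in
/-- The projections of `T^×`. -/
def tensorProj {n : ℕ} (W : Fin n → V) (i : Fin n) :
    ((timesMultitensor T).tensor n).obj W ⟶ T.obj (W i) :=
  Pi.π (fun i => T.obj (W i)) i

@[simp]
theorem tensorLift_proj {n : ℕ} {W : Fin n → V} {Z : V} (t : ∀ i, Z ⟶ T.obj (W i)) (i : Fin n) :
    tensorLift t ≫ tensorProj T W i = t i :=
  Limits.Pi.lift_π _ _

@[simp]
theorem tensorLift_proj_assoc {n : ℕ} {W : Fin n → V} {Z A : V} (t : ∀ i, Z ⟶ T.obj (W i))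
    (i : Fin n) (h : T.obj (W i) ⟶ A) : tensorLift t ≫ tensorProj T W i ≫ h = t i ≫ h := by
  rw [← Category.assoc, tensorLift_proj]

theorem tensor_hom_ext {n : ℕ} {W : Fin n → V} {Z : V}
    {f g : Z ⟶ ((timesMultitensor T).tensor n).obj W}
    (h : ∀ i, f ≫ tensorProj T W i = g ≫ tensorProj T W i) : f = g :=
  Limits.Pi.hom_ext _ _ h

theorem tensorLift_injective {n : ℕ} {W : Fin n → V} {Z : V} :
    Function.Injective (tensorLift : (∀ i, Z ⟶ T.obj (W i)) → _) := fun t t' h =>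
  funext fun i => by rw [← tensorLift_proj t i, h, tensorLift_proj]

theorem tensorLift_surjective {n : ℕ} {W : Fin n → V} {Z : V} :
    Function.Surjective (tensorLift : (∀ i, Z ⟶ T.obj (W i)) → _) := fun f =>
  ⟨fun i => f ≫ tensorProj T W i, tensor_hom_ext fun i => by simp⟩

theorem tensorLift_tensorProj {n : ℕ} (W : Fin n → V) :
    tensorLift (tensorProj T W) = 𝟙 _ :=
  tensor_hom_ext fun i => by simp

theorem comp_tensorLift {n : ℕ} {W : Fin n → V} {Z Z' : V} (z : Z' ⟶ Z)
    (t : ∀ i, Z ⟶ T.obj (W i)) : z ≫ tensorLift t = tensorLift fun i => z ≫ t i :=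
  tensor_hom_ext fun i => by simp

theorem comp_tensorLift_assoc {n : ℕ} {W : Fin n → V} {Z Z' A : V} (z : Z' ⟶ Z)
    (t : ∀ i, Z ⟶ T.obj (W i)) (h : ((timesMultitensor T).tensor n).obj W ⟶ A) :
    z ≫ tensorLift t ≫ h = tensorLift (fun i => z ≫ t i) ≫ h := by
  rw [← Category.assoc, comp_tensorLift]

theorem tensor_map_proj {n : ℕ} {W W' : Fin n → V} (f : ∀ i, W i ⟶ W' i) (i : Fin n) :
    ((timesMultitensor T).tensor n).map f ≫ tensorProj T W' i = tensorProj T W i ≫ T.map (f i) :=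
  Limits.Pi.map_π (fun i => T.map (f i)) i

theorem tensorLift_map {n : ℕ} {W W' : Fin n → V} {Z : V} (t : ∀ i, Z ⟶ T.obj (W i))
    (f : ∀ i, W i ⟶ W' i) :
    tensorLift t ≫ ((timesMultitensor T).tensor n).map f = tensorLift fun i => t i ≫ T.map (f i) :=
  tensor_hom_ext fun i => by
    rw [Category.assoc, tensor_map_proj, tensorLift_proj_assoc, tensorLift_proj]

theorem tensorLift_map_assoc {n : ℕ} {W W' : Fin n → V} {Z A : V} (t : ∀ i, Z ⟶ T.obj (W i))
    (f : ∀ i, W i ⟶ W' i) (h : ((timesMultitensor T).tensor n).obj W' ⟶ A) :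
    tensorLift t ≫ ((timesMultitensor T).tensor n).map f ≫ h =
      tensorLift (fun i => t i ≫ T.map (f i)) ≫ h := by
  rw [← Category.assoc, tensorLift_map]

theorem tensor_subst_proj {k : ℕ} {n : Fin k → ℕ} {N : ℕ} (e : Juxt n N) (W : Fin N → V)
    (i : Fin k) (j : Fin (n i)) :
    (timesMultitensor T).subst e W ≫ tensorProj T W (e.idx i j) =
      tensorProj T (fun i => ((timesMultitensor T).tensor (n i)).obj fun j => W (e.idx i j)) i ≫
        T.map (tensorProj T (fun j => W (e.idx i j)) j) ≫ T.μ.app _ :=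
  timesSubst_π T e W i j

variable [HasCoproducts.{u} V]

variable (T) in
/-- The generalized elements of `T` of the homs of an enriched graph. -/
abbrev THom (X : EGraph V) (Z : V) (a b : X.Obj) : Type u := Z ⟶ T.obj (X.hom a b)

variable (T) in
/-- The enriched graph `Γ (T^×) X`. -/
abbrev timesGamma (X : EGraph V) : EGraph V := (timesMultitensor T).gammaObj X

/-- The generalized element of `Γ (T^×) X` given by a chain of generalized elements. -/
def el {X : EGraph V} {Z : V} {a b : X.Obj} (P : Chain (THom T X Z) a b) :
    Z ⟶ (timesMultitensor T).gammaHom X a b :=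
  tensorLift ((Chain.alongEquiv a b).symm P).2 ≫
    Multitensor.inc X ((Chain.alongEquiv a b).symm P).1

theorem el_ofPath {X : EGraph V} {Z : V} {a b : X.Obj} (p : EPath a b)
    (t : ∀ i : Fin p.len, THom T X Z (p.vert i.castSucc) (p.vert i.succ)) :
    el (Chain.ofPath p t) = tensorLift t ≫ Multitensor.inc X p := by
  unfold el
  rw [Chain.alongEquiv_symm_ofPath]

theorem comp_el {X : EGraph V} {Z Z' : V} (z : Z' ⟶ Z) {a b : X.Obj}
    (P : Chain (THom T X Z) a b) :
    z ≫ el P = el (T := T) (X := X) (P.hmap (K := THom T X Z') fun {_ _} t => z ≫ t) := by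
  obtain ⟨⟨p, t⟩, rfl⟩ := Chain.ofPath_surjective P
  dsimp only
  rw [Chain.hmap_ofPath, el_ofPath, el_ofPath, comp_tensorLift_assoc]

theorem el_mapHom {X Y : EGraph V} (f : X ⟶ Y) {Z : V} {a b : X.Obj}
    (P : Chain (THom T X Z) a b) :
    el P ≫ Multitensor.gammaMapHom f a b =
      el (P.map (H' := THom T Y Z) f.obj fun a b t => t ≫ T.map (f.map a b)) := by
  obtain ⟨⟨p, t⟩, rfl⟩ := Chain.ofPath_surjective P
  dsimp only
  rw [Chain.map_ofPath, el_ofPath, el_ofPath, Category.assoc, Multitensor.inc_mapHom]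
  exact tensorLift_map_assoc _ _ _

theorem comp_unitHom {X : EGraph V} {Z : V} {a b : X.Obj} (x : Z ⟶ X.hom a b) :
    x ≫ (timesMultitensor T).gammaUnitHom X a b =
      el (Chain.single (H := THom T X Z) (x ≫ T.η.app (X.hom a b))) := by
  have h : Chain.single (H := THom T X Z) (x ≫ T.η.app (X.hom a b)) =
      Chain.ofPath (H := THom T X Z) (EPath.edge a b) fun i => x ≫ T.η.app _ ≫
        T.map (X.cast (EPath.edge_src a b i) (EPath.edge_tgt a b i)) := by
    apply Chain.toList_injective
    rw [Chain.toList_ofPath]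
    have : x ≫ T.η.app _ ≫
      T.map (X.cast (EPath.edge_src a b 0) (EPath.edge_tgt a b 0)) = x ≫ T.η.app (X.hom a b) := by
      -- At position 0 the vertices of `EPath.edge a b` reduce to `a` and `b`, so the cast is an
      -- identity.
      erw [EGraph.cast_rfl]
      simp
    exact congrArg (fun t : THom T X Z a b => [(⟨a, b, t⟩ : Σ a b, THom T X Z a b)]) this.symm
  rw [h, el_ofPath, Multitensor.gammaUnitHom]
  have h₂ : x ≫ (timesMultitensor T).unit (X.hom a b) =
      tensorLift fun _ => x ≫ T.η.app (X.hom a b) := comp_tensorLift x _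
  rw [← Category.assoc, h₂]
  refine (tensorLift_map_assoc _ _ _).trans ?_
  simp only [Category.assoc]

/-- Each summand serves as its own stage of definition: the projections form a chain over it, whose
element is the inclusion of that summand, and the inclusions are jointly epic. -/
theorem gammaHom_ext_el {X : EGraph V} {a b : X.Obj} {A : V}
    {f g : (timesMultitensor T).gammaHom X a b ⟶ A}
    (h : ∀ (Z : V) (P : Chain (THom T X Z) a b), el P ≫ f = el P ≫ g) : f = g := by
  refine Multitensor.gammaHom_ext fun p => ?_
  have := h _ (Chain.ofPath p (tensorProj T (p.homs X)))
  rw [el_ofPath, tensorLift_tensorProj] at this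
  simpa using this

/-! #### The multiplication -/

variable (T) in
/-- Generalized elements of the summands of `T (Γ (T^×) X)`. -/
abbrev Nested (X : EGraph V) (Z : V) (a b : X.Obj) : Type u :=
  Σ p : EPath a b, (Z ⟶ T.obj (((timesMultitensor T).tensor p.len).obj (p.homs X)))

/-- The inclusions of the summands of `T (Γ (T^×) X)`. -/
def Nested.incl {X : EGraph V} {Z : V} {a b : X.Obj} (s : Nested T X Z a b) :
    THom T (timesGamma T X) Z a b :=
  s.2 ≫ T.map (Multitensor.inc X s.1)

/-- The chain obtained from an element of a summand of `T (Γ (T^×) X)` by means of the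
multiplication of `T`. -/
def Nested.parse {X : EGraph V} {Z : V} {a b : X.Obj} (s : Nested T X Z a b) :
    Chain (THom T X Z) a b :=
  Chain.ofPath s.1 fun j => s.2 ≫ T.map (tensorProj T (s.1.homs X) j) ≫ T.μ.app _

variable (hE : (timesMultitensor T).IsDistributive)

theorem Sigma.eq_comp_cast (X : EGraph V) (Z : V) {a b a' b' : X.Obj} (h : a = a') (k : b = b')
    (t : THom T X Z a b) : (⟨a, b, t⟩ : Σ a b, THom T X Z a b) =
      ⟨a', b', t ≫ T.map (X.cast h k)⟩ := by
  subst h k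
  simp

/-- This is the multiplication in terms of chains. It involves no choice of a `Concat`, so arguments
about the multiplication become recursions on chains. -/
theorem el_mulHom {X : EGraph V} {Z : V} {a b : X.Obj} (P : Chain (Nested T X Z) a b) :
    el (P.hmap (K := THom T (timesGamma T X) Z) Nested.incl) ≫ Multitensor.gammaMulHom hE X a b =
      el (P.hmap (K := Chain (THom T X Z)) Nested.parse).join := by
  obtain ⟨⟨q, s⟩, rfl⟩ := Chain.ofPath_surjective P
  dsimp only
  rw [Chain.hmap_ofPath, Chain.hmap_ofPath, el_ofPath]
  have h₁ : tensorLift (fun i => (s i).incl) ≫ Multitensor.inc (timesGamma T X) q =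
      tensorLift (T := T) (fun i => (s i).2) ≫ Multitensor.inc₂ X q (fun i => (s i).1) := by
    unfold Multitensor.inc₂
    exact (tensorLift_map_assoc (T := T) _ _ _).symm
  let c : Concat q (fun i => (s i).1) := Classical.arbitrary _
  -- A map into the summand of the concatenation is a tuple. Its components `u` are afterwards
  -- identified one position at a time by `tensor_subst_proj`.
  obtain ⟨u, hu⟩ := tensorLift_surjective (tensorLift (T := T) (fun i => (s i).2) ≫
    ((timesMultitensor T).tensor q.len).map (fun i =>
      ((timesMultitensor T).tensor (s i).1.len).map fun j => X.cast (c.src i j) (c.tgt i j)) ≫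
        (timesMultitensor T).subst c.e (c.path.homs X))
  refine (congrArg (· ≫ _) h₁).trans ?_
  rw [Category.assoc, Multitensor.inc₂_mul hE X c, Multitensor.mulOf]
  simp only [← Category.assoc] at hu ⊢
  rw [← hu, ← el_ofPath]
  congr 1
  refine Chain.ofPath_concat (H := THom T X Z) c u _ fun i j => ?_
  refine (Sigma.eq_comp_cast X Z (c.src i j) (c.tgt i j) _).trans ?_
  congr 2
  have h₂ := congrArg (· ≫ tensorProj T (c.path.homs X) (c.e.idx i j)) hu
  simp only [tensorLift_proj, Category.assoc, tensor_subst_proj] at h₂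
  refine Eq.trans ?_ h₂.symm
  rw [tensorLift_map_assoc, tensorLift_proj_assoc]
  simp only [Category.assoc, ← T.map_comp_assoc]
  rw [tensor_map_proj]
  have h₃ := T.μ.naturality (X.cast (c.src i j) (c.tgt i j))
  simp only [Functor.comp_map] at h₃
  simp only [T.map_comp_assoc, h₃]

/-- The universal elements suffice again: over the summand at `(q, p)` the projections form a chain
of `Nested` elements, whose element is the inclusion `inc₂ X q p`. -/
theorem gamma₂_ext_el {X : EGraph V} {a b : X.Obj} {A : V}
    {f g : (timesMultitensor T).gammaHom (timesGamma T X) a b ⟶ A}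
    (hE : (timesMultitensor T).IsDistributive)
    (h : ∀ (Z : V) (P : Chain (Nested T X Z) a b),
      el (P.hmap (K := THom T (timesGamma T X) Z) Nested.incl) ≫ f =
        el (P.hmap (K := THom T (timesGamma T X) Z) Nested.incl) ≫ g) : f = g := by
  refine Multitensor.gamma₂_ext hE fun q p => ?_
  have := h _ (Chain.ofPath q fun i => ⟨p i, tensorProj T
    (fun i => ((timesMultitensor T).tensor (p i).len).obj ((p i).homs X)) i⟩)
  rw [Chain.hmap_ofPath, el_ofPath] at this
  have h₁ : tensorLift (fun i => Nested.incl (T := T) (X := X) ⟨p i, tensorProj T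
      (fun i => ((timesMultitensor T).tensor (p i).len).obj ((p i).homs X)) i⟩) ≫
        Multitensor.inc (timesGamma T X) q = Multitensor.inc₂ X q p := by
    unfold Multitensor.inc₂
    refine (tensorLift_map_assoc (T := T) (tensorProj T
      (fun i => ((timesMultitensor T).tensor (p i).len).obj ((p i).homs X))) _ _).symm.trans ?_
    rw [tensorLift_tensorProj, Category.id_comp]
  rw [← h₁]
  exact this

end Elements

/-! ### Presheaf-like categories -/

section Cells

open Opposite

variable {V : Type (u + 1)} [LargeCategory.{u} V]

/-- The restricted Yoneda functor of a family of objects. -/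
def cellNerve {ι : Type u} (G : ι → V) : V ⥤ (InducedCategory V G)ᵒᵖ ⥤ Type u :=
  yoneda ⋙ (Functor.whiskeringLeft _ _ _).obj (inducedFunctor G).op

/-- A finite family of objects, with finite sets of morphisms, which exhibits `V` as a category of
presheaves. -/
structure CellFamily {ι : Type u} (G : ι → V) : Prop where
  finite_index : Finite ι
  isEquivalence : (cellNerve G).IsEquivalence
  finite_hom : ∀ i j, Finite (G i ⟶ G j)

/-- A morphism from a member of the family as an object of the comma category. -/
abbrev cellOver {ι : Type u} (G : ι → V) {A : V} (i : ι) (x : G i ⟶ A) :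
    CostructuredArrow (inducedFunctor G) A :=
  CostructuredArrow.mk (S := inducedFunctor G) (Y := (show InducedCategory V G from i)) x

/-- The canonical cocone on the morphisms from members of the family to `A`. -/
def cellCocone {ι : Type u} (G : ι → V) (A : V) :
    Cocone (CostructuredArrow.proj (inducedFunctor G) A ⋙ inducedFunctor G) where
  pt := A
  ι :=
    { app := fun x => x.hom
      naturality := fun _ _ k => (CostructuredArrow.w k).trans (Category.comp_id _).symm }

namespace CellFamily

variable {ι : Type u} {G : ι → V} (hG : CellFamily G)
include hG

/-- Faithfulness of the nerve here, and its fullness in `exists_hom`, allow morphisms to be compared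
and constructed cell by cell. -/
theorem hom_ext {X Y : V} {f g : X ⟶ Y} (h : ∀ i (x : G i ⟶ X), x ≫ f = x ≫ g) : f = g := by
  have := hG.isEquivalence
  apply (cellNerve G).map_injective
  ext i x
  exact h _ x

theorem exists_hom {X Y : V} (φ : ∀ i, (G i ⟶ X) → (G i ⟶ Y))
    (h : ∀ i j (z : G i ⟶ G j) (x : G j ⟶ X), φ i (z ≫ x) = z ≫ φ j x) :
    ∃ f : X ⟶ Y, ∀ i x, x ≫ f = φ i x := by
  have := hG.isEquivalence
  let ψ : (cellNerve G).obj X ⟶ (cellNerve G).obj Y :=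
    { app := fun i => TypeCat.ofHom fun x => φ i.unop x
      naturality := fun i j z => by
        ext x
        exact h _ _ z.unop.hom x }
  obtain ⟨f, hf⟩ := (cellNerve G).map_surjective ψ
  exact ⟨f, fun i x => congrFun (congrArg (fun α => (α.app (op i)).hom) hf) x⟩

theorem hasColimitsOfSize : HasColimitsOfSize.{u, u} V :=
  have := hG.isEquivalence
  Adjunction.has_colimits_of_equivalence (cellNerve G)

/-- Along the nerve, homs out of a cell become evaluation at that cell, and evaluation preserves
colimits. This underlies both the choice of a single summand by a cell of a coproduct and the finite
presentability of cells. -/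
theorem preservesColimitsOfSize (i : ι) : PreservesColimitsOfSize.{u, u} (coyoneda.obj (op (G i))) := by
  have := hG.isEquivalence
  have e : cellNerve G ⋙ (evaluation _ _).obj (op i) ≅ coyoneda.obj (op (G i)) :=
    NatIso.ofComponents (fun X => Iso.refl _)
  exact preservesColimits_of_natIso e

/-- Morphisms from the members of the family into a coproduct. -/
theorem bijective_cofan (i : ι) {K : Type u} {Z : K → V} (c : Cofan Z)
    (hc : Nonempty (IsColimit c)) :
    Function.Bijective (fun x : Σ k, (G i ⟶ Z k) => x.2 ≫ c.inj x.1) := by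
  have := hG.preservesColimitsOfSize i
  exact (nonempty_isColimit_type_iff _).1
    ⟨isColimitCofanMkObjOfIsColimit (coyoneda.obj (op (G i))) Z c.inj
      (hc.some.ofIsoColimit (Cofan.ext (Iso.refl _)))⟩

/-- An initial object is the coproduct of the empty family, and a cell of a coproduct has to choose
a summand. -/
theorem isEmpty_of_isInitial (i : ι) {A : V} (hA : IsInitial A) : IsEmpty (G i ⟶ A) := by
  refine ⟨fun x => ?_⟩
  obtain ⟨⟨k, _⟩, _⟩ := (hG.bijective_cofan i (K := PEmpty) (Z := PEmpty.elim)
    (Cofan.mk A fun k => k.elim) ⟨Cofan.IsColimit.mk _ (fun s => hA.to _) (fun s k => k.elim)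
      fun s m _ => hA.hom_ext _ _⟩).2 x
  exact k.elim

/-- The lifts of cells define the mediating morphism on the cells of a cone. Their uniqueness makes
them compatible with morphisms of cells, so that `exists_hom` can assemble them. -/
theorem isPullback {P X Y Z : V} {fst : P ⟶ X} {snd : P ⟶ Y} {f : X ⟶ Z} {g : Y ⟶ Z}
    (w : fst ≫ f = snd ≫ g)
    (h : ∀ i (x : G i ⟶ X) (y : G i ⟶ Y), x ≫ f = y ≫ g → ∃! z : G i ⟶ P, z ≫ fst = x ∧ z ≫ snd = y) :
    IsPullback fst snd f g := by
  have hex : ∀ s : PullbackCone f g, ∃ l : s.pt ⟶ P, l ≫ fst = s.fst ∧ l ≫ snd = s.snd := by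
    intro s
    have hs : ∀ i (x : G i ⟶ s.pt), (x ≫ s.fst) ≫ f = (x ≫ s.snd) ≫ g := fun i x => by
      simp [s.condition]
    choose φ hφ using fun i x => (h i _ _ (hs i x)).exists
    obtain ⟨l, hl⟩ := hG.exists_hom φ fun i j z x => (h i _ _ (hs i (z ≫ x))).unique
      (hφ i (z ≫ x)) (by simp [hφ])
    exact ⟨l, hG.hom_ext fun i x => by rw [← Category.assoc, hl, (hφ i x).1],
      hG.hom_ext fun i x => by rw [← Category.assoc, hl, (hφ i x).2]⟩
  choose l hl using hex
  refine ⟨⟨w⟩, ⟨PullbackCone.IsLimit.mk _ l (fun s => (hl s).1) (fun s => (hl s).2) ?_⟩⟩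
  intro s m h₁ h₂
  refine hG.hom_ext fun i x => ?_
  have hs : (x ≫ s.fst) ≫ f = (x ≫ s.snd) ≫ g := by simp [s.condition]
  exact (h i _ _ hs).unique (by simp [h₁, h₂]) (by simp [hl])

/-- Every object is the canonical colimit of members of the family. -/
theorem nonempty_isColimit (A : V) : Nonempty (IsColimit (cellCocone G A)) := by
  have hex : ∀ s : Cocone (CostructuredArrow.proj (inducedFunctor G) A ⋙ inducedFunctor G),
      ∃ f : A ⟶ s.pt, ∀ (i : ι) (x : G i ⟶ A), x ≫ f = s.ι.app (cellOver G i x) :=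
    fun s => hG.exists_hom (fun i x => s.ι.app (cellOver G i x)) fun i j z x =>
      (s.w (CostructuredArrow.homMk (InducedCategory.homMk z) rfl :
        cellOver G i (z ≫ x) ⟶ cellOver G j x)).symm
  choose f hf using hex
  exact ⟨{ desc := f
           fac := fun s j => hf s j.left j.hom
           uniq := fun s m hm => hG.hom_ext fun i x => (hm (cellOver G i x)).trans (hf s i x).symm }⟩

/-- Objects with finitely many cells are finitely presentable. -/
theorem isFinitelyPresentable (B : V) (hB : ∀ i, Finite (G i ⟶ B)) :
    IsFinitelyPresentable.{u} B := by
  obtain ⟨hc⟩ := hG.nonempty_isColimit B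
  have := hG.finite_index
  have : Fact (Cardinal.aleph0.{u}).IsRegular := Cardinal.fact_isRegular_aleph0
  have hi : ∀ i, IsFinitelyPresentable.{u} (G i) := fun i => by
    rw [isFinitelyPresentable_iff_preservesFilteredColimitsOfSize]
    have := hG.preservesColimitsOfSize i
    infer_instance
  have : ∀ k, IsCardinalPresentable ((CostructuredArrow.proj (inducedFunctor G) B ⋙
    inducedFunctor G).obj k) Cardinal.aleph0.{u} := fun k => hi k.left
  -- `B` is the colimit of its cells, and the diagram has finitely many arrows: an arrow is
  -- determined by two cells of `B` and a morphism between members of the family.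
  refine isCardinalPresentable_of_isColimit _ hc Cardinal.aleph0.{u} ?_
  rw [hasCardinalLT_aleph0_iff]
  have h₁ : Finite (CostructuredArrow (inducedFunctor G) B) :=
    Finite.of_injective (β := Σ i : ι, (G i ⟶ B)) (fun x => ⟨x.left, x.hom⟩) (by
      rintro ⟨i, ⟨⟨⟩⟩, x⟩ ⟨j, ⟨⟨⟩⟩, y⟩ h
      cases h
      rfl)
  have h₂ : ∀ x y : CostructuredArrow (inducedFunctor G) B, Finite (x ⟶ y) := fun x y =>
    have := hG.finite_hom x.left y.left
    Finite.of_injective (β := G x.left ⟶ G y.left) (fun k => k.left.hom) (fun k k' h =>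
      CostructuredArrow.hom_ext _ _ (InducedCategory.hom_ext h))
  exact Finite.of_injective (β := Σ (x y : CostructuredArrow (inducedFunctor G) B), (x ⟶ y))
    (fun f => ⟨f.left, f.right, f.hom⟩) (by
      rintro ⟨x, y, f⟩ ⟨x', y', f'⟩ h
      cases h
      rfl)

/-- A cocone is colimiting when it is so for the morphisms from each member of the family. -/
theorem nonempty_isColimit_of_coyoneda {J : Type u} [SmallCategory J] {D : J ⥤ V} (c : Cocone D)
    (h : ∀ i, Nonempty (IsColimit ((coyoneda.obj (op (G i))).mapCocone c))) :
    Nonempty (IsColimit c) := by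
  have := hG.isEquivalence
  refine ⟨isColimitOfReflects (cellNerve G) (evaluationJointlyReflectsColimits _ fun i => ?_)⟩
  exact (h i.unop).some

end CellFamily

/-! ### Generic morphisms -/

/-- A morphism `b : K ⟶ T B` is generic when it is a universal arrow into the functors induced by
`T` on the slices. -/
def IsGeneric (T : V ⥤ V) {K B : V} (b : K ⟶ T.obj B) : Prop :=
  ∀ ⦃Y Z : V⦄ (g : Y ⟶ Z) (h : B ⟶ Z) (y : K ⟶ T.obj Y), y ≫ T.map g = b ≫ T.map h →
    ∃! k : B ⟶ Y, k ≫ g = h ∧ b ≫ T.map k = y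

/-- Every morphism from a member of the family into a value of `T` factors through a generic
morphism, at an object with finitely many cells. -/
def HasGenericFactorizations {ι : Type u} (G : ι → V) (T : V ⥤ V) : Prop :=
  ∀ ⦃i : ι⦄ ⦃X : V⦄ (x : G i ⟶ T.obj X), ∃ (B : V) (b : G i ⟶ T.obj B) (h : B ⟶ X),
    b ≫ T.map h = x ∧ IsGeneric T b ∧ ∀ j, Finite (G j ⟶ B)

namespace HasGenericFactorizations

variable {ι : Type u} {G : ι → V} (hG : CellFamily G) {T : V ⥤ V}
  (hT : HasGenericFactorizations G T)
include hG hT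

/-- A cell of T(colim D) factors through a generic morphism into T B with B finitely presentable, so
B ⟶ colim D comes from some stage, and with it the cell. If two cells of T(D j) agree in the
colimit, genericity makes both come from the same `b` by maps `h` and `k` from B to D j that agree
in the colimit; these already agree at a later stage. -/
theorem preservesFilteredColimitsOfSize : PreservesFilteredColimitsOfSize.{u, u} T := by
  refine ⟨fun J _ _ => ⟨fun {D} => ⟨fun {c} hc => ?_⟩⟩⟩
  refine hG.nonempty_isColimit_of_coyoneda _ fun i => ⟨Types.FilteredColimit.isColimitOf' _ _ ?_ ?_⟩
  · intro x
    obtain ⟨B, b, h, hx, -, hB⟩ := hT (X := c.pt) x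
    have := hG.isFinitelyPresentable B hB
    obtain ⟨j, p, rfl⟩ := IsFinitelyPresentable.exists_hom_of_isColimit hc h
    exact ⟨j, b ≫ T.map p, hx.symm.trans (by simp)⟩
  · intro j x y hxy
    have hxy' : (show G i ⟶ T.obj (D.obj j) from x) ≫ T.map (c.ι.app j) =
      (show G i ⟶ T.obj (D.obj j) from y) ≫ T.map (c.ι.app j) := hxy
    obtain ⟨B, b, h, hx, hb, hB⟩ := hT (X := D.obj j) x
    obtain ⟨k, ⟨hk, hy⟩, -⟩ := hb (c.ι.app j) (h ≫ c.ι.app j) y (by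
      rw [← hxy', T.map_comp, ← Category.assoc, hx])
    have := hG.isFinitelyPresentable B hB
    obtain ⟨l, f, g, hfg⟩ := IsFinitelyPresentable.exists_eq_of_isColimit hc h k hk.symm
    -- Finite presentability gives two possibly different arrows `f` and `g` out of `j`;
    -- coequalizing them leaves a single transition map.
    refine ⟨IsFiltered.coeq f g, f ≫ IsFiltered.coeqHom f g, ?_⟩
    have hfg' : h ≫ D.map (f ≫ IsFiltered.coeqHom f g) =
        k ≫ D.map (f ≫ IsFiltered.coeqHom f g) := by
      conv_rhs => rw [IsFiltered.coeq_condition]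
      simp only [D.map_comp, ← Category.assoc, hfg]
    change (show G i ⟶ T.obj (D.obj j) from x) ≫ T.map (D.map _) =
      (show G i ⟶ T.obj (D.obj j) from y) ≫ T.map (D.map _)
    rw [← hx, ← hy, Category.assoc, Category.assoc, ← T.map_comp, ← T.map_comp, hfg']

/-- The objects at which a left adjoint is defined are closed under colimits, and every object over
T X is a colimit of cells over T X. At a cell, factored as `b ≫ T.map h` with `b` generic, the value
is `h : B ⟶ X`: genericity of `b` is exactly the required universal property. -/
theorem isRightAdjoint_post (X : V) : (Over.post (X := X) T).IsRightAdjoint := by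
  have := hG.hasColimitsOfSize
  apply Functor.isRightAdjoint_of_leftAdjointObjIsDefined_eq_top
  ext A
  simp only [Pi.top_apply, Prop.top_eq_true, iff_true]
  obtain ⟨hc⟩ := hG.nonempty_isColimit A.left
  have : HasColimitsOfShape (CostructuredArrow (inducedFunctor G) A.left) (Over X) := inferInstance
  refine Functor.leftAdjointObjIsDefined_of_isColimit
    (Over.isColimitLiftCocone (cellCocone G A.left) A.hom hc) ?_
  intro x
  obtain ⟨B, b, h, hx, hb, -⟩ := hT (i := x.left) (X := X) (x.hom ≫ A.hom)
  rw [Functor.leftAdjointObjIsDefined_iff]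
  have hw : ∀ {Y : Over X} (k : Over.mk h ⟶ Y), (b ≫ T.map k.left) ≫ T.map Y.hom =
      x.hom ≫ A.hom := fun {Y} k => by
    rw [Category.assoc, ← T.map_comp, Over.w k]
    exact hx
  refine Functor.CorepresentableBy.isCorepresentable (X := Over.mk h)
    { homEquiv := fun {Y} => Equiv.ofBijective (fun k => Over.homMk (b ≫ T.map k.left) (hw k))
        ⟨fun k k' hk => ?_, fun y => ?_⟩
      homEquiv_comp := fun {Y Y'} g f => ?_ }
  · have h₁ : b ≫ T.map k.left = b ≫ T.map k'.left := congrArg CommaMorphism.left hk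
    exact Over.OverMorphism.ext ((hb Y.hom h _ ((hw k).trans hx.symm)).unique ⟨Over.w k, rfl⟩
      ⟨Over.w k', h₁.symm⟩)
  · obtain ⟨k, ⟨hk, hy⟩, -⟩ := hb Y.hom h y.left ((Over.w y).trans hx.symm)
    exact ⟨Over.homMk k hk, Over.OverMorphism.ext hy⟩
  · refine Over.OverMorphism.ext ?_
    change b ≫ T.map (f.left ≫ g.left) = (b ≫ T.map f.left) ≫ T.map g.left
    simp

end HasGenericFactorizations

end Cells

/-! ### Cells of enriched graphs -/

section GraphCells

open Opposite

variable {V : Type (u + 1)} [LargeCategory.{u} V]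

theorem CellFamily.mk_of_exists {ι : Type u} {G : ι → V} (h₀ : Finite ι)
    (h₁ : ∀ i j, Finite (G i ⟶ G j))
    (hext : ∀ {X Y : V} {f g : X ⟶ Y}, (∀ i (x : G i ⟶ X), x ≫ f = x ≫ g) → f = g)
    (hhom : ∀ {X Y : V} (φ : ∀ i, (G i ⟶ X) → (G i ⟶ Y)),
      (∀ i j (z : G i ⟶ G j) (x : G j ⟶ X), φ i (z ≫ x) = z ≫ φ j x) →
        ∃ f : X ⟶ Y, ∀ i x, x ≫ f = φ i x)
    (hobj : ∀ P : (InducedCategory V G)ᵒᵖ ⥤ Type u, ∃ X, Nonempty ((cellNerve G).obj X ≅ P)) :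
    CellFamily G where
  finite_index := h₀
  finite_hom := h₁
  isEquivalence :=
    { faithful := ⟨fun {X Y f g} h => hext fun i x =>
        congrFun (congrArg (fun α => (α.app (op i)).hom) h) x⟩
      full := ⟨fun {X Y} ψ => by
        obtain ⟨f, hf⟩ := hhom (X := X) (Y := Y) (fun i x => (ψ.app (op i)).hom x)
          fun i j z x => ConcreteCategory.congr_hom
            (ψ.naturality (X := op (show InducedCategory V G from j))
              (Y := op (show InducedCategory V G from i)) (InducedCategory.homMk z).op) x
        refine ⟨f, ?_⟩
        ext i x
        exact hf _ x⟩
      essSurj := ⟨hobj⟩ }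

namespace EGraph

variable [HasInitial V]

variable (V) in
/-- The enriched graph with one object and initial hom. -/
def pt : EGraph V where
  Obj := PUnit
  hom _ _ := ⊥_ V

/-- The morphism from `pt` given by an object. -/
def ptHom {Y : EGraph V} (y : Y.Obj) : pt V ⟶ Y :=
  Hom.mk (fun _ => y) fun _ _ => initial.to _

theorem pt_hom_ext {Y : EGraph V} {f g : pt V ⟶ Y} (h : f.obj PUnit.unit = g.obj PUnit.unit) :
    f = g :=
  hom_ext (fun _ => h) fun _ _ => initialIsInitial.hom_ext _ _

theorem ptHom_comp {X Y : EGraph V} (x : X.Obj) (f : X ⟶ Y) :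
    ptHom x ≫ f = ptHom (f.obj x) :=
  pt_hom_ext rfl

theorem ptHom_surjective {Y : EGraph V} (f : pt V ⟶ Y) : ∃ y, ptHom y = f :=
  ⟨f.obj PUnit.unit, pt_hom_ext rfl⟩

/-- The homs of the suspension. -/
def suspHoms (G : V) : Bool → Bool → V
  | false, true => G
  | _, _ => ⊥_ V

/-- The enriched graph with two objects and a single non-initial hom `G`. -/
def susp (G : V) : EGraph V where
  Obj := ULift.{u} Bool
  hom i j := suspHoms G i.down j.down

/-- The hom maps of the morphism from a suspension given by a morphism to a hom. -/
def suspHomMap {G : V} {Y : EGraph V} (y : Bool → Y.Obj) (e : G ⟶ Y.hom (y false) (y true)) :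
    ∀ i j, suspHoms G i j ⟶ Y.hom (y i) (y j)
  | false, true => e
  | false, false => initial.to _
  | true, false => initial.to _
  | true, true => initial.to _

/-- The morphism from a suspension given by a morphism to a hom. -/
def suspHom {G : V} {Y : EGraph V} {a b : Y.Obj} (e : G ⟶ Y.hom a b) : susp G ⟶ Y :=
  Hom.mk (fun i => bif i.down then b else a)
    (fun i j => suspHomMap (fun i => bif i then b else a) e i.down j.down)

theorem susp_hom_ext {G : V} {Y : EGraph V} {f g : susp G ⟶ Y}
    (h₀ : f.obj ⟨false⟩ = g.obj ⟨false⟩) (h₁ : f.obj ⟨true⟩ = g.obj ⟨true⟩)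
    (h : f.map ⟨false⟩ ⟨true⟩ ≫ Y.cast h₀ h₁ = g.map ⟨false⟩ ⟨true⟩) : f = g := by
  refine hom_ext (fun ⟨i⟩ => by cases i <;> assumption) fun ⟨i⟩ ⟨j⟩ => ?_
  match i, j with
  | false, true => exact h
  | false, false => exact initialIsInitial.hom_ext _ _
  | true, false => exact initialIsInitial.hom_ext _ _
  | true, true => exact initialIsInitial.hom_ext _ _

theorem suspHom_comp {G : V} {X Y : EGraph V} {a b : X.Obj} (e : G ⟶ X.hom a b) (f : X ⟶ Y) :
    suspHom e ≫ f = suspHom (e ≫ f.map a b) :=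
  susp_hom_ext rfl rfl (Category.comp_id _)

theorem suspHom_eta {G : V} {Y : EGraph V} (f : susp G ⟶ Y) :
    suspHom (f.map ⟨false⟩ ⟨true⟩ : G ⟶ _) = f :=
  susp_hom_ext rfl rfl (Category.comp_id _)

theorem suspHom_injective {G : V} {Y : EGraph V} {a b a' b' : Y.Obj} {e : G ⟶ Y.hom a b}
    {e' : G ⟶ Y.hom a' b'} (h : suspHom e = suspHom e') :
    (⟨a, b, e⟩ : Σ a b, G ⟶ Y.hom a b) = ⟨a', b', e'⟩ :=
  congrArg (fun f : susp G ⟶ Y =>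
    (⟨f.obj ⟨false⟩, f.obj ⟨true⟩, f.map ⟨false⟩ ⟨true⟩⟩ : Σ a b, G ⟶ Y.hom a b)) h

theorem suspHom_cast {G : V} {Y : EGraph V} {a b a' b' : Y.Obj} (e : G ⟶ Y.hom a b) (h : a = a')
    (k : b = b') : suspHom (e ≫ Y.cast h k) = suspHom e := by
  subst h k
  simp

/-- Suspension of morphisms. -/
def suspMap {G G' : V} (z : G ⟶ G') : susp G ⟶ susp G' :=
  suspHom (Y := susp G') (a := ⟨false⟩) (b := ⟨true⟩) z

theorem suspMap_comp {G G' : V} (z : G ⟶ G') {Y : EGraph V} {a b : Y.Obj} (e : G' ⟶ Y.hom a b) :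
    suspMap z ≫ suspHom e = suspHom (z ≫ e) :=
  suspHom_comp _ _

/-- The cells of enriched graphs. -/
def cells {ι : Type u} (G : ι → V) : Option ι → EGraph V
  | none => pt V
  | some i => susp (G i)

/-! ### The cells of enriched graphs generate a presheaf category -/

section

variable {ι : Type u} {G : ι → V} (hG : CellFamily G)

theorem finite_cells_hom {Y : EGraph V} [Finite Y.Obj] (h : ∀ i a b, Finite (G i ⟶ Y.hom a b)) :
    ∀ i, Finite (cells G i ⟶ Y)
  | none => Finite.of_injective (β := Y.Obj) (fun f => f.obj PUnit.unit) fun _ _ h => pt_hom_ext h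
  | some i => Finite.of_surjective (α := Σ a b, G i ⟶ Y.hom a b) (fun x => suspHom x.2.2)
      fun f => ⟨⟨_, _, _⟩, suspHom_eta f⟩

include hG

/-- The other three homs of a suspension are initial, and no cell maps to an initial object. -/
theorem suspHoms_cases (i : ι) (G' : V) (x y : Bool) (z : G i ⟶ suspHoms G' x y) :
    x = false ∧ y = true := by
  match x, y with
  | false, true => exact ⟨rfl, rfl⟩
  | false, false => exact ((hG.isEmpty_of_isInitial i initialIsInitial).false z).elim
  | true, false => exact ((hG.isEmpty_of_isInitial i initialIsInitial).false z).elim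
  | true, true => exact ((hG.isEmpty_of_isInitial i initialIsInitial).false z).elim

theorem suspMap_surjective {i : ι} {G' : V} (f : susp (G i) ⟶ susp G') : ∃ z, suspMap z = f := by
  rw [← suspHom_eta f]
  -- The hom map and the end points of `f` are turned into variables, so that the end points can be
  -- replaced by their actual values although the type of the hom map depends on them.
  generalize (f.map ⟨false⟩ ⟨true⟩ : G i ⟶ _) = z
  generalize f.obj ⟨false⟩ = x at z
  generalize f.obj ⟨true⟩ = y at z
  obtain ⟨x⟩ := x
  obtain ⟨y⟩ := y
  obtain ⟨rfl, rfl⟩ := suspHoms_cases hG i G' x y z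
  exact ⟨z, rfl⟩

theorem isEmpty_susp_hom_pt (i : ι) : IsEmpty (susp (G i) ⟶ pt V) :=
  ⟨fun f => (hG.isEmpty_of_isInitial i initialIsInitial).false
    (f.map ⟨false⟩ ⟨true⟩ : G i ⟶ ⊥_ V)⟩

/-- Points detect the action on objects. Suspended cells then detect the hom maps, up to the
transport along this equality of end points. -/
theorem cells_hom_ext {X Y : EGraph V} {f g : X ⟶ Y}
    (h : ∀ i (x : cells G i ⟶ X), x ≫ f = x ≫ g) : f = g := by
  have h₀ : ∀ x, f.obj x = g.obj x := fun x => by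
    have := h none (ptHom x)
    exact congrArg (fun f : pt V ⟶ Y => f.obj PUnit.unit) this
  refine hom_ext h₀ fun a b => hG.hom_ext fun i x => ?_
  have h₁ := h (some i) (suspHom x)
  simp only [cells, suspHom_comp] at h₁
  rw [← suspHom_cast _ (h₀ a) (h₀ b)] at h₁
  have h₂ := suspHom_injective h₁
  simpa using h₂

/-- The values of `φ` at points give the map on objects. Compatibility with the two points of a
suspension forces the image of a suspended cell of X(a, b) to run from `f₀ a` to `f₀ b`, and
compatibility with suspended morphisms lets `hG.exists_hom` produce each hom map. -/
theorem cells_exists_hom {X Y : EGraph V} (φ : ∀ i, (cells G i ⟶ X) → (cells G i ⟶ Y))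
    (h : ∀ i j (z : cells G i ⟶ cells G j) (x : cells G j ⟶ X), φ i (z ≫ x) = z ≫ φ j x) :
    ∃ f : X ⟶ Y, ∀ i x, x ≫ f = φ i x := by
  let f₀ : X.Obj → Y.Obj := fun x => (φ none (ptHom x)).obj PUnit.unit
  have h₀ : ∀ x, φ none (ptHom x) = ptHom (f₀ x) := fun x => pt_hom_ext rfl
  have hs : ∀ i {a b : X.Obj} (e : G i ⟶ X.hom a b),
      (φ (some i) (suspHom e)).obj ⟨false⟩ = f₀ a := fun i a b e =>
    (congrArg (fun f : pt V ⟶ Y => f.obj PUnit.unit)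
      ((congrArg (φ none) (ptHom_comp (X := susp (G i)) ⟨false⟩ (suspHom e)).symm).trans
        (h none (some i) (ptHom (Y := susp (G i)) ⟨false⟩) (suspHom e)))).symm
  have ht : ∀ i {a b : X.Obj} (e : G i ⟶ X.hom a b),
      (φ (some i) (suspHom e)).obj ⟨true⟩ = f₀ b := fun i a b e =>
    (congrArg (fun f : pt V ⟶ Y => f.obj PUnit.unit)
      ((congrArg (φ none) (ptHom_comp (X := susp (G i)) ⟨true⟩ (suspHom e)).symm).trans
        (h none (some i) (ptHom (Y := susp (G i)) ⟨true⟩) (suspHom e)))).symm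
  have h₁ : ∀ i (a b : X.Obj) (e : G i ⟶ X.hom a b), ∃ e' : G i ⟶ Y.hom (f₀ a) (f₀ b),
      φ (some i) (suspHom e) = suspHom e' := fun i a b e =>
    ⟨_, ((suspHom_cast _ (hs i e) (ht i e)).trans (suspHom_eta (φ (some i) (suspHom e)))).symm⟩
  choose ψ hψ using h₁
  have h₂ : ∀ a b, ∃ f : X.hom a b ⟶ Y.hom (f₀ a) (f₀ b), ∀ i x, x ≫ f = ψ i a b x := by
    intro a b
    refine hG.exists_hom (fun i x => ψ i a b x) fun i j z x => ?_
    have h₃ := h (some i) (some j) (suspMap z) (suspHom x)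
    have h₄ : suspHom (ψ i a b (z ≫ x)) = suspHom (z ≫ ψ j a b x) :=
      (hψ i a b (z ≫ x)).symm.trans ((congrArg (φ (some i)) (suspMap_comp z x).symm).trans
        (h₃.trans ((congrArg (suspMap z ≫ ·) (hψ j a b x)).trans (suspMap_comp _ _))))
    simpa using suspHom_injective h₄
  choose f₁ hf₁ using h₂
  refine ⟨Hom.mk f₀ f₁, ?_⟩
  rintro (_ | i) x
  · obtain ⟨x, rfl⟩ := ptHom_surjective x
    exact (ptHom_comp _ _).trans (h₀ x).symm
  · obtain ⟨a, b, e, rfl⟩ : ∃ a b, ∃ e : G i ⟶ X.hom a b, suspHom e = x :=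
      ⟨_, _, _, suspHom_eta x⟩
    refine (suspHom_comp _ _).trans ?_
    rw [hψ]
    exact congrArg suspHom (hf₁ _ _ _ _)

/-- The graph has as objects the values of `P` at the point. Its hom from `a` to `b` is the object
whose nerve is the presheaf `Q a b` of those elements of `P` on suspended cells that have source `a`
and target `b`. -/
theorem cells_exists_obj (P : (InducedCategory (EGraph V) (cells G))ᵒᵖ ⥤ Type u) :
    ∃ X, Nonempty ((cellNerve (cells G)).obj X ≅ P) := by
  have := hG.isEquivalence
  let C := InducedCategory (EGraph V) (cells G)
  let c₀ : C := none
  let c : ι → C := fun i => some i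
  let src : ∀ i, c₀ ⟶ c i := fun i => InducedCategory.homMk (ptHom (Y := susp (G i)) ⟨false⟩)
  let tgt : ∀ i, c₀ ⟶ c i := fun i => InducedCategory.homMk (ptHom (Y := susp (G i)) ⟨true⟩)
  let S : ∀ {i j} (_ : G i ⟶ G j), c i ⟶ c j := fun {i j} z => InducedCategory.homMk (suspMap z)
  have hsrc : ∀ {i j} (z : G i ⟶ G j), src i ≫ S z = src j := fun z =>
    InducedCategory.hom_ext (ptHom_comp _ _)
  have htgt : ∀ {i j} (z : G i ⟶ G j), tgt i ≫ S z = tgt j := fun z =>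
    InducedCategory.hom_ext (ptHom_comp _ _)
  have hsrcP : ∀ {i j} (z : G i ⟶ G j) (x : P.obj (op (c j))),
      P.map (src i).op (P.map (S z).op x) = P.map (src j).op x := fun z x => by
    rw [← hsrc z, op_comp, P.map_comp]; rfl
  have htgtP : ∀ {i j} (z : G i ⟶ G j) (x : P.obj (op (c j))),
      P.map (tgt i).op (P.map (S z).op x) = P.map (tgt j).op x := fun z x => by
    rw [← htgt z, op_comp, P.map_comp]; rfl
  let O : Type u := P.obj (op c₀)
  let Q : O → O → (InducedCategory V G)ᵒᵖ ⥤ Type u := fun a b =>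
    { obj := fun i => { x : P.obj (op (c i.unop)) // P.map (src i.unop).op x = a ∧
        P.map (tgt i.unop).op x = b }
      map := fun z => TypeCat.ofHom fun x => ⟨P.map (S z.unop.hom).op x.1,
        (hsrcP z.unop.hom x.1).trans x.2.1, (htgtP z.unop.hom x.1).trans x.2.2⟩
      map_id := fun i => by
        ext x
        have : S (𝟙 (G i.unop)) = 𝟙 _ := InducedCategory.hom_ext (suspHom_eta (𝟙 (susp (G i.unop))))
        change P.map (S (𝟙 (G i.unop))).op x.1 = x.1
        rw [this]
        simp
      map_comp := fun z z' => by
        ext x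
        have : S (z'.unop.hom ≫ z.unop.hom) = S z'.unop.hom ≫ S z.unop.hom :=
          InducedCategory.hom_ext (suspMap_comp _ _).symm
        change P.map (S (z'.unop.hom ≫ z.unop.hom)).op x.1 = _
        rw [this, op_comp, P.map_comp]
        rfl }
  let X : EGraph V := ⟨O, fun a b => (cellNerve G).objPreimage (Q a b)⟩
  let θ : ∀ a b, (cellNerve G).obj (X.hom a b) ≅ Q a b := fun a b =>
    (cellNerve G).objObjPreimageIso (Q a b)
  let θ' : ∀ i {a b}, (G i ⟶ X.hom a b) → (Q a b).obj (op i) := fun i a b x =>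
    ((θ a b).hom.app (op i)).hom x
  have hθ : ∀ i a b, Function.Bijective (θ' i : (G i ⟶ X.hom a b) → _) := fun i a b =>
    ((θ a b).app (op i)).toEquiv.bijective
  have hθn : ∀ {i j} (z : G i ⟶ G j) {a b} (x : G j ⟶ X.hom a b),
      (θ' i (z ≫ x)).1 = P.map (S z).op (θ' j x).1 := fun {i j} z {a b} x =>
    congrArg Subtype.val (ConcreteCategory.congr_hom ((θ a b).hom.naturality
      (X := op (show InducedCategory V G from j)) (Y := op (show InducedCategory V G from i))
        (InducedCategory.homMk z).op) x)
  let Ψ : ∀ d : C, (cells G d ⟶ X) → P.obj (op d)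
    | none => fun f => f.obj PUnit.unit
    | some i => fun f => (θ' i (f.map ⟨false⟩ ⟨true⟩ : G i ⟶ _)).1
  have hΨ : ∀ d, Function.Bijective (Ψ d) := by
    rintro (_ | i)
    · exact ⟨fun f g h => pt_hom_ext h, fun x => ⟨ptHom (Y := X) x, rfl⟩⟩
    · refine ⟨fun f g h => ?_, fun x => ?_⟩
      · rw [← suspHom_eta f, ← suspHom_eta g]
        have h' : (θ' i (f.map ⟨false⟩ ⟨true⟩ : G i ⟶ _)).1 =
          (θ' i (g.map ⟨false⟩ ⟨true⟩ : G i ⟶ _)).1 := h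
        revert h'
        generalize (f.map ⟨false⟩ ⟨true⟩ : G i ⟶ _) = e
        generalize (g.map ⟨false⟩ ⟨true⟩ : G i ⟶ _) = e'
        intro h'
        have h₀ := (θ' i e).2
        have h₁ := (θ' i e').2
        -- An element of `P` determines its source and target, so equal elements have equal end
        -- points. Once these are generalized and identified, `e` and `e'` lie in the same hom,
        -- where `hθ` applies.
        rw [h', h₁.1, h₁.2] at h₀
        revert e e'
        obtain ⟨h₂, h₃⟩ := h₀
        revert h₂ h₃
        generalize f.obj ⟨false⟩ = a
        generalize f.obj ⟨true⟩ = b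
        rintro rfl rfl e e' h -
        rw [(hθ i _ _).1 (Subtype.ext h)]
      · obtain ⟨e, he⟩ := (hθ i _ _).2 ⟨x, rfl, rfl⟩
        exact ⟨suspHom e, congrArg Subtype.val he⟩
  refine ⟨X, ⟨NatIso.ofComponents (fun d => (Equiv.ofBijective _ (hΨ d.unop)).toIso) ?_⟩⟩
  rintro ⟨d⟩ ⟨d'⟩ ⟨m⟩
  ext f
  change Ψ d' (m.hom ≫ f) = P.map m.op (Ψ d f)
  -- The morphisms of cells are the identity of the point, the two points of each suspension, and
  -- the suspensions of morphisms; there is none from a suspended cell to the point.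
  match d, d', m, f with
  | none, none, m, f =>
    obtain rfl : m = 𝟙 _ := InducedCategory.hom_ext (pt_hom_ext rfl)
    simp
    rfl
  | none, some i, m, f => exact ((isEmpty_susp_hom_pt hG i).false m.hom).elim
  | some i, none, m, f =>
    obtain ⟨⟨x⟩, hx⟩ := ptHom_surjective m.hom
    cases x with
    | false =>
      obtain rfl : m = src i := InducedCategory.hom_ext hx.symm
      exact (θ' i (f.map ⟨false⟩ ⟨true⟩ : G i ⟶ _)).2.1.symm
    | true =>
      obtain rfl : m = tgt i := InducedCategory.hom_ext hx.symm
      exact (θ' i (f.map ⟨false⟩ ⟨true⟩ : G i ⟶ _)).2.2.symm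
  | some i, some j, m, f =>
    obtain ⟨z, hz⟩ := suspMap_surjective hG m.hom
    obtain rfl : m = S z := InducedCategory.hom_ext hz.symm
    exact hθn z _

/-- The cells of enriched graphs exhibit `𝒢V` as a category of presheaves when `V` is one. -/
theorem cellFamily_cells : CellFamily (cells G) := by
  have := hG.finite_index
  refine CellFamily.mk_of_exists inferInstance (fun i j => ?_) (cells_hom_ext hG)
    (cells_exists_hom hG) (cells_exists_obj hG)
  match j with
  | none =>
    have : Finite (pt V).Obj := inferInstanceAs (Finite PUnit)
    exact finite_cells_hom (Y := pt V) (fun i a b =>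
      have := hG.isEmpty_of_isInitial i initialIsInitial
      inferInstanceAs (Finite (G i ⟶ ⊥_ V))) i
  | some j =>
    have : Finite (susp (G j)).Obj := inferInstanceAs (Finite (ULift Bool))
    refine finite_cells_hom (Y := susp (G j)) (fun i a b => ?_) i
    obtain ⟨a⟩ := a
    obtain ⟨b⟩ := b
    have := hG.isEmpty_of_isInitial i initialIsInitial
    match a, b with
    | false, true => exact hG.finite_hom i j
    | false, false => exact inferInstanceAs (Finite (G i ⟶ ⊥_ V))
    | true, false => exact inferInstanceAs (Finite (G i ⟶ ⊥_ V))
    | true, true => exact inferInstanceAs (Finite (G i ⟶ ⊥_ V))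

end

end EGraph

end GraphCells

/-! ### Lifting chains along maps of families -/

namespace Chain

variable {O O' : Type u} {H K : O → O → Type u} {H' K' : O' → O' → Type u}

theorem single_injective {a b : O} {e e' : H a b} (h : single e = single e') : e = e' := by
  cases h
  rfl

theorem exists_single {a b : O} (P : Chain H a b) (h : P.length = 1) : ∃ e, P = single e := by
  cases P with
  | nil => simp [length] at h
  | cons P e =>
    cases P with
    | nil => exact ⟨e, rfl⟩
    | cons P e' => simp [length] at h

/-- Decompositions of a chain are determined by the length of their second part. -/
theorem comp_injective {a b : O} {m m' : O} {P : Chain H a m} {Q : Chain H m b}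
    {P' : Chain H a m'} {Q' : Chain H m' b} (h : P.comp Q = P'.comp Q')
    (hl : Q.length = Q'.length) :
    (⟨m, P, Q⟩ : Σ m, Chain H a m × Chain H m b) = ⟨m', P', Q'⟩ := by
  induction Q with
  | nil =>
    cases Q' with
    | nil =>
      obtain rfl : P = P' := h
      rfl
    | cons Q' e => simp [length] at hl
  | cons Q e ih =>
    cases Q' with
    | nil => simp [length] at hl
    | cons Q' e' =>
      simp only [comp] at h
      obtain ⟨h₁, h₂, h₃⟩ := cons.inj h
      subst h₁
      obtain rfl := eq_of_heq h₃
      have := ih (eq_of_heq h₂) (by simpa [length] using hl)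
      cases this
      rfl

/-- Decompositions of chains lift along maps of families. -/
theorem exists_comp_of_map (f : O → O') (φ : ∀ a b, H a b → H' (f a) (f b)) {a : O} {y z : O'}
    (A : Chain H' (f a) y) (B : Chain H' y z) {b : O} (P : Chain H a b) (hb : z = f b)
    (h : P.map f φ = (A.comp B).cast rfl hb) :
    ∃ (m : O) (hm : y = f m) (P₁ : Chain H a m) (P₂ : Chain H m b), P = P₁.comp P₂ ∧
      P₁.map f φ = A.cast rfl hm ∧ P₂.map f φ = B.cast hm hb := by
  induction B generalizing b with
  | nil =>
    subst hb
    exact ⟨b, rfl, P, nil, rfl, h, rfl⟩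
  | cons B e ih =>
    subst hb
    cases P with
    | nil =>
      have := congrArg length h
      simp [length, map, comp] at this
    | cons P e' =>
      simp only [map, comp, cast_rfl] at h
      obtain ⟨h₁, h₂, h₃⟩ := cons.inj h
      subst h₁
      obtain rfl := eq_of_heq h₃
      obtain ⟨m, rfl, P₁, P₂, rfl, h₄, h₅⟩ := ih P rfl (eq_of_heq h₂)
      exact ⟨m, rfl, P₁, cons P₂ e', rfl, h₄, by simp [map, h₅]⟩

/-- The length of the last member of a chain of elements which are sent to chains. -/
def lastLength (π : ∀ {a b}, K a b → Chain H a b) {a : O} : ∀ {b : O}, Chain K a b → ℕ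
  | _, nil => 0
  | _, cons _ e => (π e).length

/-- If the members of a family `K` are uniquely lifted along a map of families, compatibly with
their images in chains, then so are chains of them. -/
theorem existsUnique_join (f : O → O') (φ : ∀ a b, H a b → H' (f a) (f b))
    (ψ : ∀ a b, K a b → K' (f a) (f b)) (π : ∀ {a b}, K a b → Chain H a b)
    (π' : ∀ {a b}, K' a b → Chain H' a b)
    (hπ : ∀ a b (k : K a b), (π k).map f φ = π' (ψ a b k))
    (hu : ∀ a b (k' : K' (f a) (f b)) (P : Chain H a b), P.map f φ = π' k' →
      ∃! k : K a b, ψ a b k = k' ∧ π k = P)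
    {a : O} {z : O'} (Q : Chain K' (f a) z) {b : O} (hb : z = f b) (P : Chain H a b)
    (h : P.map f φ = ((Q.hmap (K := Chain H') π').join).cast rfl hb) :
    ∃! R : Chain K a b, R.map f ψ = Q.cast rfl hb ∧ (R.hmap (K := Chain H) π).join = P := by
  induction Q generalizing b with
  | nil =>
    cases P with
    | cons P e =>
      have := congrArg toList h
      rw [toList_cast] at this
      simp [map, toList, hmap, join] at this
    | nil =>
      refine ⟨nil, ⟨rfl, rfl⟩, ?_⟩
      rintro R ⟨hR, -⟩
      cases R with
      | nil => rfl
      | cons R k =>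
        have := congrArg length hR
        simp [map, length] at this
  | cons Q k' ih =>
    subst hb
    simp only [cast_rfl, hmap, join] at h
    -- The image of `P` splits into the part coming from `Q` and the part coming from the last
    -- member `k'`. The splitting lifts to `P`, and the two parts are treated by induction and by
    -- `hu`.
    obtain ⟨m, rfl, P₁, P₂, rfl, h₁, h₂⟩ := exists_comp_of_map f φ _ _ P rfl h
    obtain ⟨R, ⟨hR, hR'⟩, hRu⟩ := ih rfl P₁ h₁
    obtain ⟨k, ⟨hk, hk'⟩, hku⟩ := hu _ _ k' P₂ h₂
    refine ⟨cons R k, ⟨?_, ?_⟩, ?_⟩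
    · simp [map, hR, hk]
    · simp [hmap, join, hR', hk']
    · rintro S ⟨hS, hS'⟩
      cases S with
      | nil =>
        have := congrArg length hS
        simp [map, length] at this
      | cons S l =>
        -- A competitor `S.cons l` must cut `P₁.comp P₂` in the same place. The length of its last
        -- part is dictated by `k'`, since mapping a chain preserves its length, and
        -- `comp_injective` then separates the parts.
        have hl : (π' (ψ _ _ l)).length = (π' k').length :=
          congrArg (lastLength π') hS
        have hl' : (π l).length = P₂.length := by
          rw [← length_map f φ, hπ, hl, ← length_map f φ P₂, h₂, cast_rfl]
        simp only [hmap, join] at hS'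
        have := comp_injective hS' hl'
        cases this
        simp only [map, cast_rfl] at hS
        obtain ⟨-, h₃, h₄⟩ := cons.inj hS
        rw [hRu S ⟨eq_of_heq h₃, rfl⟩, hku l ⟨eq_of_heq h₄, rfl⟩]

theorem hmap_bijective {φ : ∀ {a b}, H a b → K a b}
    (hφ : ∀ a b, Function.Bijective (φ : H a b → K a b)) (a b : O) :
    Function.Bijective (hmap (φ := φ) : Chain H a b → Chain K a b) := by
  refine Function.bijective_iff_has_inverse.2
    ⟨hmap (φ := fun {a b} => (Equiv.ofBijective _ (hφ a b)).symm), fun P => ?_, fun P => ?_⟩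
  · rw [hmap_hmap]
    exact hmap_id (fun a b e => (Equiv.ofBijective _ (hφ a b)).symm_apply_apply e) P
  · rw [hmap_hmap]
    exact hmap_id (fun a b e => (Equiv.ofBijective _ (hφ a b)).apply_symm_apply e) P

end Chain

/-! ### Pullbacks of enriched graphs -/

namespace EGraph

variable {V : Type (u + 1)} [LargeCategory.{u} V]

/-- A square of enriched graphs with two sides which are the identity on objects is a pullback when
it is so on homs. -/
theorem isPullback_of_hom {X Y : EGraph V} {X₁ : X.Obj → X.Obj → V} {Y₁ : Y.Obj → Y.Obj → V}
    (f : X ⟶ Y) (α : ∀ a b, X.hom a b ⟶ X₁ a b) (β : ∀ a b, Y.hom a b ⟶ Y₁ a b)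
    (φ : ∀ a b, X₁ a b ⟶ Y₁ (f.obj a) (f.obj b))
    (h : ∀ a b, IsPullback (f.map a b) (α a b) (β (f.obj a) (f.obj b)) (φ a b)) :
    IsPullback (Z := (⟨Y.Obj, Y₁⟩ : EGraph V)) (Y := (⟨X.Obj, X₁⟩ : EGraph V)) f
      (Hom.mk (Y := (⟨X.Obj, X₁⟩ : EGraph V)) (fun a => a) α)
      (Hom.mk (Y := (⟨Y.Obj, Y₁⟩ : EGraph V)) (fun a => a) β)
      (Hom.mk (X := (⟨X.Obj, X₁⟩ : EGraph V)) (Y := (⟨Y.Obj, Y₁⟩ : EGraph V)) f.obj φ) := by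
  let X' : EGraph V := ⟨X.Obj, X₁⟩
  let Y' : EGraph V := ⟨Y.Obj, Y₁⟩
  let α' : X ⟶ X' := Hom.mk (Y := X') (fun a => a) α
  let β' : Y ⟶ Y' := Hom.mk (Y := Y') (fun a => a) β
  let φ' : X' ⟶ Y' := Hom.mk (X := X') (Y := Y') f.obj φ
  have hex : ∀ (S : EGraph V) (u : S ⟶ Y) (v : S ⟶ X'), u ≫ β' = v ≫ φ' →
      ∃ l : S ⟶ X, l ≫ f = u ∧ l ≫ α' = v := by
    rintro S ⟨u₀, u₁⟩ ⟨v₀, v₁⟩ w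
    -- Since `β'` and `α'` are the identity on objects, the object map of `u` is forced by that of
    -- `v`; what remains is a separate pullback for every hom.
    obtain rfl : u₀ = fun x => f.obj (v₀ x) := congrArg Hom.obj w
    have w' : ∀ x y, u₁ x y ≫ β _ _ = v₁ x y ≫ φ _ _ := fun x y =>
      (map_eq_of_eq w x y).trans (Category.comp_id _)
    exact ⟨Hom.mk v₀ fun x y => (h _ _).lift (u₁ x y) (v₁ x y) (w' x y),
      mk_ext fun x y => (h _ _).lift_fst _ _ _, mk_ext fun x y => (h _ _).lift_snd _ _ _⟩
  have huniq : ∀ (S : EGraph V) (l m : S ⟶ X), l ≫ f = m ≫ f → l ≫ α' = m ≫ α' → l = m := by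
    rintro S ⟨l₀, l₁⟩ ⟨m₀, m₁⟩ h₁ h₂
    obtain rfl : l₀ = m₀ := congrArg Hom.obj h₂
    exact mk_ext fun x y => (h _ _).hom_ext
      ((map_eq_of_eq h₁ x y).trans (Category.comp_id _))
      ((map_eq_of_eq h₂ x y).trans (Category.comp_id _))
  choose l hl using fun s : PullbackCone β' φ' => hex s.pt s.fst s.snd s.condition
  exact ⟨⟨mk_ext fun a b => (h a b).w⟩, ⟨PullbackCone.IsLimit.mk _ l (fun s => (hl s).1)
    (fun s => (hl s).2) fun s m h₁ h₂ => huniq _ _ _ (h₁.trans (hl s).1.symm)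
      (h₂.trans (hl s).2.symm)⟩⟩

end EGraph

/-! ### Generalized elements at cells -/

section Cells

variable {V : Type (u + 1)} [LargeCategory.{u} V] [HasFiniteProducts V] [HasCoproducts.{u} V]
  {T : Monad V} {ι : Type u} {G : ι → V}

/-- A cell of the coproduct lies in a unique summand, and a map into that summand, which is a
product, is a unique tuple; a sequence of objects together with such a tuple is a chain. -/
theorem el_bijective (hG : CellFamily G) (i : ι) (X : EGraph V) (a b : X.Obj) :
    Function.Bijective (el : Chain (THom T X (G i)) a b → _) :=
  (hG.bijective_cofan i _ ⟨Multitensor.gammaIsColimit (E := timesMultitensor T) X a b⟩).comp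
    (((Equiv.sigmaCongrRight fun p : EPath a b => Equiv.ofBijective
      (tensorLift (T := T) (W := p.homs X) (Z := G i))
        ⟨tensorLift_injective, tensorLift_surjective⟩).bijective).comp
      (Chain.alongEquiv (H := THom T X (G i)) a b).symm.bijective)

/-- `T` preserves the coproduct defining `Γ (T^×) X`, and a cell of a coproduct lies in a unique
summand. -/
theorem Nested.incl_bijective (hG : CellFamily G) (hT : PreservesCoproducts T.toFunctor) (i : ι)
    (X : EGraph V) (a b : X.Obj) :
    Function.Bijective (Nested.incl : Nested T X (G i) a b → _) :=
  hG.bijective_cofan i _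
    (hT _ _ _ ⟨Multitensor.gammaIsColimit (E := timesMultitensor T) X a b⟩)

/-- The action of a morphism of enriched graphs on elements of the summands of `T (Γ (T^×) X)`. -/
def Nested.map {X Y : EGraph V} (f : X ⟶ Y) {Z : V} {a b : X.Obj} (s : Nested T X Z a b) :
    Nested T Y Z (f.obj a) (f.obj b) :=
  ⟨s.1.map f.obj, s.2 ≫ T.map (((timesMultitensor T).tensor s.1.len).map fun j =>
    f.map (s.1.vert j.castSucc) (s.1.vert j.succ))⟩

theorem Nested.incl_map {X Y : EGraph V} (f : X ⟶ Y) {Z : V} {a b : X.Obj}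
    (s : Nested T X Z a b) :
    (s.map f).incl = s.incl ≫ T.map (Multitensor.gammaMapHom f a b) := by
  unfold Nested.incl Nested.map
  rw [Category.assoc, Category.assoc, ← T.map_comp, ← T.map_comp, Multitensor.inc_mapHom]

theorem Nested.parse_map {X Y : EGraph V} (f : X ⟶ Y) {Z : V} {a b : X.Obj}
    (s : Nested T X Z a b) :
    s.parse.map (H' := THom T Y Z) f.obj (fun a b t => t ≫ T.map (f.map a b)) =
      (s.map f).parse := by
  unfold Nested.parse
  rw [Chain.map_ofPath]
  refine congrArg (Chain.ofPath (H := THom T Y Z) (s.1.map f.obj)) (funext fun j => ?_)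
  have h := tensor_map_proj (T := T) (fun j => f.map (s.1.vert j.castSucc) (s.1.vert j.succ)) j
  have h₁ := T.μ.naturality (f.map (s.1.vert j.castSucc) (s.1.vert j.succ))
  have h₂ := congrArg (fun k => s.2 ≫ T.map k ≫ T.μ.app _) h
  simp only [T.map_comp, Category.assoc] at h₂
  simp only [Category.assoc]
  refine Eq.trans ?_ ((Category.assoc _ _ _).trans h₂).symm
  exact congrArg (fun k => s.2 ≫ T.map (tensorProj T (s.1.homs X) j) ≫ k) h₁.symm

variable (hT : HasGenericFactorizations G T.toFunctor) (hμ : NatTrans.Equifibered T.μ)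
include hT hμ

/-- The pullback squares of `T.μ` lift each pair of `t j` and the j-th component of `s'` to a map `r
j` into T(T(W j)). As `T` is not assumed to preserve products, the `r j` cannot be paired there.
Factoring `s'` through a generic `b` into T B turns them into maps from `B` to T(W j), and these can
be paired before applying `T`. -/
theorem existsUnique_tensor {n : ℕ} {W W' : Fin n → V} (f : ∀ j, W j ⟶ W' j) (i : ι)
    (s' : G i ⟶ T.obj (((timesMultitensor T).tensor n).obj W')) (t : ∀ j, G i ⟶ T.obj (W j))
    (h : ∀ j, t j ≫ T.map (f j) = s' ≫ T.map (tensorProj T W' j) ≫ T.μ.app _) :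
    ∃! s : G i ⟶ T.obj (((timesMultitensor T).tensor n).obj W),
      s ≫ T.map (((timesMultitensor T).tensor n).map f) = s' ∧
        ∀ j, s ≫ T.map (tensorProj T W j) ≫ T.μ.app _ = t j := by
  have hp : ∀ j, IsPullback (T.map (T.map (f j))) (T.μ.app (W j)) (T.μ.app (W' j))
      (T.map (f j)) := fun j => hμ (f j)
  have hr : ∀ j, ∃ r : G i ⟶ T.obj (T.obj (W j)), r ≫ T.map (T.map (f j)) =
      s' ≫ T.map (tensorProj T W' j) ∧ r ≫ T.μ.app _ = t j := fun j =>
    ⟨(hp j).lift (s' ≫ T.map (tensorProj T W' j)) (t j) ((Category.assoc _ _ _).trans (h j).symm),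
      (hp j).lift_fst _ _ _, (hp j).lift_snd _ _ _⟩
  choose r hr₁ hr₂ using hr
  obtain ⟨B, b, q, rfl, hb, -⟩ := hT s'
  have hk : ∀ j, ∃! k : B ⟶ T.obj (W j), k ≫ T.map (f j) = q ≫ tensorProj T W' j ∧
      b ≫ T.map k = r j := fun j => hb _ _ _ (by rw [hr₁, T.map_comp, Category.assoc])
  choose k hk hku using hk
  refine ⟨b ≫ T.map (tensorLift k), ⟨?_, fun j => ?_⟩, ?_⟩
  · rw [Category.assoc, ← T.map_comp]
    congr 2
    exact tensor_hom_ext fun j => by rw [tensorLift_map, tensorLift_proj, (hk j).1]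
  · rw [Category.assoc, ← T.map_comp_assoc, tensorLift_proj, ← Category.assoc, (hk j).2, hr₂]
  · rintro s ⟨hs₁, hs₂⟩
    -- Any other solution also factors through `b`. Its components are recognized by the uniqueness
    -- of `k j`, tested in the pullback of `T.μ`.
    obtain ⟨k', ⟨hk₁, rfl⟩, -⟩ := hb _ _ s hs₁
    congr 2
    refine tensor_hom_ext fun j => ?_
    rw [tensorLift_proj]
    refine hku j _ ⟨?_, ?_⟩
    · rw [← hk₁, Category.assoc, Category.assoc, tensor_map_proj]
    · refine (hp j).hom_ext ?_ ?_
      · rw [hr₁, ← hk₁]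
        simp only [Category.assoc, ← T.map_comp, tensor_map_proj]
      · rw [hr₂, ← hs₂ j]
        simp only [Category.assoc, T.map_comp]

/-- The elements of the summands of `T (Γ (T^×) X)` are uniquely lifted along morphisms of enriched
graphs, compatibly with the multiplication. -/
theorem Nested.existsUnique_lift {X Y : EGraph V} (f : X ⟶ Y) (i : ι) (a b : X.Obj)
    (k' : Nested T Y (G i) (f.obj a) (f.obj b)) (P : Chain (THom T X (G i)) a b)
    (h : P.map (H' := THom T Y (G i)) f.obj (fun a b t => t ≫ T.map (f.map a b)) = k'.parse) :
    ∃! k : Nested T X (G i) a b, k.map f = k' ∧ k.parse = P := by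
  obtain ⟨⟨p, t⟩, rfl⟩ := Chain.ofPath_surjective P
  obtain ⟨p', s'⟩ := k'
  dsimp only [Nested.parse] at h
  rw [Chain.map_ofPath] at h
  obtain ⟨rfl, h₁⟩ := Sigma.mk.inj_iff.1 (Chain.ofPath_injective (H := THom T Y (G i))
    (a₁ := ⟨_, _⟩) (a₂ := ⟨_, _⟩) h)
  have h₂ := fun j => congrFun (eq_of_heq h₁) j
  obtain ⟨s, ⟨hs₁, hs₂⟩, hsu⟩ := existsUnique_tensor hT hμ
    (W := p.homs X) (W' := (p.map f.obj).homs Y)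
    (fun j => f.map (p.vert j.castSucc) (p.vert j.succ)) i s' t h₂
  refine ⟨⟨p, s⟩, ⟨Sigma.ext rfl (heq_of_eq hs₁), ?_⟩, ?_⟩
  · exact congrArg (Chain.ofPath (H := THom T X (G i)) p) (funext hs₂)
  · rintro ⟨q, s₂⟩ ⟨hq₁, hq₂⟩
    obtain ⟨rfl, h₃⟩ := Sigma.mk.inj_iff.1 (Chain.ofPath_injective (H := THom T X (G i))
      (a₁ := ⟨_, _⟩) (a₂ := ⟨_, _⟩) hq₂)
    refine Sigma.ext rfl (heq_of_eq (hsu _ ⟨?_, fun j => congrFun (eq_of_heq h₃) j⟩))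
    exact eq_of_heq (Sigma.mk.inj_iff.1 hq₁).2

end Cells

/-! ### The unit and the multiplication of `Γ (T^×)` are cartesian -/

section Cartesian

variable {V : Type (u + 1)} [LargeCategory.{u} V] [HasFiniteProducts V] [HasCoproducts.{u} V]
  {T : Monad V} {ι : Type u} {G : ι → V} (hG : CellFamily G)
  (hE : (timesMultitensor T).IsDistributive)

-- A cell of the pullback is a chain in `X` whose image has exactly one member. Mapping preserves
-- the length, so the chain itself has one member, and the question reduces to the naturality square
-- of `T.η` at a hom map.
include hG in
theorem gamma_η_equifibered (hη : NatTrans.Equifibered T.η) :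
    NatTrans.Equifibered (Multitensor.gamma hE).η := by
  intro X Y f
  refine EGraph.isPullback_of_hom f ((timesMultitensor T).gammaUnitHom X)
    ((timesMultitensor T).gammaUnitHom Y) (Multitensor.gammaMapHom f) fun a b => ?_
  refine hG.isPullback (Multitensor.gammaUnitHom_naturality f a b) fun i x y h => ?_
  obtain ⟨P, rfl⟩ := (el_bijective hG i X a b).2 y
  rw [comp_unitHom, el_mapHom] at h
  have h₁ := (el_bijective hG i Y _ _).1 h
  obtain ⟨e, rfl⟩ := Chain.exists_single P (by
    rw [← Chain.length_map (H' := THom T Y (G i)) f.obj (fun a b t => t ≫ T.map (f.map a b)), ← h₁]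
    rfl)
  have h₂ := Chain.single_injective h₁
  have hp : IsPullback (f.map a b) (T.η.app _) (T.η.app _) (T.map (f.map a b)) := hη (f.map a b)
  refine ⟨hp.lift x e h₂, ⟨hp.lift_fst _ _ _, ?_⟩, ?_⟩
  · rw [comp_unitHom, hp.lift_snd]
  · rintro z ⟨hz₁, hz₂⟩
    rw [comp_unitHom] at hz₂
    have h₃ := Chain.single_injective ((el_bijective hG i X _ _).1 hz₂)
    refine hp.hom_ext (by rw [hz₁, hp.lift_fst]) (by rw [h₃, hp.lift_snd])

/-- The image of a morphism of enriched graphs under `Γ (T^×)`. -/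
@[reducible] def timesGammaMap (T : Monad V) {X Y : EGraph V} (f : X ⟶ Y) :
    timesGamma T X ⟶ timesGamma T Y :=
  EGraph.Hom.mk (X := timesGamma T X) (Y := timesGamma T Y) f.obj (Multitensor.gammaMapHom f)

-- On cells, everything is about chains: since `T` preserves coproducts, a cell of the twofold
-- application is a unique chain of `Nested` elements, and the multiplication parses its members and
-- joins them. Unique lifting for chains follows by `Chain.existsUnique_join` from unique lifting
-- for members, `Nested.existsUnique_lift`.
include hG in
theorem isPullback_gammaMulHom (hTc : PreservesCoproducts T.toFunctor)
    (hT : HasGenericFactorizations G T.toFunctor) (hμ : NatTrans.Equifibered T.μ) {X Y : EGraph V}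
    (f : X ⟶ Y) (a b : X.Obj) :
    IsPullback (Multitensor.gammaMapHom (timesGammaMap T f) a b) (Multitensor.gammaMulHom hE X a b)
      (Multitensor.gammaMulHom hE Y (f.obj a) (f.obj b)) (Multitensor.gammaMapHom f a b) := by
  have key : ∀ i (R : Chain (Nested T X (G i)) a b),
      el (R.hmap (K := THom T (timesGamma T X) (G i)) Nested.incl) ≫
        Multitensor.gammaMapHom (timesGammaMap T f) a b =
      el (X := timesGamma T Y) ((R.map (H' := Nested T Y (G i)) f.obj fun a b s => s.map f).hmap
        (K := THom T (timesGamma T Y) (G i)) Nested.incl) := fun i R => by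
    refine (el_mapHom (timesGammaMap T f) _).trans ?_
    rw [Chain.map_hmap, Chain.hmap_map]
    refine congrArg el ?_
    exact Chain.map_congr f.obj (fun a b s => (Nested.incl_map f s).symm) R
  have hbij : ∀ i (Y : EGraph V) (a b : Y.Obj),
      Function.Bijective fun R : Chain (Nested T Y (G i)) a b =>
        el (R.hmap (K := THom T (timesGamma T Y) (G i)) Nested.incl) := fun i Y a b =>
    (el_bijective hG i (timesGamma T Y) a b).comp
      (Chain.hmap_bijective (fun a b => Nested.incl_bijective hG hTc i Y a b) a b)
  refine hG.isPullback (Multitensor.gammaMulHom_naturality hE f a b) fun i x y h => ?_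
  obtain ⟨P, rfl⟩ := (el_bijective hG i X a b).2 y
  obtain ⟨Q, rfl⟩ := (hbij i Y _ _).2 x
  dsimp only at h
  rw [el_mulHom, el_mapHom] at h
  have h₁ := (el_bijective hG i Y _ _).1 h
  obtain ⟨R, ⟨hR₁, hR₂⟩, hRu⟩ := Chain.existsUnique_join f.obj
    (H := THom T X (G i)) (H' := THom T Y (G i)) (K := Nested T X (G i)) (K' := Nested T Y (G i))
    (fun a b t => t ≫ T.map (f.map a b)) (fun a b s => s.map f) Nested.parse Nested.parse
    (fun a b k => Nested.parse_map f k)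
    (fun a b k' P hP => Nested.existsUnique_lift hT hμ f i a b k' P hP) Q rfl P h₁.symm
  refine ⟨_, ⟨(key i R).trans (by rw [hR₁]; rfl), (el_mulHom hE R).trans (by rw [hR₂])⟩, ?_⟩
  rintro z ⟨hz₁, hz₂⟩
  obtain ⟨S, rfl⟩ := (hbij i X _ _).2 z
  refine congrArg (fun R : Chain (Nested T X (G i)) a b =>
    el (R.hmap (K := THom T (timesGamma T X) (G i)) Nested.incl)) (hRu S ⟨?_, ?_⟩)
  · exact (hbij i Y _ _).1 ((key i S).symm.trans hz₁)
  · exact (el_bijective hG i X _ _).1 ((el_mulHom hE S).symm.trans hz₂)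

include hG in
theorem gamma_μ_equifibered (hTc : PreservesCoproducts T.toFunctor)
    (hT : HasGenericFactorizations G T.toFunctor) (hμ : NatTrans.Equifibered T.μ) :
    NatTrans.Equifibered (Multitensor.gamma hE).μ := fun X Y f =>
  EGraph.isPullback_of_hom (timesGammaMap T (timesGammaMap T f))
    (Multitensor.gammaMulHom hE X) (Multitensor.gammaMulHom hE Y)
    (Multitensor.gammaMapHom f) fun a b => isPullback_gammaMulHom hG hE hTc hT hμ f a b

end Cartesian

/-! ### Generic factorizations for `Γ (T^×)` -/

section Wedge

variable {V : Type (u + 1)} [LargeCategory.{u} V] [HasCoproducts.{u} V]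

namespace EGraph

/-- The enriched graph with objects `0, …, n` freely generated by homs `B k` from `k` to `k + 1`. -/
def wedge {n : ℕ} (B : Fin n → V) : EGraph V where
  Obj := ULift.{u} (Fin (n + 1))
  hom i j := ∐ fun k : ULift.{u} { k : Fin n // k.castSucc = i.down ∧ k.succ = j.down } =>
    B k.down.1

variable {n : ℕ} {B : Fin n → V}

/-- The inclusions of the generating homs. -/
def wedgeInj (B : Fin n → V) (k : Fin n) : B k ⟶ (wedge B).hom ⟨k.castSucc⟩ ⟨k.succ⟩ :=
  Limits.Sigma.ι (fun k' : ULift.{u} { k' : Fin n // k'.castSucc = k.castSucc ∧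
    k'.succ = k.succ } => B k'.down.1) ⟨k, rfl, rfl⟩

/-- The morphism from a wedge given by a sequence of homs. -/
def wedgeHom {Y : EGraph V} (y : Fin (n + 1) → Y.Obj)
    (e : ∀ k, B k ⟶ Y.hom (y k.castSucc) (y k.succ)) : wedge B ⟶ Y :=
  Hom.mk (fun i => y i.down) fun _ _ => Limits.Sigma.desc fun k =>
    e k.down.1 ≫ Y.cast (congrArg y k.down.2.1) (congrArg y k.down.2.2)

theorem wedgeInj_map {Y : EGraph V} (y : Fin (n + 1) → Y.Obj)
    (e : ∀ k, B k ⟶ Y.hom (y k.castSucc) (y k.succ)) (k : Fin n) :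
    wedgeInj B k ≫ (wedgeHom y e).map ⟨k.castSucc⟩ ⟨k.succ⟩ = e k :=
  (Limits.Sigma.ι_desc _ _).trans (Category.comp_id _)

theorem wedgeHom_eta {Y : EGraph V} (f : wedge B ⟶ Y) :
    wedgeHom (fun i => f.obj ⟨i⟩) (fun k => wedgeInj B k ≫ f.map ⟨k.castSucc⟩ ⟨k.succ⟩) = f := by
  refine hom_ext (fun _ => rfl) ?_
  rintro ⟨i⟩ ⟨j⟩
  refine (Category.comp_id _).trans (Limits.Sigma.hom_ext _ _ ?_)
  rintro ⟨k, h₀, h₁⟩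
  obtain rfl : k.castSucc = i := h₀
  obtain rfl : k.succ = j := h₁
  exact (Limits.Sigma.ι_desc _ _).trans (Category.comp_id _)

theorem wedgeHom_comp {X Y : EGraph V} (x : Fin (n + 1) → X.Obj)
    (e : ∀ k, B k ⟶ X.hom (x k.castSucc) (x k.succ)) (f : X ⟶ Y) :
    wedgeHom x e ≫ f = wedgeHom (fun i => f.obj (x i)) fun k => e k ≫ f.map _ _ := by
  rw [← wedgeHom_eta (wedgeHom x e ≫ f)]
  exact congrArg (wedgeHom _) (funext fun k => (Category.assoc _ _ _).symm.trans
    (congrArg (· ≫ f.map _ _) (wedgeInj_map x e k)))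

theorem wedgeHom_injective {Y : EGraph V} {y : Fin (n + 1) → Y.Obj}
    {e e' : ∀ k, B k ⟶ Y.hom (y k.castSucc) (y k.succ)} (h : wedgeHom y e = wedgeHom y e') :
    e = e' := by
  funext k
  have h₁ := (congrArg (wedgeInj B k ≫ ·) (map_eq_of_eq h ⟨k.castSucc⟩ ⟨k.succ⟩)).trans
    (congrArg (wedgeInj B k ≫ ·) (Category.comp_id _))
  exact (wedgeInj_map y e k).symm.trans (h₁.trans (wedgeInj_map y e' k))

end EGraph

variable [HasFiniteProducts V] {T : Monad V} (hE : (timesMultitensor T).IsDistributive)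
  {ι : Type u} {G : ι → V} (hG : CellFamily G)

/-- The morphism from a suspension to `Γ (T^×) Y` given by a sequence of elements. -/
def seqHom [HasInitial V] {Z : V} {Y : EGraph V} (n : ℕ) (x : Fin (n + 1) → Y.Obj)
    (t : ∀ k : Fin n, Z ⟶ T.obj (Y.hom (x k.castSucc) (x k.succ))) :
    EGraph.susp Z ⟶ (Multitensor.gamma hE).obj Y :=
  EGraph.suspHom (Y := timesGamma T Y) (a := x 0) (b := x (Fin.last n))
    (el (Chain.ofSeq (H := THom T Y Z) n x t))

variable [HasInitial V]

theorem seqHom_map {Z : V} {X Y : EGraph V} (f : X ⟶ Y) (n : ℕ) (x : Fin (n + 1) → X.Obj)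
    (t : ∀ k : Fin n, Z ⟶ T.obj (X.hom (x k.castSucc) (x k.succ))) :
    seqHom hE n x t ≫ (Multitensor.gamma hE).map f =
      seqHom hE n (fun i => f.obj (x i)) fun k => t k ≫ T.map (f.map _ _) := by
  refine (EGraph.suspHom_comp _ (timesGammaMap T f)).trans ?_
  refine congrArg EGraph.suspHom ((el_mapHom f _).trans (congrArg el ?_))
  exact Chain.map_ofPath (H := THom T X Z) (H' := THom T Y Z) f.obj
    (fun a b t => t ≫ T.map (f.map a b)) ⟨n, x, rfl, rfl⟩ t

include hG

theorem seqHom_surjective (i : ι) {Y : EGraph V}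
    (y : EGraph.susp (G i) ⟶ (Multitensor.gamma hE).obj Y) : ∃ n x t, seqHom hE n x t = y := by
  rw [← EGraph.suspHom_eta y]
  obtain ⟨P, hP⟩ := (el_bijective hG i Y (y.obj ⟨false⟩) (y.obj ⟨true⟩)).2 (y.map ⟨false⟩ ⟨true⟩)
  rw [← hP]
  clear hP
  obtain ⟨⟨⟨n, x, h₀, h₁⟩, t⟩, rfl⟩ := Chain.ofPath_surjective P
  refine ⟨n, x, t, ?_⟩
  revert t h₀ h₁
  generalize y.obj ⟨false⟩ = a
  generalize y.obj ⟨true⟩ = b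
  rintro rfl rfl t
  rfl

theorem suspHom_el_injective (i : ι) {Y : EGraph V} {a b a' b' : Y.Obj}
    {P : Chain (THom T Y (G i)) a b} {P' : Chain (THom T Y (G i)) a' b'}
    (h : (EGraph.suspHom (Y := timesGamma T Y) (a := a) (b := b) (el P)) =
      EGraph.suspHom (Y := timesGamma T Y) (a := a') (b := b') (el P')) :
    ∃ (h₀ : a = a') (h₁ : b = b'), P.cast h₀ h₁ = P' := by
  have h' := EGraph.suspHom_injective h
  obtain ⟨rfl, h'⟩ := Sigma.mk.inj_iff.1 h'
  obtain ⟨rfl, h'⟩ := Sigma.mk.inj_iff.1 (eq_of_heq h')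
  exact ⟨rfl, rfl, (el_bijective hG i Y _ _).1 (eq_of_heq h')⟩

/-- By `el_bijective` the cell determines its chain, hence the sequence. Equality in the total space
allows length, vertices and members to be compared successively. -/
theorem seqHom_injective (i : ι) {Y : EGraph V} {n : ℕ} {x : Fin (n + 1) → Y.Obj}
    {t : ∀ k : Fin n, G i ⟶ T.obj (Y.hom (x k.castSucc) (x k.succ))} {n' : ℕ}
    {x' : Fin (n' + 1) → Y.Obj} {t' : ∀ k : Fin n', G i ⟶ T.obj (Y.hom (x' k.castSucc) (x' k.succ))}
    (h : seqHom hE n x t = seqHom hE n' x' t') :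
    (⟨n, x, t⟩ : Σ (n : ℕ) (x : Fin (n + 1) → Y.Obj),
      ∀ k : Fin n, G i ⟶ T.obj (Y.hom (x k.castSucc) (x k.succ))) = ⟨n', x', t'⟩ := by
  obtain ⟨h₀, h₁, h⟩ := suspHom_el_injective hG i h
  have := Chain.ofPath_injective (H := THom T Y (G i)) (a₁ := ⟨⟨n, x, h₀, h₁⟩, t⟩)
    (a₂ := ⟨⟨n', x', rfl, rfl⟩, t'⟩) h
  cases this
  rfl

/-- A suspended cell of `Γ (T^×) X` is a sequence of cells `t k` of T applied to homs of `X`. If `b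
k`, from the cell to T(B k), is generic for `t k`, then the sequence of the `b k` in the wedge of
the `B k` is generic for the whole, since morphisms out of a wedge are sequences of maps out of the
`B k`. -/
theorem gamma_hasGenericFactorizations (hT : HasGenericFactorizations G T.toFunctor) :
    HasGenericFactorizations (EGraph.cells G) (Multitensor.gamma hE).toFunctor := by
  rintro (_ | i) X x
  -- `Γ (T^×)` does not change objects, so the point itself is the generic object for a point.
  · obtain ⟨x, rfl⟩ := EGraph.ptHom_surjective x
    refine ⟨EGraph.pt V, EGraph.ptHom (Y := (Multitensor.gamma hE).obj (EGraph.pt V)) PUnit.unit,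
      EGraph.ptHom (Y := X) x, EGraph.pt_hom_ext rfl, ?_, ?_⟩
    · intro Y Z g h y hy
      refine ⟨EGraph.ptHom (Y := Y) (y.obj PUnit.unit), ⟨EGraph.pt_hom_ext ?_,
        EGraph.pt_hom_ext rfl⟩, ?_⟩
      · exact congrArg (fun f : EGraph.pt V ⟶ (Multitensor.gamma hE).obj Z =>
          f.obj PUnit.unit) hy
      · rintro k ⟨-, rfl⟩
        exact EGraph.pt_hom_ext rfl
    · exact fun j => (EGraph.cellFamily_cells hG).finite_hom j none
  · obtain ⟨n, x, t, rfl⟩ := seqHom_surjective hE hG i x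
    have := fun k => hT (t k)
    choose B b q hq hb hf using this
    let β : EGraph.susp (G i) ⟶ (Multitensor.gamma hE).obj (EGraph.wedge B) :=
      seqHom hE n ULift.up fun k => b k ≫ T.map (EGraph.wedgeInj B k)
    have hβ : ∀ {Y : EGraph V} (y : Fin (n + 1) → Y.Obj)
        (e : ∀ k, B k ⟶ Y.hom (y k.castSucc) (y k.succ)),
        β ≫ (Multitensor.gamma hE).map (EGraph.wedgeHom y e) =
          seqHom hE n y fun k => b k ≫ T.map (e k) := fun y e => by
      refine (seqHom_map hE _ _ _ _).trans ?_
      refine congrArg (seqHom hE n y) (funext fun k => ?_)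
      rw [Category.assoc, ← T.map_comp, EGraph.wedgeInj_map]
      rfl
    refine ⟨EGraph.wedge B, β, EGraph.wedgeHom x q, ?_, ?_, ?_⟩
    · refine (hβ x q).trans ?_
      exact congrArg (seqHom hE n x) (funext hq)
    · intro Y Z g h y hy
      obtain ⟨n', y, s, rfl⟩ := seqHom_surjective hE hG i y
      obtain ⟨z, e, rfl⟩ : ∃ z e, EGraph.wedgeHom z e = h := ⟨_, _, EGraph.wedgeHom_eta h⟩
      -- Comparing sequences in `Γ (T^×) Z` forces `y` to have length `n` and vertices lying over
      -- `z`; its members are then lifted one at a time by genericity of `b k`.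
      have hy' := hy.trans (hβ z e)
      obtain ⟨rfl, h₁⟩ := Sigma.mk.inj_iff.1 (seqHom_injective hE hG i
        ((seqHom_map hE g _ _ _).symm.trans hy'))
      obtain ⟨rfl, h₂⟩ := Sigma.mk.inj_iff.1 (eq_of_heq h₁)
      have h₃ := fun k => hb k _ _ _ (congrFun (eq_of_heq h₂) k)
      choose r hr hru using h₃
      refine ⟨EGraph.wedgeHom y r, ⟨?_, ?_⟩, ?_⟩
      · rw [EGraph.wedgeHom_comp]
        exact congrArg (EGraph.wedgeHom _) (funext fun k => (hr k).1)
      · exact (hβ y r).trans (congrArg (seqHom hE _ y) (funext fun k => (hr k).2))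
      · rintro k ⟨hk₁, hk₂⟩
        obtain ⟨y', r', rfl⟩ : ∃ z e, EGraph.wedgeHom z e = k := ⟨_, _, EGraph.wedgeHom_eta k⟩
        obtain ⟨-, h₄⟩ := Sigma.mk.inj_iff.1 (seqHom_injective hE hG i ((hβ y' r').symm.trans hk₂))
        obtain ⟨rfl, h₅⟩ := Sigma.mk.inj_iff.1 (eq_of_heq h₄)
        rw [EGraph.wedgeHom_comp] at hk₁
        exact congrArg (EGraph.wedgeHom _) (funext fun k => hru k _
          ⟨congrFun (EGraph.wedgeHom_injective hk₁) k, congrFun (eq_of_heq h₅) k⟩)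
    -- A cell of a hom of the wedge lies in one of finitely many summands `B k`, each of which has
    -- finitely many cells.
    · have : Finite (EGraph.wedge B).Obj := inferInstanceAs (Finite (ULift (Fin (n + 1))))
      refine EGraph.finite_cells_hom (Y := EGraph.wedge B) fun j x y => ?_
      have := fun k => hf k j
      exact Finite.of_surjective _ (hG.bijective_cofan j _ ⟨coproductIsCoproduct
        fun k : ULift.{u} { k : Fin n // k.castSucc = x.down ∧ k.succ = y.down } => B k.down.1⟩).2

end Wedge

/-! ### Compositions of generalized elements of algebras -/

section Compositions

variable {V : Type (u + 1)} [LargeCategory.{u} V] {T : Monad V} {O : Type u}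

/-- The generalized elements of a family of algebras. -/
abbrev AlgHom (X : O → O → T.Algebra) (Z : V) (a b : O) : Type u := Z ⟶ (X a b).A

/-- The structure of a category on the generalized elements of a family of `T`-algebras, natural
in the stage of definition and compatible with the actions of `T`. -/
structure HomOps (X : O → O → T.Algebra) where
  one (Z : V) (a : O) : AlgHom X Z a a
  mul {Z : V} {a b c : O} (x : AlgHom X Z a b) (y : AlgHom X Z b c) : AlgHom X Z a c
  one_mul {Z : V} {a b : O} (x : AlgHom X Z a b) : mul (one Z a) x = x
  mul_one {Z : V} {a b : O} (x : AlgHom X Z a b) : mul x (one Z b) = x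
  mul_assoc {Z : V} {a b c d : O} (x : AlgHom X Z a b) (y : AlgHom X Z b c) (z : AlgHom X Z c d) :
    mul (mul x y) z = mul x (mul y z)
  comp_one {Z Z' : V} (z : Z' ⟶ Z) (a : O) : z ≫ one Z a = one Z' a
  comp_mul {Z Z' : V} (z : Z' ⟶ Z) {a b c : O} (x : AlgHom X Z a b) (y : AlgHom X Z b c) :
    z ≫ mul x y = mul (z ≫ x) (z ≫ y)
  map_one (Z : V) (a : O) : T.map (one Z a) ≫ (X a a).a = one (T.obj Z) a
  map_mul {Z : V} {a b c : O} (x : AlgHom X Z a b) (y : AlgHom X Z b c) :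
    T.map (mul x y) ≫ (X a c).a = mul (T.map x ≫ (X a b).a) (T.map y ≫ (X b c).a)

namespace HomOps

variable {X : O → O → T.Algebra} (S : HomOps X)

/-- The composite of a chain. -/
def fold {Z : V} {a : O} : ∀ {b : O}, Chain (AlgHom X Z) a b → AlgHom X Z a b
  | _, .nil => S.one Z a
  | _, .cons P e => S.mul (fold P) e

theorem fold_single {Z : V} {a b : O} (x : AlgHom X Z a b) : S.fold (Chain.single x) = x :=
  S.one_mul x

theorem fold_comp {Z : V} {a b c : O} (P : Chain (AlgHom X Z) a b) (Q : Chain (AlgHom X Z) b c) :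
    S.fold (P.comp Q) = S.mul (S.fold P) (S.fold Q) := by
  induction Q with
  | nil => exact (S.mul_one _).symm
  | cons Q e ih => exact (congrArg (S.mul · e) ih).trans (S.mul_assoc _ _ _)

theorem fold_join {Z : V} {a b : O} (P : Chain (Chain (AlgHom X Z)) a b) :
    S.fold P.join = S.fold (P.hmap (K := AlgHom X Z) S.fold) := by
  induction P with
  | nil => rfl
  | cons P Q ih => exact (S.fold_comp _ _).trans (congrArg (S.mul · _) ih)

theorem comp_fold {Z Z' : V} (z : Z' ⟶ Z) {a b : O} (P : Chain (AlgHom X Z) a b) :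
    z ≫ S.fold P = S.fold (P.hmap (K := AlgHom X Z') fun {_ _} x => z ≫ x) := by
  induction P with
  | nil => exact S.comp_one z a
  | cons P e ih => exact (S.comp_mul _ _ _).trans (congrArg (S.mul · _) ih)

theorem map_fold {Z : V} {a b : O} (P : Chain (AlgHom X Z) a b) :
    T.map (S.fold P) ≫ (X a b).a =
      S.fold (P.hmap (K := AlgHom X (T.obj Z)) fun {a b} x => T.map x ≫ (X a b).a) := by
  induction P with
  | nil => exact S.map_one Z a
  | cons P e ih => exact (S.map_mul _ _).trans (congrArg (S.mul · _) ih)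

/-- Families of algebra morphisms which preserve identities and composites. -/
structure IsHom {O' : Type u} {X' : O' → O' → T.Algebra} (S : HomOps X) (S' : HomOps X')
    (f : O → O') (φ : ∀ a b, X a b ⟶ X' (f a) (f b)) : Prop where
  one (Z : V) (a : O) : S.one Z a ≫ (φ a a).f = S'.one Z (f a)
  mul {Z : V} {a b c : O} (x : AlgHom X Z a b) (y : AlgHom X Z b c) :
    S.mul x y ≫ (φ a c).f = S'.mul (x ≫ (φ a b).f) (y ≫ (φ b c).f)

variable {S} in
theorem IsHom.fold {O' : Type u} {X' : O' → O' → T.Algebra} {S' : HomOps X'} {f : O → O'}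
    {φ : ∀ a b, X a b ⟶ X' (f a) (f b)} (h : IsHom S S' f φ) {Z : V} {a b : O}
    (P : Chain (AlgHom X Z) a b) :
    S.fold P ≫ (φ a b).f =
      S'.fold (P.map (H' := AlgHom X' Z) f fun a b x => x ≫ (φ a b).f) := by
  induction P with
  | nil => exact h.one Z a
  | cons P e ih => exact (h.mul _ _).trans (congrArg (S'.mul · _) ih)

end HomOps

/-- The underlying enriched graph of a family of algebras. -/
@[reducible] def algGraph (X : O → O → T.Algebra) : EGraph V where
  Obj := O
  hom a b := (X a b).A

end Compositions

/-! ### The algebra of `Γ (T^×)` given by a family of algebras with compositions -/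

section GammaAlgebra

variable {V : Type (u + 1)} [LargeCategory.{u} V] [HasFiniteProducts V] [HasCoproducts.{u} V]
  {T : Monad V} {O : Type u} (hE : (timesMultitensor T).IsDistributive)

namespace HomOps

variable {X : O → O → T.Algebra} (S : HomOps X)

/-- The action of `Γ (T^×)` given by composition. -/
def act (a b : O) : (timesMultitensor T).gammaHom (algGraph X) a b ⟶ (X a b).A :=
  Multitensor.gammaDesc fun p => S.fold (Chain.ofPath (H := AlgHom X _) p fun i =>
    tensorProj T (p.homs (algGraph X)) i ≫ (X _ _).a)

theorem el_act {Z : V} {a b : O} (P : Chain (THom T (algGraph X) Z) a b) :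
    el P ≫ S.act a b = S.fold (P.hmap (K := AlgHom X Z) fun {a b} t => t ≫ (X a b).a) := by
  obtain ⟨⟨p, t⟩, rfl⟩ := Chain.ofPath_surjective P
  dsimp only
  rw [Chain.hmap_ofPath, el_ofPath, act, Category.assoc, Multitensor.inc_desc, comp_fold,
    Chain.hmap_ofPath]
  refine congrArg S.fold (congrArg (Chain.ofPath p) (funext fun i => ?_))
  exact tensorLift_proj_assoc _ _ _

theorem unit_act (a b : O) :
    (timesMultitensor T).gammaUnitHom (algGraph X) a b ≫ S.act a b = 𝟙 _ := by
  have h := comp_unitHom (T := T) (X := algGraph X) (𝟙 (X a b).A)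
  rw [← Category.id_comp ((timesMultitensor T).gammaUnitHom (algGraph X) a b), h, el_act]
  refine (S.fold_single _).trans ?_
  rw [Category.id_comp]
  exact (X a b).unit

/-- `map_fold` moves `T` and its action inside the composite; in each member the associativity law
of the algebra then turns two successive actions into `T.μ` followed by one. -/
theorem incl_act {Z : V} {a b : O} (s : Nested T (algGraph X) Z a b) :
    (s.incl ≫ T.map (S.act a b)) ≫ (X a b).a =
      S.fold (s.parse.hmap (K := AlgHom X Z) fun {a b} t => t ≫ (X a b).a) := by
  obtain ⟨p, r⟩ := s
  unfold Nested.incl Nested.parse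
  rw [Chain.hmap_ofPath]
  simp only [Category.assoc, ← T.map_comp_assoc]
  rw [act, Multitensor.inc_desc, map_fold, comp_fold, Chain.hmap_ofPath, Chain.hmap_ofPath]
  refine congrArg S.fold (congrArg (Chain.ofPath p) (funext fun j => ?_))
  have h := (X (p.vert j.castSucc) (p.vert j.succ)).assoc
  rw [T.map_comp, Category.assoc, ← h]

/-- The action of `Γ (T^×)` given by composition, as a morphism of enriched graphs. -/
@[reducible] def actHom : timesGamma T (algGraph X) ⟶ algGraph X :=
  EGraph.Hom.mk (X := timesGamma T (algGraph X)) (Y := algGraph X) (fun a => a) S.act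

/-- On chains of `Nested` elements, one side composes the joined chain and the other composes the
composites of the members. These agree by `fold_join`, with `incl_act` computing the composite of
each member. -/
theorem mul_act (a b : O) :
    Multitensor.gammaMulHom hE (algGraph X) a b ≫ S.act a b =
      Multitensor.gammaMapHom S.actHom a b ≫ S.act a b := by
  refine gamma₂_ext_el hE fun Z P => ?_
  refine (Category.assoc _ _ _).symm.trans
    ((congrArg (· ≫ S.act a b) (el_mulHom hE P)).trans ((S.el_act _).trans ?_))
  rw [← Category.assoc]
  refine Eq.trans ?_ (congrArg (· ≫ S.act a b) (el_mapHom S.actHom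
    (P.hmap (K := THom T (timesGamma T (algGraph X)) Z) Nested.incl)).symm)
  refine Eq.trans ?_ (S.el_act _).symm
  rw [Chain.hmap_join, fold_join, Chain.hmap_hmap, Chain.hmap_hmap, Chain.map_hmap]
  refine Eq.trans ?_ (congrArg S.fold (Chain.hmap_map (fun a => a) _ _ _).symm)
  refine congrArg S.fold ?_
  induction P with
  | nil => rfl
  | cons P e ih => exact congrArg₂ Chain.cons ih (S.incl_act e).symm

/-- The algebra of `Γ (T^×)` given by a family of algebras with compositions. -/
def algebra : (Multitensor.gamma hE).Algebra where
  A := algGraph X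
  a := S.actHom
  unit := EGraph.mk_ext S.unit_act
  assoc := EGraph.mk_ext (S.mul_act hE)

variable {S} {O' : Type u} {X' : O' → O' → T.Algebra} {S' : HomOps X'} {f : O → O'}
  {φ : ∀ a b, X a b ⟶ X' (f a) (f b)}

theorem IsHom.act (h : IsHom S S' f φ) (a b : O) :
    Multitensor.gammaMapHom (X := algGraph X) (Y := algGraph X')
      (EGraph.Hom.mk (X := algGraph X) (Y := algGraph X') f fun a b => (φ a b).f) a b ≫
        S'.act (f a) (f b) = S.act a b ≫ (φ a b).f := by
  refine gammaHom_ext_el fun Z P => ?_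
  rw [← Category.assoc, ← Category.assoc, el_act, h.fold]
  refine (congrArg (· ≫ S'.act (f a) (f b)) (el_mapHom (X := algGraph X)
    (Y := algGraph X') _ _)).trans ?_
  refine (S'.el_act _).trans (congrArg S'.fold ?_)
  rw [Chain.map_hmap]
  refine (Chain.hmap_map f _ _ _).trans (Chain.map_congr f (fun a b e => ?_) P)
  rw [Category.assoc, Category.assoc]
  exact congrArg (e ≫ ·) (φ a b).h

/-- The morphism of algebras of `Γ (T^×)` given by a morphism of families. -/
def IsHom.algebraHom (h : IsHom S S' f φ) : S.algebra hE ⟶ S'.algebra hE where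
  f := EGraph.Hom.mk (X := algGraph X) (Y := algGraph X') f fun a b => (φ a b).f
  h := EGraph.mk_ext h.act

end HomOps

end GammaAlgebra

/-! ### Algebras of `Γ (T^×)` come from families of algebras with compositions -/

section GammaAlgebra

variable {V : Type (u + 1)} [LargeCategory.{u} V] [HasFiniteProducts V] [HasCoproducts.{u} V]
  {T : Monad V} (hE : (timesMultitensor T).IsDistributive)

/-- A morphism of algebras commutes with the evaluation of all chains (`key`). One-member chains
show that its hom maps are morphisms of T-algebras, the empty chain gives preservation of
identities, and two-member chains of units of `T` give preservation of composites. -/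
theorem HomOps.exists_isHom {O O' : Type u} {X : O → O → T.Algebra} {X' : O' → O' → T.Algebra}
    {S : HomOps X} {S' : HomOps X'} (g : S.algebra hE ⟶ S'.algebra hE) :
    ∃ (f : O → O') (φ : ∀ a b, X a b ⟶ X' (f a) (f b)) (h : HomOps.IsHom S S' f φ),
      h.algebraHom hE = g := by
  obtain ⟨⟨f, ψ⟩, h⟩ := g
  change ∀ a b, (X a b).A ⟶ (X' (f a) (f b)).A at ψ
  let q : algGraph X ⟶ algGraph X' := EGraph.Hom.mk (X := algGraph X) (Y := algGraph X') f ψ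
  have h' : ∀ a b, Multitensor.gammaMapHom q a b ≫ S'.act (f a) (f b) = S.act a b ≫ ψ a b :=
    fun a b => (EGraph.map_eq_of_eq h a b).trans (Category.comp_id _)
  have key : ∀ {Z : V} {a b : O} (P : Chain (THom T (algGraph X) Z) a b),
      S.fold (P.hmap (K := AlgHom X Z) fun {a b} t => t ≫ (X a b).a) ≫ ψ a b =
        S'.fold (P.map (H' := AlgHom X' Z) f fun a b t =>
          t ≫ T.map (ψ a b) ≫ (X' (f a) (f b)).a) := fun {Z a b} P => by
    rw [← el_act, Category.assoc, ← h', ← Category.assoc]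
    refine (congrArg (· ≫ S'.act (f a) (f b)) (el_mapHom q P)).trans ((S'.el_act _).trans ?_)
    refine congrArg S'.fold ((Chain.hmap_map f _ _ _).trans (Chain.map_congr f ?_ P))
    exact fun a b e => Category.assoc _ _ _
  have hψ : ∀ a b, T.map (ψ a b) ≫ (X' (f a) (f b)).a = (X a b).a ≫ ψ a b := fun a b => by
    have h₁ := key (Chain.single (H := THom T (algGraph X) (T.obj (X a b).A)) (𝟙 _))
    replace h₁ := (congrArg (· ≫ ψ a b) (S.fold_single _)).symm.trans
      (h₁.trans (S'.fold_single _))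
    simpa using h₁.symm
  refine ⟨f, fun a b => ⟨ψ a b, hψ a b⟩, ⟨fun Z a => key (Chain.nil : Chain (THom T (algGraph X) Z) a a), fun {Z a b c} x y => ?_⟩, rfl⟩
  have hη : ∀ {a b : O} (x : Z ⟶ (X a b).A), (x ≫ T.η.app _) ≫ (X a b).a = x := fun x => by
    rw [Category.assoc, (X _ _).unit, Category.comp_id]
  have h₂ := key (Chain.cons (Chain.single (H := THom T (algGraph X) Z) (x ≫ T.η.app (X a b).A))
    (y ≫ T.η.app (X b c).A))
  simp only [Chain.hmap, Chain.map, HomOps.fold, hη, HomOps.one_mul, hψ] at h₂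
  simp only [← Category.assoc, hη] at h₂
  exact h₂.trans (congrArg (S'.mul · _) (S'.one_mul _))

/-! ### Recovering T-actions and compositions from an action on chains -/

/-- An action of `Γ (T^×)` on an enriched graph which is the identity on objects. -/
structure GammaAction (A : EGraph V) where
  act : ∀ a b : A.Obj, (timesMultitensor T).gammaHom A a b ⟶ A.hom a b
  unit : ∀ a b, (timesMultitensor T).gammaUnitHom A a b ≫ act a b = 𝟙 _
  mul : ∀ a b, Multitensor.gammaMulHom hE A a b ≫ act a b =
    Multitensor.gammaMapHom (X := timesGamma T A) (Y := A)
      (EGraph.Hom.mk (X := timesGamma T A) (Y := A) (fun a => a) act) a b ≫ act a b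

namespace GammaAction

variable {hE} {A : EGraph V} (S : GammaAction hE A)

/-- The value of the action at a chain of generalized elements. -/
def ev {Z : V} {a b : A.Obj} (P : Chain (THom T A Z) a b) : Z ⟶ A.hom a b :=
  el P ≫ S.act a b

theorem comp_ev {Z Z' : V} (z : Z' ⟶ Z) {a b : A.Obj} (P : Chain (THom T A Z) a b) :
    z ≫ S.ev P = S.ev (P.hmap (K := THom T A Z') fun {_ _} t => z ≫ t) := by
  rw [ev, ← Category.assoc, comp_el, ev]

theorem ev_single_unit {Z : V} {a b : A.Obj} (x : Z ⟶ A.hom a b) :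
    S.ev (Chain.single (H := THom T A Z) (x ≫ T.η.app _)) = x := by
  rw [ev, ← comp_unitHom, Category.assoc, S.unit, Category.comp_id]

/-- This is the associativity law of the action read on elements: parsing the members and
concatenating has the same value as first acting on every member. -/
theorem ev_nested {Z : V} {a b : A.Obj} (P : Chain (Nested T A Z) a b) :
    S.ev (P.hmap (K := Chain (THom T A Z)) Nested.parse).join =
      S.ev (P.hmap (K := THom T A Z) fun {a b} s => s.incl ≫ T.map (S.act a b)) := by
  rw [ev, ← el_mulHom hE, Category.assoc, S.mul, ← Category.assoc]
  refine (congrArg (· ≫ S.act a b) (el_mapHom (EGraph.Hom.mk (X := timesGamma T A) (Y := A)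
    (fun a => a) S.act) (P.hmap (K := THom T (timesGamma T A) Z) Nested.incl))).trans ?_
  rw [Chain.map_hmap]
  refine congrArg S.ev ?_
  induction P with
  | nil => rfl
  | cons P e ih => exact congrArg (Chain.cons · _) ih

/-- Each inner chain becomes a `Nested` element through the unit of `T`, and parsing that element
cancels the unit against `T.μ`; the rest is `ev_nested`. -/
theorem ev_join {Z : V} {a b : A.Obj} (P : Chain (Chain (THom T A Z)) a b) :
    S.ev P.join = S.ev (P.hmap (K := THom T A Z) fun {_ _} Q => S.ev Q ≫ T.η.app _) := by
  have h : ∀ {a b : A.Obj} (Q : Chain (THom T A Z) a b), ∃ s : Nested T A Z a b,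
      s.parse = Q ∧ s.incl ≫ T.map (S.act a b) = S.ev Q ≫ T.η.app _ := fun {a b} Q => by
    obtain ⟨⟨p, t⟩, rfl⟩ := Chain.ofPath_surjective Q
    refine ⟨⟨p, tensorLift t ≫ T.η.app (((timesMultitensor T).tensor p.len).obj (p.homs A))⟩,
      ?_, ?_⟩
    · refine congrArg (Chain.ofPath (H := THom T A Z) p) (funext fun j => ?_)
      have h := T.η.naturality (tensorProj T (p.homs A) j)
      simp only [Functor.id_map] at h
      change (tensorLift t ≫ T.η.app (((timesMultitensor T).tensor p.len).obj (p.homs A))) ≫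
        T.map (tensorProj T (p.homs A) j) ≫ T.μ.app (p.homs A j) = t j
      rw [Category.assoc, ← Category.assoc (T.η.app _), ← h, Category.assoc, T.left_unit,
        Category.comp_id, tensorLift_proj]
    · dsimp only [Nested.incl]
      rw [ev, el_ofPath, Category.assoc, Category.assoc, ← T.map_comp, Category.assoc,
        Category.assoc]
      exact congrArg (tensorLift t ≫ ·) ((T.η.naturality _).symm.trans (Category.assoc _ _ _))
  choose nest h₁ h₂ using @h
  have h := S.ev_nested (P.hmap (K := Nested T A Z) nest)
  rw [Chain.hmap_hmap, Chain.hmap_hmap, Chain.hmap_id fun a b Q => h₁ Q, Chain.hmap_congr fun a b Q => h₂ Q] at h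
  exact h

/-- The action of `T` on a hom. -/
def algHom (a b : A.Obj) : T.obj (A.hom a b) ⟶ A.hom a b :=
  S.ev (Chain.single (H := THom T A _) (𝟙 _))

theorem ev_single {Z : V} {a b : A.Obj} (t : Z ⟶ T.obj (A.hom a b)) :
    S.ev (Chain.single (H := THom T A Z) t) = t ≫ S.algHom a b := by
  rw [algHom, comp_ev]
  simp [Chain.hmap]

/-- `ev_nested` is applied to a chain with one member, made from `s` and `T` of the tuple `Q`. The
case of a single identity is the associativity of `algHom`; in general it makes evaluation
compatible with `T`. -/
theorem ev_hmap_map {Z W : V} (s : Z ⟶ T.obj W) {a b : A.Obj} (Q : Chain (THom T A W) a b) :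
    S.ev (Q.hmap (K := THom T A Z) fun {_ _} q => s ≫ T.map q ≫ T.μ.app _) =
      s ≫ T.map (S.ev Q) ≫ S.algHom a b := by
  obtain ⟨⟨p, t⟩, rfl⟩ := Chain.ofPath_surjective Q
  dsimp only
  have h := S.ev_nested (Chain.single (H := Nested T A Z) ⟨p, s ≫ T.map (tensorLift t)⟩)
  simp only [Chain.hmap, Chain.join, Chain.nil_comp] at h
  refine Eq.trans (congrArg S.ev ?_) (h.trans ((S.ev_single _).trans ?_))
  · rw [Chain.hmap_ofPath]
    refine congrArg (Chain.ofPath (H := THom T A Z) p) (funext fun j => ?_)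
    rw [Category.assoc, ← T.map_comp_assoc, tensorLift_proj]
  · simp only [Nested.incl, Category.assoc, ← T.map_comp_assoc, ev, el_ofPath]

/-- The homs, as algebras. -/
@[reducible] def alg (a b : A.Obj) : T.Algebra where
  A := A.hom a b
  a := S.algHom a b
  unit := (S.ev_single _).symm.trans (by simpa using S.ev_single_unit (𝟙 (A.hom a b)))
  assoc := by
    have h := S.ev_hmap_map (𝟙 _) (Chain.single (H := THom T A _) (𝟙 (T.obj (A.hom a b))))
    simp only [Chain.single, Chain.hmap, T.map_id, Category.id_comp] at h
    exact (S.ev_single _).symm.trans h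

/-- Composition of chains of elements of the homs. -/
def compose {Z : V} {a b : A.Obj} (R : Chain (AlgHom S.alg Z) a b) : AlgHom S.alg Z a b :=
  S.ev (R.hmap (K := THom T A Z) fun {_ _} x => x ≫ T.η.app _)

theorem compose_single {Z : V} {a b : A.Obj} (x : AlgHom S.alg Z a b) :
    S.compose (Chain.single x) = x :=
  S.ev_single_unit x

theorem compose_join {Z : V} {a b : A.Obj} (P : Chain (Chain (AlgHom S.alg Z)) a b) :
    S.compose P.join = S.compose (P.hmap (K := AlgHom S.alg Z) S.compose) := by
  rw [compose, Chain.hmap_join, ev_join, compose, Chain.hmap_hmap, Chain.hmap_hmap]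
  rfl

theorem comp_compose {Z Z' : V} (z : Z' ⟶ Z) {a b : A.Obj} (R : Chain (AlgHom S.alg Z) a b) :
    z ≫ S.compose R = S.compose (R.hmap (K := AlgHom S.alg Z') fun {_ _} x => z ≫ x) := by
  rw [compose, comp_ev, compose, Chain.hmap_hmap, Chain.hmap_hmap]
  refine congrArg S.ev (Chain.hmap_congr (fun a b e =>
    (Category.assoc z e (T.η.app (A.hom a b))).symm) R)

theorem map_compose {Z : V} {a b : A.Obj} (R : Chain (AlgHom S.alg Z) a b) :
    T.map (S.compose R) ≫ S.algHom a b =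
      S.compose (R.hmap (K := AlgHom S.alg (T.obj Z)) fun {a b} x => T.map x ≫ S.algHom a b) := by
  have h := S.ev_hmap_map (𝟙 (T.obj Z)) (R.hmap (K := THom T A Z) fun {_ _} x => x ≫ T.η.app _)
  rw [Category.id_comp] at h
  refine h.symm.trans ?_
  -- A chain is the join of its one-member chains, so `ev_join` replaces every member `T.map x` by
  -- its action followed by the unit, which is the form used in `compose`.
  have h₂ := S.ev_join ((R.hmap (K := THom T A (T.obj Z)) fun {_ _} x => T.map x).hmap
    (K := Chain (THom T A (T.obj Z))) fun {_ _} t => Chain.single t)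
  rw [Chain.hmap_hmap, Chain.hmap_hmap] at h₂
  have h₃ : (R.hmap (K := Chain (THom T A (T.obj Z))) fun {_ _} x =>
      Chain.single (T.map x)).join = R.hmap (K := THom T A (T.obj Z)) fun {_ _} x => T.map x := by
    clear h h₂
    induction R with
    | nil => rfl
    | cons R e ih => exact congrArg (Chain.cons · _) ih
  rw [h₃] at h₂
  rw [Chain.hmap_hmap, compose, Chain.hmap_hmap]
  refine Eq.trans (congrArg S.ev (Chain.hmap_congr (fun a b e => ?_) R)) (h₂.trans
    (congrArg S.ev (Chain.hmap_congr (fun a b e => ?_) R)))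
  · rw [Category.id_comp, T.map_comp, Category.assoc, T.right_unit, Category.comp_id]
  · rw [ev_single]

/-- The compositions given by an action of `Γ (T^×)`. -/
def ops : HomOps S.alg where
  one Z a := S.compose Chain.nil
  mul x y := S.compose (Chain.cons (Chain.single x) y)
  -- Each law evaluates a chain of chains in two ways by `compose_join`. For the unit laws one inner
  -- chain is empty; for associativity two bracketings have the same join.
  one_mul {Z a b} x := by
    have h := S.compose_join (Chain.cons (Chain.single (H := Chain (AlgHom S.alg Z))
      (Chain.nil : Chain (AlgHom S.alg Z) a a)) (Chain.single x))
    simp only [Chain.single, Chain.hmap, Chain.join, Chain.comp] at h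
    exact (h.trans (congrArg (fun y => S.compose (Chain.cons (Chain.single _) y))
      (S.compose_single x))).symm.trans (S.compose_single x)
  mul_one {Z a b} x := by
    have h := S.compose_join (Chain.cons (Chain.single (H := Chain (AlgHom S.alg Z))
      (Chain.single x)) (Chain.nil : Chain (AlgHom S.alg Z) b b))
    simp only [Chain.single, Chain.hmap, Chain.join, Chain.comp] at h
    exact (h.trans (congrArg (fun y => S.compose (Chain.cons (Chain.single y) _))
      (S.compose_single x))).symm.trans (S.compose_single x)
  mul_assoc {Z a b c d} x y z := by
    have h := S.compose_join (Chain.cons (Chain.single (H := Chain (AlgHom S.alg Z))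
      (Chain.cons (Chain.single x) y)) (Chain.single z))
    have h' := S.compose_join (Chain.cons (Chain.single (H := Chain (AlgHom S.alg Z))
      (Chain.single x)) (Chain.cons (Chain.single y) z))
    simp only [Chain.single, Chain.hmap, Chain.join, Chain.comp] at h h'
    have h₁ := h.trans (congrArg (fun y => S.compose (Chain.cons (Chain.single _) y))
      (S.compose_single z))
    have h₂ := h'.trans (congrArg (fun y => S.compose (Chain.cons (Chain.single y) _))
      (S.compose_single x))
    exact h₁.symm.trans h₂
  comp_one z a := S.comp_compose z _
  comp_mul z _ _ _ x y := S.comp_compose z _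
  map_one Z a := S.map_compose _
  map_mul x y := S.map_compose _

theorem ops_fold {Z : V} {a b : A.Obj} (R : Chain (AlgHom S.alg Z) a b) :
    S.ops.fold R = S.compose R := by
  induction R with
  | nil => rfl
  | @cons b c R e ih =>
    have h := S.compose_join (Chain.cons (Chain.single (H := Chain (AlgHom S.alg Z)) R)
      (Chain.single e))
    simp only [Chain.single, Chain.hmap, Chain.join, Chain.comp, Chain.nil_comp] at h
    exact (congrArg (S.ops.mul · e) ih).trans
      (h.trans (congrArg (fun y => S.compose (Chain.cons (Chain.single _) y))
        (S.compose_single e))).symm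

/-- A chain is the join of its one-member chains. Hence by `ev_join` its value depends only on the
T-actions of its members and on the compositions, so nothing of the original action is lost. -/
theorem ops_act (a b : A.Obj) : S.ops.act a b = S.act a b := by
  refine gammaHom_ext_el fun Z P => ?_
  refine (S.ops.el_act P).trans ?_
  rw [ops_fold, compose, Chain.hmap_hmap]
  have h := S.ev_join (P.hmap (K := Chain (THom T A Z)) fun {_ _} t => Chain.single t)
  have h₃ : (P.hmap (K := Chain (THom T A Z)) fun {_ _} t => Chain.single t).join = P := by
    clear h
    induction P with
    | nil => rfl
    | cons R e ih => exact congrArg (Chain.cons · _) ih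
  rw [h₃, Chain.hmap_hmap] at h
  refine Eq.trans (congrArg S.ev (Chain.hmap_congr (fun a b e => ?_) P)) h.symm
  rw [ev_single]

end GammaAction

theorem HomOps.exists_algebra_eq (𝔸 : (Multitensor.gamma hE).Algebra) :
    ∃ (O : Type u) (X : O → O → T.Algebra) (S : HomOps X), S.algebra hE = 𝔸 := by
  obtain ⟨A, ⟨a₀, a₁⟩, hu, ha⟩ := 𝔸
  -- The unit of the monad is the identity on objects, so the unit law forces the structure map to
  -- be the identity on objects too.
  obtain rfl : a₀ = fun a => a := congrArg EGraph.Hom.obj hu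
  let S : GammaAction hE A :=
    { act := a₁
      unit := fun a b => (EGraph.map_eq_of_eq hu a b).trans (Category.comp_id _)
      mul := fun a b => (EGraph.map_eq_of_eq ha a b).trans (Category.comp_id _) }
  refine ⟨A.Obj, S.alg, S.ops, ?_⟩
  have h : ∀ (a : (Multitensor.gamma hE).obj A ⟶ A) hu' ha', a = EGraph.Hom.mk (X := timesGamma T A) (Y := A) (fun a => a)
        a₁ →
        (⟨A, a, hu', ha'⟩ : (Multitensor.gamma hE).Algebra) = ⟨A, ⟨fun a => a, a₁⟩, hu, ha⟩ := by
    rintro _ _ _ rfl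
    rfl
  exact h _ _ _ (EGraph.mk_ext S.ops_act)

end GammaAlgebra

/-! ### Enriched categories as families of algebras with compositions -/

section Enriched

open MonoidalCategory CartesianMonoidalCategory

theorem HomOps.IsHom.inv {V : Type (u + 1)} [LargeCategory.{u} V] {T : Monad V} {O : Type u}
    {X X' : O → O → T.Algebra} {S : HomOps X} {S' : HomOps X'} {φ : ∀ a b, X a b ≅ X' a b}
    (h : HomOps.IsHom S S' (fun a => a) (fun a b => (φ a b).hom)) :
    HomOps.IsHom S' S (fun a => a) (fun a b => (φ a b).inv) where
  one Z a := by
    rw [← h.one Z a, Category.assoc, ← Monad.Algebra.comp_f, Iso.hom_inv_id]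
    exact Category.comp_id _
  mul {Z a b c} x y := by
    have h' := congrArg (· ≫ (φ a c).inv.f) (h.mul (x ≫ (φ a b).inv.f) (y ≫ (φ b c).inv.f))
    simp only [Category.assoc, ← Monad.Algebra.comp_f, Iso.hom_inv_id, Iso.inv_hom_id] at h'
    simpa using h'.symm

variable {V : Type (u + 1)} [LargeCategory.{u} V] {T : Monad V}
  {D : Type (u + 1)} [LargeCategory.{u} D] [CartesianMonoidalCategory D] (K : D ⥤ T.Algebra)

theorem map_comp_f {A B C : D} (f : A ⟶ B) (g : B ⟶ C) :
    (K.map (f ≫ g)).f = (K.map f).f ≫ (K.map g).f := by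
  rw [K.map_comp, Monad.Algebra.comp_f]

variable [K.IsEquivalence]

theorem map_f_injective {A B : D} {f g : A ⟶ B} (h : (K.map f).f = (K.map g).f) : f = g :=
  K.map_injective (Monad.Algebra.Hom.ext h)

/-- The equivalence `K` and the right adjoint `T.forget` preserve limits. Hence generalized elements
of a product in `D` are pairs, which is why enrichments in `D` can be expressed by operations on
generalized elements. -/
theorem preservesLimits_comp_forget : PreservesLimitsOfSize.{0, 0} (K ⋙ T.forget) :=
  have : PreservesLimitsOfSize.{0, 0} T.forget := T.adj.rightAdjoint_preservesLimits
  inferInstance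

/-- The unique generalized element of the underlying object of the unit. -/
def bang (Z : V) : Z ⟶ (K.obj (𝟙_ D)).A :=
  have := preservesLimits_comp_forget K
  (IsTerminal.isTerminalObj (K ⋙ T.forget) _ isTerminalTensorUnit).from Z

theorem bang_unique {Z : V} (f g : Z ⟶ (K.obj (𝟙_ D)).A) : f = g :=
  have := preservesLimits_comp_forget K
  (IsTerminal.isTerminalObj (K ⋙ T.forget) _ isTerminalTensorUnit).hom_ext f g

/-- The underlying object of a product is a product. -/
def forgetTensorIsLimit (A B : D) :
    IsLimit (BinaryFan.mk (P := (K.obj (A ⊗ B)).A) (X := (K.obj A).A) (Y := (K.obj B).A)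
      (K.map (fst A B)).f (K.map (snd A B)).f) :=
  have := preservesLimits_comp_forget K
  mapIsLimitOfPreservesOfIsLimit (K ⋙ T.forget) (fst A B) (snd A B)
    (tensorProductIsBinaryProduct A B)

variable {A B : D} {Z : V}

/-- The generalized element of a product given by a pair of generalized elements. -/
def pair (x : Z ⟶ (K.obj A).A) (y : Z ⟶ (K.obj B).A) : Z ⟶ (K.obj (A ⊗ B)).A :=
  (BinaryFan.IsLimit.lift' (forgetTensorIsLimit K A B) x y).1

@[simp]
theorem pair_fst (x : Z ⟶ (K.obj A).A) (y : Z ⟶ (K.obj B).A) :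
    pair K x y ≫ (K.map (fst A B)).f = x :=
  (BinaryFan.IsLimit.lift' (forgetTensorIsLimit K A B) x y).2.1

@[simp]
theorem pair_snd (x : Z ⟶ (K.obj A).A) (y : Z ⟶ (K.obj B).A) :
    pair K x y ≫ (K.map (snd A B)).f = y :=
  (BinaryFan.IsLimit.lift' (forgetTensorIsLimit K A B) x y).2.2

theorem pair_hom_ext {f g : Z ⟶ (K.obj (A ⊗ B)).A}
    (h₁ : f ≫ (K.map (fst A B)).f = g ≫ (K.map (fst A B)).f)
    (h₂ : f ≫ (K.map (snd A B)).f = g ≫ (K.map (snd A B)).f) : f = g :=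
  BinaryFan.IsLimit.hom_ext (forgetTensorIsLimit K A B) h₁ h₂

theorem comp_pair {Z' : V} (z : Z' ⟶ Z) (x : Z ⟶ (K.obj A).A) (y : Z ⟶ (K.obj B).A) :
    z ≫ pair K x y = pair K (z ≫ x) (z ≫ y) :=
  pair_hom_ext K (by simp) (by simp)

theorem map_pair (x : Z ⟶ (K.obj A).A) (y : Z ⟶ (K.obj B).A) :
    T.map (pair K x y) ≫ (K.obj (A ⊗ B)).a =
      pair K (T.map x ≫ (K.obj A).a) (T.map y ≫ (K.obj B).a) := by
  refine pair_hom_ext K ?_ ?_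
  · rw [Category.assoc, ← (K.map (fst A B)).h, ← T.map_comp_assoc, pair_fst, pair_fst]
  · rw [Category.assoc, ← (K.map (snd A B)).h, ← T.map_comp_assoc, pair_snd, pair_snd]

theorem pair_comp {A' B' : D} (x : Z ⟶ (K.obj A).A) (y : Z ⟶ (K.obj B).A) (f : A ⟶ A')
    (g : B ⟶ B') : pair K x y ≫ (K.map (f ⊗ₘ g)).f = pair K (x ≫ (K.map f).f) (y ≫ (K.map g).f) := by
  refine pair_hom_ext K ?_ ?_
  · rw [Category.assoc, ← map_comp_f, tensorHom_fst, map_comp_f, ← Category.assoc, pair_fst,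
      pair_fst]
  · rw [Category.assoc, ← map_comp_f, tensorHom_snd, map_comp_f, ← Category.assoc, pair_snd,
      pair_snd]

theorem pair_whiskerRight {A' : D} (x : Z ⟶ (K.obj A).A) (y : Z ⟶ (K.obj B).A) (f : A ⟶ A') :
    pair K x y ≫ (K.map (f ▷ B)).f = pair K (x ≫ (K.map f).f) y := by
  rw [← tensorHom_id, pair_comp, K.map_id]
  exact congrArg _ (Category.comp_id _)

theorem pair_whiskerLeft {B' : D} (x : Z ⟶ (K.obj A).A) (y : Z ⟶ (K.obj B).A) (g : B ⟶ B') :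
    pair K x y ≫ (K.map (A ◁ g)).f = pair K x (y ≫ (K.map g).f) := by
  rw [← id_tensorHom, pair_comp, K.map_id]
  exact congrArg (pair K · _) (Category.comp_id _)

theorem comp_leftUnitor_inv (x : Z ⟶ (K.obj A).A) :
    x ≫ (K.map (λ_ A).inv).f = pair K (bang K Z) x := by
  refine pair_hom_ext K (bang_unique K _ _) ?_
  rw [Category.assoc, ← map_comp_f, leftUnitor_inv_snd, K.map_id, pair_snd]
  exact Category.comp_id _

theorem comp_rightUnitor_inv (x : Z ⟶ (K.obj A).A) :
    x ≫ (K.map (ρ_ A).inv).f = pair K x (bang K Z) := by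
  refine pair_hom_ext K ?_ (bang_unique K _ _)
  rw [Category.assoc, ← map_comp_f, rightUnitor_inv_fst, K.map_id, pair_fst]
  exact Category.comp_id _

theorem pair_associator_inv {C : D} (x : Z ⟶ (K.obj A).A) (y : Z ⟶ (K.obj B).A)
    (z : Z ⟶ (K.obj C).A) :
    pair K x (pair K y z) ≫ (K.map (α_ A B C).inv).f = pair K (pair K x y) z := by
  refine pair_hom_ext K (pair_hom_ext K ?_ ?_) ?_
  · rw [pair_fst, pair_fst, Category.assoc, Category.assoc, ← map_comp_f, ← map_comp_f,
      associator_inv_fst_fst, pair_fst]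
  · rw [pair_fst, pair_snd, Category.assoc, Category.assoc, ← map_comp_f, ← map_comp_f,
      associator_inv_fst_snd, map_comp_f, ← Category.assoc, pair_snd, pair_fst]
  · rw [pair_snd, Category.assoc, ← map_comp_f,
      associator_inv_snd, map_comp_f, ← Category.assoc, pair_snd, pair_snd]

/-- The algebras underlying the homs of an enriched category. -/
@[reducible] def vcatAlg (𝒜 : VCat D) (a b : 𝒜.carrier) : T.Algebra :=
  K.obj (EnrichedCategory.Hom (V := D) a b)

/-- The compositions of generalized elements of the homs of an enriched category. -/
def vcatOps (𝒜 : VCat D) : HomOps (vcatAlg K 𝒜) where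
  one Z a := bang K Z ≫ (K.map (eId D a)).f
  mul {Z a b c} x y := pair K x y ≫ (K.map (eComp D a b c)).f
  one_mul {Z a b} x := by
    have h := congrArg (fun k => x ≫ (K.map k).f) (e_id_comp D a b)
    simp only [map_comp_f, K.map_id] at h
    simp only [← Category.assoc] at h
    rw [comp_leftUnitor_inv, pair_whiskerRight] at h
    exact h.trans (Category.comp_id _)
  mul_one {Z a b} x := by
    have h := congrArg (fun k => x ≫ (K.map k).f) (e_comp_id D a b)
    simp only [map_comp_f, K.map_id] at h
    simp only [← Category.assoc] at h
    rw [comp_rightUnitor_inv, pair_whiskerLeft] at h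
    exact h.trans (Category.comp_id _)
  mul_assoc {Z a b c d} x y z := by
    have h := congrArg (fun k => pair K x (pair K y z) ≫ (K.map k).f) (e_assoc D a b c d)
    simp only [map_comp_f] at h
    simp only [← Category.assoc] at h
    rwa [pair_associator_inv, pair_whiskerRight, pair_whiskerLeft] at h
  comp_one z a := by rw [← Category.assoc]; exact congrArg (· ≫ _) (bang_unique K _ _)
  comp_mul z _ _ _ x y := by rw [← Category.assoc, comp_pair]
  map_one Z a := by
    rw [T.map_comp, Category.assoc, (K.map (eId D a)).h, ← Category.assoc]
    exact congrArg (· ≫ _) (bang_unique K _ _)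
  map_mul {Z a b c} x y := by
    rw [T.map_comp, Category.assoc, (K.map (eComp D a b c)).h, ← Category.assoc, map_pair]

theorem vcatOps_isHom {𝒜 ℬ : VCat D} (F : 𝒜 ⟶ ℬ) :
    HomOps.IsHom (vcatOps K 𝒜) (vcatOps K ℬ) (EnrichedFunctor.obj F)
      (fun a b => K.map (EnrichedFunctor.map F a b)) where
  one Z a := by
    dsimp only [vcatOps]
    rw [Category.assoc, ← map_comp_f, EnrichedFunctor.map_id]
  mul {Z a b c} x y := by
    dsimp only [vcatOps]
    rw [Category.assoc, ← map_comp_f, EnrichedFunctor.map_comp, map_comp_f, ← Category.assoc,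
      pair_comp]

/-- The enriched functor given by a morphism of families of algebras with compositions. -/
def vcatHomOfIsHom {𝒜 ℬ : VCat D} (f : 𝒜.carrier → ℬ.carrier)
    (φ : ∀ a b, vcatAlg K 𝒜 a b ⟶ vcatAlg K ℬ (f a) (f b))
    (h : HomOps.IsHom (vcatOps K 𝒜) (vcatOps K ℬ) f φ) : 𝒜 ⟶ ℬ where
  obj := f
  map a b := K.preimage (φ a b)
  map_id a := map_f_injective K (by
    have := h.one (K.obj (𝟙_ D)).A a
    rw [map_comp_f, K.map_preimage]
    dsimp only [vcatOps] at this
    rw [bang_unique K (bang K _) (𝟙 _), Category.id_comp, Category.id_comp] at this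
    exact this)
  map_comp a b c := map_f_injective K (by
    -- The universal instance is used: the pair of the two projections is the identity, so the law
    -- for this single pair gives the law for morphisms.
    have := h.mul (K.map (fst (EnrichedCategory.Hom (V := D) a b) (EnrichedCategory.Hom b c))).f
      (K.map (snd (EnrichedCategory.Hom (V := D) a b) (EnrichedCategory.Hom b c))).f
    have hp : pair K (K.map (fst (EnrichedCategory.Hom (V := D) a b) (EnrichedCategory.Hom b c))).f
      (K.map (snd (EnrichedCategory.Hom (V := D) a b) (EnrichedCategory.Hom b c))).f = 𝟙 _ :=
      pair_hom_ext K (by simp) (by simp)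
    dsimp only [vcatOps] at this
    rw [hp, Category.id_comp] at this
    rw [map_comp_f, K.map_preimage, this, map_comp_f]
    congr 1
    refine Eq.trans ?_ (Category.id_comp _)
    rw [← hp, pair_comp, K.map_preimage, K.map_preimage])

section

variable {O : Type u} {X : O → O → T.Algebra} (S : HomOps X) {Y : O → O → D}
  (φ : ∀ a b, K.obj (Y a b) ≅ X a b)

/-- The identities given by a family of algebras with compositions. -/
def opsId (a : O) : 𝟙_ D ⟶ Y a a :=
  K.preimage ((Monad.Algebra.Hom.mk (S.one (K.obj (𝟙_ D)).A a)
    (by rw [S.map_one, S.comp_one]) : K.obj (𝟙_ D) ⟶ X a a) ≫ (φ a a).inv)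

/-- The compositions given by a family of algebras with compositions. -/
def opsComp (a b c : O) : Y a b ⊗ Y b c ⟶ Y a c :=
  K.preimage ((Monad.Algebra.Hom.mk
    (S.mul ((K.map (fst (Y a b) (Y b c))).f ≫ (φ a b).hom.f)
      ((K.map (snd (Y a b) (Y b c))).f ≫ (φ b c).hom.f))
    (by
      have h₁ := (K.map (fst (Y a b) (Y b c)) ≫ (φ a b).hom).h
      have h₂ := (K.map (snd (Y a b) (Y b c)) ≫ (φ b c).hom).h
      rw [Monad.Algebra.comp_f] at h₁ h₂
      rw [S.map_mul, S.comp_mul, h₁, h₂]) : K.obj (Y a b ⊗ Y b c) ⟶ X a c) ≫ (φ a c).inv)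

theorem comp_opsId (a : O) (z : Z ⟶ (K.obj (𝟙_ D)).A) :
    z ≫ (K.map (opsId K S φ a)).f ≫ (φ a a).hom.f = S.one Z a := by
  rw [← Monad.Algebra.comp_f, opsId, K.map_preimage, Category.assoc, Iso.inv_hom_id,
    Category.comp_id, S.comp_one]

theorem pair_opsComp {a b c : O} (x : Z ⟶ (K.obj (Y a b)).A) (y : Z ⟶ (K.obj (Y b c)).A) :
    pair K x y ≫ (K.map (opsComp K S φ a b c)).f ≫ (φ a c).hom.f =
      S.mul (x ≫ (φ a b).hom.f) (y ≫ (φ b c).hom.f) := by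
  rw [← Monad.Algebra.comp_f, opsComp, K.map_preimage, Category.assoc, Iso.inv_hom_id,
    Category.comp_id, S.comp_mul, ← Category.assoc, ← Category.assoc, pair_fst, pair_snd]

/-- The identity is the universal generalized element; `K` and the forgetful functor of algebras are
faithful. -/
theorem ops_hom_ext {C : D} {a b : O} {f g : C ⟶ Y a b}
    (h : ∀ (Z : V) (z : Z ⟶ (K.obj C).A), z ≫ (K.map f).f ≫ (φ a b).hom.f =
      z ≫ (K.map g).f ≫ (φ a b).hom.f) : f = g := by
  have := h _ (𝟙 _)
  rw [Category.id_comp, Category.id_comp, ← Monad.Algebra.comp_f, ← Monad.Algebra.comp_f] at this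
  have h' := Monad.Algebra.Hom.ext this
  exact K.map_injective ((cancel_mono _).1 h')

theorem exists_pair {A B : D} (z : Z ⟶ (K.obj (A ⊗ B)).A) : ∃ x y, z = pair K x y :=
  ⟨z ≫ (K.map (fst A B)).f, z ≫ (K.map (snd A B)).f,
    pair_hom_ext K (pair_fst K _ _).symm (pair_snd K _ _).symm⟩

/-- The enriched category given by a family of algebras with compositions. -/
def opsVCat : VCat D where
  carrier := O
  str :=
    { Hom := Y
      id := opsId K S φ
      comp := opsComp K S φ
      id_comp := fun a b => ops_hom_ext K φ fun _ z => by
        simp only [map_comp_f, Category.assoc]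
        rw [← Category.assoc, comp_leftUnitor_inv, ← Category.assoc, pair_whiskerRight,
          pair_opsComp, Category.assoc, comp_opsId, S.one_mul, K.map_id]
        exact congrArg (z ≫ ·) (Category.id_comp _).symm
      comp_id := fun a b => ops_hom_ext K φ fun _ z => by
        simp only [map_comp_f, Category.assoc]
        rw [← Category.assoc, comp_rightUnitor_inv, ← Category.assoc, pair_whiskerLeft,
          pair_opsComp, Category.assoc, comp_opsId, S.mul_one, K.map_id]
        exact congrArg (z ≫ ·) (Category.id_comp _).symm
      assoc := fun a b c d => ops_hom_ext K φ fun _ w => by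
        -- An element of a threefold product is split into its components, on which associativity is
        -- that of `S`.
        obtain ⟨x, w, rfl⟩ := exists_pair K w
        obtain ⟨y, z, rfl⟩ := exists_pair K w
        simp only [map_comp_f, Category.assoc]
        rw [← Category.assoc, pair_associator_inv, ← Category.assoc, pair_whiskerRight,
          pair_opsComp, Category.assoc, pair_opsComp, ← Category.assoc, pair_whiskerLeft,
          pair_opsComp, Category.assoc, pair_opsComp, S.mul_assoc] }

theorem opsVCat_isHom :
    HomOps.IsHom (vcatOps K (opsVCat K S φ)) S (fun a => a) (fun a b => (φ a b).hom) where
  one _ a := (Category.assoc _ _ _).trans (comp_opsId K S φ a _)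
  mul x y := (Category.assoc _ _ _).trans (pair_opsComp K S φ x y)

end

variable [HasFiniteProducts V] [HasCoproducts.{u} V] (hE : (timesMultitensor T).IsDistributive)

/-- The functor from enriched categories to algebras of `Γ (T^×)`. -/
def vcatToAlgebra : VCat D ⥤ (Multitensor.gamma hE).Algebra where
  obj 𝒜 := (vcatOps K 𝒜).algebra hE
  map F := (vcatOps_isHom K F).algebraHom hE
  map_id _ := Monad.Algebra.Hom.ext (EGraph.mk_ext fun _ _ =>
    congrArg Monad.Algebra.Hom.f (K.map_id _))
  map_comp _ _ := Monad.Algebra.Hom.ext (EGraph.mk_ext fun _ _ => map_comp_f K _ _)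

/-- Every algebra comes from compositions on a family of T-algebras, and every morphism of algebras
from a morphism of such families. Replacing the algebras by isomorphic ones in the image of `K` and
lifting the operations through `K` gives an enriched category, whose algebra is isomorphic to the
given one. -/
theorem vcatToAlgebra_isEquivalence : (vcatToAlgebra K hE).IsEquivalence where
  faithful := ⟨fun {𝒜 ℬ F G} h => by
    have h₁ : EGraph.Hom.mk (X := algGraph (vcatAlg K 𝒜)) (Y := algGraph (vcatAlg K ℬ))
        (EnrichedFunctor.obj F) (fun a b => (K.map (EnrichedFunctor.map F a b)).f) =
        EGraph.Hom.mk (X := algGraph (vcatAlg K 𝒜)) (Y := algGraph (vcatAlg K ℬ))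
          (EnrichedFunctor.obj G) (fun a b => (K.map (EnrichedFunctor.map G a b)).f) :=
      congrArg Monad.Algebra.Hom.f h
    obtain ⟨F₀, F₁, _, _⟩ := F
    obtain ⟨G₀, G₁, _, _⟩ := G
    obtain rfl : F₀ = G₀ := congrArg EGraph.Hom.obj h₁
    obtain rfl : F₁ = G₁ := funext fun a => funext fun b => map_f_injective K
      ((EGraph.map_eq_of_eq h₁ a b).trans (Category.comp_id _))
    rfl⟩
  full := ⟨fun {𝒜 ℬ} g => by
    obtain ⟨f, φ, h, rfl⟩ := HomOps.exists_isHom hE g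
    exact ⟨vcatHomOfIsHom K f φ h, Monad.Algebra.Hom.ext (EGraph.mk_ext fun a b =>
      congrArg Monad.Algebra.Hom.f (K.map_preimage _))⟩⟩
  essSurj := ⟨fun 𝔸 => by
    obtain ⟨O, X, S, rfl⟩ := HomOps.exists_algebra_eq hE 𝔸
    let φ : ∀ a b, K.obj (K.objPreimage (X a b)) ≅ X a b := fun a b => K.objObjPreimageIso _
    exact ⟨opsVCat K S φ, ⟨{
      hom := (opsVCat_isHom K S φ).algebraHom hE
      inv := (HomOps.IsHom.inv (opsVCat_isHom K S φ)).algebraHom hE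
      hom_inv_id := Monad.Algebra.Hom.ext (EGraph.mk_ext fun a b =>
        congrArg Monad.Algebra.Hom.f (φ a b).hom_inv_id)
      inv_hom_id := Monad.Algebra.Hom.ext (EGraph.mk_ext fun a b =>
        congrArg Monad.Algebra.Hom.f (φ a b).inv_hom_id) }⟩⟩⟩

end Enriched

/-! ### Monadicity from an equivalence with a category of algebras -/

section Monadicity

variable {C : Type*} [Category* C] {D : Type*} [Category* D] {T : Monad C} (K : D ⥤ T.Algebra)
  [K.IsEquivalence]

/-- The free functor transported along an equivalence with the category of algebras. -/
def freeAdj : T.free ⋙ K.inv ⊣ K ⋙ T.forget :=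
  T.adj.comp K.asEquivalence.symm.toAdjunction

/-- The counit of the composite adjunction is the counit of `T.adj`, which is the structure map,
transported through `K`. A triangle identity and the naturality of the counit of the equivalence
bring the structure map out. -/
theorem map_freeAdj_counit_f (A : D) : (K.map ((freeAdj K).counit.app A)).f =
    (K.asEquivalence.counitIso.hom.app (T.free.obj (K.obj A).A)).f ≫ (K.obj A).a := by
  have h : (freeAdj K).counit.app A =
      K.inv.map (T.adj.counit.app (K.obj A)) ≫ K.asEquivalence.unitIso.inv.app A :=
    (Adjunction.comp_counit_app _ _ _).trans rfl
  have h₁ : K.map (K.asEquivalence.unitIso.inv.app A) =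
      K.asEquivalence.counitIso.hom.app (K.obj A) :=
    (K.asEquivalence.counit_app_functor A).symm
  have h₂ := K.asEquivalence.counitIso.hom.naturality (T.adj.counit.app (K.obj A))
  have h₃ : K.map ((freeAdj K).counit.app A) =
      K.asEquivalence.counitIso.hom.app (T.free.obj (K.obj A).A) ≫ T.adj.counit.app (K.obj A) :=
    (congrArg K.map h).trans ((K.map_comp _ _).trans
      ((congrArg (K.map (K.inv.map (T.adj.counit.app (K.obj A))) ≫ ·) h₁).trans h₂))
  have h₄ : (T.adj.counit.app (K.obj A)).f = (K.obj A).a := by simp; rfl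
  exact (congrArg Monad.Algebra.Hom.f h₃).trans (congrArg (_ ≫ ·) h₄)

theorem freeAdj_unit_app (X : C) : (freeAdj K).unit.app X =
    T.η.app X ≫ (K.asEquivalence.counitIso.inv.app (T.free.obj X)).f :=
  (Adjunction.comp_unit_app _ _ _).trans (congrArg₂ (· ≫ ·)
    (by simp; rfl : T.adj.unit.app X = T.η.app X)
    (congrArg (fun k => (k.app (T.free.obj X)).f) K.asEquivalence.symm.toAdjunction_unit))

/-- The monad induced by the transported adjunction. -/
def freeAdjMonadIso : (freeAdj K).toMonad ≅ T :=
  MonadIso.mk (NatIso.ofComponents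
    (fun X => T.forget.mapIso (K.asEquivalence.counitIso.app (T.free.obj X)))
    fun f => congrArg Monad.Algebra.Hom.f
      (K.asEquivalence.counitIso.hom.naturality (T.free.map f)))
    (fun X => by
      have h := congrArg Monad.Algebra.Hom.f
        (K.asEquivalence.counitIso.inv_hom_id_app (T.free.obj X))
      refine (congrArg (· ≫ _) (freeAdj_unit_app K X)).trans ((Category.assoc _ _ _).trans ?_)
      exact (congrArg (T.η.app X ≫ ·) h).trans (Category.comp_id _))
    -- Compatibility with the multiplications holds because the counit of the equivalence at a free
    -- algebra is a morphism of algebras (`h₂`) and is natural (`h₁`).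
    (fun X => by
      let ε : ∀ A, K.obj (K.inv.obj A) ⟶ A := fun A => K.asEquivalence.counitIso.hom.app A
      let M := K.obj (K.inv.obj (T.free.obj X))
      have h₁ : (K.map (K.inv.map (T.free.map (ε (T.free.obj X)).f))).f ≫ (ε (T.free.obj _)).f =
          (ε (T.free.obj M.A)).f ≫ T.map (ε (T.free.obj X)).f :=
        congrArg Monad.Algebra.Hom.f
          (K.asEquivalence.counitIso.hom.naturality (T.free.map (ε (T.free.obj X)).f))
      have h₂ : T.map (ε (T.free.obj X)).f ≫ T.μ.app X = M.a ≫ (ε (T.free.obj X)).f :=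
        (ε (T.free.obj X)).h
      have h₃ : (K.map ((freeAdj K).counit.app (K.inv.obj (T.free.obj X)))).f =
          (ε (T.free.obj M.A)).f ≫ M.a := map_freeAdj_counit_f K _
      refine (congrArg (· ≫ (ε (T.free.obj X)).f) h₃).trans ((Category.assoc _ _ _).trans
        ((congrArg ((ε (T.free.obj M.A)).f ≫ ·) h₂.symm).trans
          ((Category.assoc _ _ _).symm.trans (congrArg (· ≫ T.μ.app X) h₁.symm)))))

/-- Transporting algebras along the isomorphism of monads is an equivalence, and its composite with
the comparison functor is isomorphic to the equivalence `K`. -/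
theorem comparison_freeAdj_isEquivalence : (Monad.comparison (freeAdj K)).IsEquivalence := by
  have e : Monad.comparison (freeAdj K) ⋙
      (Monad.algebraEquivOfIsoMonads (freeAdjMonadIso K)).functor ≅ K :=
    NatIso.ofComponents (fun A => Monad.Algebra.isoMk (Iso.refl (K.obj A).A) (by
      have h : (K.asEquivalence.counitIso.inv.app (T.free.obj (K.obj A).A)).f ≫
          (K.map ((freeAdj K).counit.app A)).f = (K.obj A).a := by
        refine (congrArg (_ ≫ ·) (map_freeAdj_counit_f K A)).trans
          ((Category.assoc _ _ _).symm.trans ?_)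
        exact (congrArg (· ≫ (K.obj A).a) (congrArg Monad.Algebra.Hom.f
          (K.asEquivalence.counitIso.inv_hom_id_app (T.free.obj (K.obj A).A)))).trans
            (Category.id_comp _)
      exact (congrArg (· ≫ (K.obj A).a) (T.map_id _)).trans
        ((Category.id_comp _).trans (h.symm.trans (Category.comp_id _).symm))))
      fun f => Monad.Algebra.Hom.ext ((Category.comp_id _).trans (Category.id_comp _).symm)
  have : (Monad.comparison (freeAdj K) ⋙
      (Monad.algebraEquivOfIsoMonads (freeAdjMonadIso K)).functor).IsEquivalence :=
    Functor.isEquivalence_of_iso e.symm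
  exact Functor.isEquivalence_of_comp_right _
    (Monad.algebraEquivOfIsoMonads (freeAdjMonadIso K)).functor

end Monadicity

/-! ### The identity monad on sets -/

section Base

/-- The category of algebras of the identity monad. -/
def idToAlgebra (C : Type*) [Category* C] : C ⥤ (Monad.id C).Algebra where
  obj A := { A := A, a := 𝟙 A, unit := Category.comp_id _, assoc := rfl }
  map f := { f := f, h := (Category.comp_id _).trans (Category.id_comp _).symm }

instance (C : Type*) [Category* C] : (idToAlgebra C).IsEquivalence where
  faithful := ⟨fun h => congrArg Monad.Algebra.Hom.f h⟩
  full := ⟨fun g => ⟨g.f, rfl⟩⟩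
  essSurj := ⟨fun A => ⟨A.A, ⟨Monad.Algebra.isoMk (Iso.refl _) (by
    have h : A.a = 𝟙 A.A := (Category.id_comp _).symm.trans A.unit
    exact (Category.id_comp _).trans (h.trans (Category.comp_id _).symm))⟩⟩⟩

/-- The one-point set has no endomorphism but the identity, so a presheaf on this family is just a
set. -/
theorem cellFamily_type : CellFamily (fun _ : PUnit.{u + 1} => (PUnit.{u + 1} : Type u)) := by
  refine CellFamily.mk_of_exists inferInstance (fun i j => ?_) (fun {X Y f g} h => ?_)
    (fun {X Y} φ h => ?_) fun P => ?_
  · exact Finite.of_injective (β := PUnit) (fun _ => PUnit.unit) fun f g _ => by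
      ext
  · ext x
    exact ConcreteCategory.congr_hom (h PUnit.unit (TypeCat.ofHom fun _ => x)) PUnit.unit
  · refine ⟨TypeCat.ofHom fun x => φ PUnit.unit (TypeCat.ofHom fun _ => x) PUnit.unit, ?_⟩
    intro i x
    ext y
    rfl
  · let e : ∀ i : (InducedCategory (Type u) fun _ : PUnit.{u + 1} => (PUnit.{u + 1} : Type u))ᵒᵖ,
        ((cellNerve fun _ : PUnit.{u + 1} => (PUnit.{u + 1} : Type u)).obj
          (P.obj (Opposite.op PUnit.unit))).obj i ≅ P.obj i := fun i =>
      Equiv.toIso (X := (PUnit.{u + 1} : Type u) ⟶ P.obj (Opposite.op PUnit.unit)) ⟨fun f => f PUnit.unit, fun x => TypeCat.ofHom fun _ => x, fun f => rfl,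
        fun x => rfl⟩
    refine ⟨P.obj (Opposite.op PUnit.unit), ⟨NatIso.ofComponents e ?_⟩⟩
    rintro ⟨⟨⟩⟩ ⟨⟨⟩⟩ f
    obtain rfl : f = 𝟙 _ := Quiver.Hom.unop_inj (InducedCategory.hom_ext (by ext))
    exact ((congrArg (· ≫ _) (CategoryTheory.Functor.map_id _ _)).trans (Category.id_comp _)).trans
      ((congrArg (_ ≫ ·) (P.map_id _)).trans (Category.comp_id _)).symm

/-- For the identity functor, the identity of a cell is generic: the required lift is the given
morphism `y` itself. -/
theorem hasGenericFactorizations_id {C : Type (u + 1)} [LargeCategory.{u} C] {ι : Type u}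
    {G : ι → C} (h : ∀ i j, Finite (G i ⟶ G j)) : HasGenericFactorizations G (𝟭 C) := by
  intro i X x
  refine ⟨G i, 𝟙 _, x, Category.id_comp _, fun Y Z g h y hy => ?_, fun j => h j i⟩
  refine ⟨y, ⟨hy.trans (Category.id_comp _), Category.id_comp _⟩, ?_⟩
  rintro k ⟨-, rfl⟩
  exact (Category.id_comp _).symm

theorem equifibered_of_isIso_app {C D : Type*} [Category* C] [Category* D] {F G : C ⥤ D}
    (α : F ⟶ G) (h : ∀ X, IsIso (α.app X)) : NatTrans.Equifibered α := fun _ _ f =>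
  IsPullback.of_vert_isIso ⟨α.naturality f⟩

end Base

/-! ### The monads on globular sets -/

/-- The compatibility with the forgetful functors is kept as an equality: it can then be substituted
in the inductive step, where both sides agree definitionally, and it fixes the right adjoint exactly
in the theorem. -/
theorem exists_isEquivalence_globMonad : ∀ n,
    ∃ K : (StrictCat.{u} n).carrier ⥤ (globMonad.{u} n).Algebra,
      K.IsEquivalence ∧ K ⋙ (globMonad n).forget = forgetStrict n
  | 0 => ⟨idToAlgebra (Type u), inferInstanceAs (idToAlgebra (Type u)).IsEquivalence, rfl⟩
  | n + 1 => by
    obtain ⟨K, hK, hU⟩ := exists_isEquivalence_globMonad n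
    have hE := timesMultitensor_isDistributive (globSet_productsDistribute.{u} n)
      (globMonadAux n).1 (globMonadAux n).2
    refine ⟨vcatToAlgebra K hE, vcatToAlgebra_isEquivalence K hE, ?_⟩
    change _ = VCat.forget (StrictCat.{u} n).carrier ⋙ EGraph.mapFunctor (forgetStrict n)
    rw [← hU]
    rfl

/-- The properties are carried together because cartesianness of the new multiplication needs both
the old one and the old generic factorizations. Iterating `EGraph.cells` from the one-point set
yields the globes of dimensions 0 to n. -/
theorem exists_cellFamily_globMonad : ∀ n, ∃ (ι : Type u) (G : ι → GlobSet.{u} n),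
    CellFamily G ∧ HasGenericFactorizations G (globMonad n).toFunctor ∧
      NatTrans.Equifibered (globMonad.{u} n).η ∧ NatTrans.Equifibered (globMonad.{u} n).μ
  | 0 => ⟨PUnit, fun _ => (PUnit.{u + 1} : Type u), cellFamily_type,
      hasGenericFactorizations_id cellFamily_type.finite_hom,
      equifibered_of_isIso_app _ fun X => inferInstanceAs (IsIso (𝟙 X)),
      equifibered_of_isIso_app _ fun X => inferInstanceAs (IsIso (𝟙 X))⟩
  | n + 1 => by
    obtain ⟨ι, G, hG, hT, hη, hμ⟩ := exists_cellFamily_globMonad n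
    have hE := timesMultitensor_isDistributive (globSet_productsDistribute.{u} n)
      (globMonadAux n).1 (globMonadAux n).2
    have := Multitensor.hasInitial_of_hasCoproducts (GlobSet.{u} n)
    exact ⟨Option ι, EGraph.cells G, EGraph.cellFamily_cells hG,
      gamma_hasGenericFactorizations hE hG hT, gamma_η_equifibered hG hE hη,
      gamma_μ_equifibered hG hE (globMonadAux n).2 hT hμ⟩

theorem preservesColimitsOfShape_discrete {C D : Type (u + 1)} [LargeCategory.{u} C]
    [LargeCategory.{u} D] {F : C ⥤ D} (hF : PreservesCoproducts F) (J : Type u) :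
    PreservesColimitsOfShape (Discrete J) F where
  preservesColimit {Z} := by
    have : PreservesColimit (Discrete.functor (Z.obj ∘ Discrete.mk)) F := ⟨fun {c} hc => by
      obtain ⟨h⟩ := hF J _ c ⟨hc⟩
      exact ⟨(Cofan.isColimitMapCoconeEquiv _ _ _).symm h⟩⟩
    exact preservesColimit_of_iso_diagram F Discrete.natIsoFunctor.symm

end GlobularMonads

end

theorem mainTheorem7 (n : ℕ) :
    (∃ (F : GlobSet.{u} n ⥤ (StrictCat.{u} n).carrier) (adj : F ⊣ forgetStrict n),
      Nonempty (adj.toMonad ≅ globMonad n) ∧ (Monad.comparison adj).IsEquivalence) ∧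
    (∀ J : Type u, PreservesColimitsOfShape (Discrete J) (globMonad.{u} n).toFunctor) ∧
    PreservesFilteredColimitsOfSize.{u, u} (globMonad.{u} n).toFunctor ∧
    (∀ X : GlobSet.{u} n, (Over.post (X := X) (globMonad n).toFunctor).IsRightAdjoint) ∧
    NatTrans.Equifibered (globMonad.{u} n).η ∧ NatTrans.Equifibered (globMonad.{u} n).μ := by
  obtain ⟨K, hK, hU⟩ := exists_isEquivalence_globMonad.{u} n
  obtain ⟨ι, G, hG, hT, hη, hμ⟩ := exists_cellFamily_globMonad.{u} n
  refine ⟨?_, preservesColimitsOfShape_discrete (globMonadAux n).2,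
    hT.preservesFilteredColimitsOfSize hG, hT.isRightAdjoint_post hG, hη, hμ⟩
  -- The forgetful functor becomes `K` followed by that of the algebras, which is literally the
  -- right adjoint of `freeAdj K`.
  rw [← hU]
  exact ⟨_, freeAdj K, ⟨freeAdjMonadIso K⟩, comparison_freeAdj_isEquivalence K⟩
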